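/- Let $r\ge 1$ be an integer. Let $V:\mathbb R\to\mathbb R$ be $2\pi$-periodic of class $C^{r-1}$, such that $V^{(r)}$ exists except at finitely many points of each bounded interval and is piecewise continuous (with finite one-sided limits everywhere). For $h>0$ let $\mu_0\le\mu_1\le\mu_2\le\dots$ ($\mu_n=\mu_n(h)$) be the eigenvalues, counted with multiplicity, of the periodic problem $$h^2y''+(\mu-V)y=0,\qquad y(x+2\pi)=y(x).$$ There are coefficients $A_1,\dots,A_{r+1}$, independent of $m$, each of them given by an expression that is independent of $V$ and is a polynomial in $h$ and in finitely many integrals $\int_{-\pi}^{\pi}F(V,V',\dots,V^{(r-1)})\,dx$ with $F$ polynomial, in particular $$A_1=\frac1{4\pi}\int_{-\pi}^{\pi}V\,dx,\qquad A_2=0,\qquad A_3=\frac1{16\pi}\int_{-\pi}^{\pi}V^2\,dx-A_1^2\quad(\text{the last one if } r\ge 2),$$ such that the following holds. (a) For each $h>0$, both $\mu=\mu_{2m+1}$ and $\mu=\mu_{2m+2}$ are positive for all large $m$ and satisfy, as $m\to\infty$, $$\sqrt{\mu}=(m+1)h+\sum_{k=1}^{r+1}\frac{A_k}{(m+1)^kh^k}+O\!\left(\frac1{m^{r+2}h^{r+2}}\right)+o\!\left(\frac1{m^{r+1}h^{r-2}}\right).$$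 (b) The estimate is uniform in $h$ in the following sense. For every $h_0>0$ there are constants $C$, $K>0$ and a sequence $\varepsilon_m\to0$ (depending only on $r,V,h_0$) such that for all $h\in(0,h_0]$ and all $m$ with $mh\ge K$, both $\mu=\mu_{2m+1}$ and $\mu=\mu_{2m+2}$ are positive and satisfy $$\left|\sqrt{\mu}-(m+1)h-\sum_{k=1}^{r+1}\frac{A_k}{(m+1)^kh^k}\right|\le\frac{C}{m^{r+2}h^{r+2}}+\frac{\varepsilon_m}{m^{r+1}h^{\max(1,r-2)}}.$$ -/

import Mathlib

open Real Filter Topology Asymptotics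

namespace PeriodicSL

/-- `g` is piecewise continuous on the line: in every bounded interval it has only finitely many
discontinuities, and it has finite one-sided limits at every point. -/
def IsPiecewiseContinuous (g : ℝ → ℝ) : Prop :=
  (∀ a b : ℝ, ({x | ¬ ContinuousAt g x} ∩ Set.Icc a b).Finite) ∧
  ∀ x : ℝ, (∃ l : ℝ, Tendsto g (𝓝[<] x) (𝓝 l)) ∧ (∃ l : ℝ, Tendsto g (𝓝[>] x) (𝓝 l))

/-- `V` (for `r ≥ 1`) has an `r`-th derivative that is piecewise continuous: `V` is of class
`C^(r-1)`, its `(r-1)`-st derivative is differentiable except at finitely many points of every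
bounded interval, and the `r`-th derivative is piecewise continuous. (At the exceptional points
the function `iteratedDeriv r V` takes a default value, which plays no role.) -/
structure HasPiecewiseContinuousDeriv (r : ℕ) (V : ℝ → ℝ) : Prop where
  contDiff : ContDiff ℝ ((r - 1 : ℕ) : WithTop ℕ∞) V
  differentiableAt : ∀ a b : ℝ,
    ({x | ¬ DifferentiableAt ℝ (iteratedDeriv (r - 1) V) x} ∩ Set.Icc a b).Finite
  piecewise : IsPiecewiseContinuous (iteratedDeriv r V)

/-- `y` is a `2π`-periodic solution of `h² y'' + (μ - V) y = 0`. -/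
structure IsPeriodicSolution (V : ℝ → ℝ) (h μ : ℝ) (y : ℝ → ℝ) : Prop where
  contDiff : ContDiff ℝ 2 y
  periodic : Function.Periodic y (2 * π)
  equation : ∀ x, h ^ 2 * deriv (deriv y) x + (μ - V x) * y x = 0

/-- The `n`-th eigenvalue (`n = 0, 1, 2, …`) of the periodic problem `h² y'' + (μ - V) y = 0`, in
ascending order and counted with multiplicity: the least `lam` such that there are `n + 1`
linearly independent eigenfunctions whose eigenvalues are at most `lam`. -/
noncomputable def eigenvalue (V : ℝ → ℝ) (h : ℝ) (n : ℕ) : ℝ :=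
  sInf {lam : ℝ | ∃ y : Fin (n + 1) → ℝ → ℝ, LinearIndependent ℝ y ∧
    ∀ i, ∃ μ ≤ lam, IsPeriodicSolution V h μ (y i)}

/-- `∫_{-π}^{π} F(V(x), V'(x), …, V^(r-1)(x)) dx` for a polynomial `F` in `r` variables. -/
noncomputable def diffIntegral {r : ℕ} (F : MvPolynomial (Fin r) ℝ) (V : ℝ → ℝ) : ℝ :=
  ∫ x in (-π)..π, MvPolynomial.eval (fun i : Fin r => iteratedDeriv (i : ℕ) V x) F

/-- The quantity `A h V` is given by a fixed expression in `V` and its derivatives up to order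
`r - 1`: a polynomial (not depending on `V` and `h`) in `h` and in finitely many integrals over
`[-π, π]` of polynomials in `V, V', …, V^(r-1)`. -/
def IsDiffPolyFunctional (r : ℕ) (A : ℝ → (ℝ → ℝ) → ℝ) : Prop :=
  ∃ (s : ℕ) (F : Fin s → MvPolynomial (Fin r) ℝ) (Q : MvPolynomial (Option (Fin s)) ℝ),
    ∀ (h : ℝ) (V : ℝ → ℝ),
      A h V = MvPolynomial.eval (fun o => o.elim h (fun j => diffIntegral (F j) V)) Q

/-- The partial sum `(m+1) h + ∑_{k=1}^{r+1} A_k / ((m+1)^k h^k)`. -/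
noncomputable def expansion (r : ℕ) (A : ℕ → ℝ) (h : ℝ) (m : ℕ) : ℝ :=
  (m + 1) * h + ∑ k ∈ Finset.Icc 1 (r + 1), A k / (((m : ℝ) + 1) ^ k * h ^ k)

end PeriodicSL

/-! The equation is the system `h y' = Y`, `h Y' = -(μ - V) y`; put `y = ρ sin θ`, `Y = ρ cos θ`.
The Prüfer angle `θ` satisfies a scalar equation of its own. Its increment over a period, `turn V h
μ t`, is strictly increasing in `μ`, is `π`-periodic in the initial angle `t`, and varies with `t`
by less than `π`. A periodic solution is one with `turn = 2πn` for which `ρ` returns to its initial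
value.

Counting. The monodromy matrix has determinant 1. Hence, where `2πn` is the maximum or the minimum
of `turn` over `t`, the corresponding solution is periodic, and where a periodic solution with `n`
turns exists, `turn - 2πn` has a constant sign in `t` or vanishes identically. So each `n ≥ 1`
carries exactly two independent periodic solutions and `n = 0` exactly one. Consequently `μ_{2m+1}`
and `μ_{2m+2}` obey every bound that holds for all `μ` at which some angle makes exactly `m + 1`
turns (`eigenvalue_mem_Icc`). From there on only the phase matters, not the amplitude.

Phase. For `μ = lam²` let `S = lam + ∑_{k ≤ r} s_k lam⁻ᵏ` be the truncated WKB series, so that `i S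
/ h` almost solves the Riccati equation, with residual `R`. Writing the exact solution as the real
part of `ρ z` relative to this logarithmic derivative, `arg z` and `θ` have the same increment over
a period. This gives the exact identity `∫ ω = 2πnh` with `ω = Re (S + (R + conj R · u) / (2 Re
S))`, where `u = conj z / z` is unimodular and rotates with velocity close to `-2 lam / h`
(`exists_phase`).

Error terms. The residual is `2 s_{r+1} lam⁻ʳ` up to `O(lam^(-r-1))`. Its non-oscillating part
supplies the coefficient of order `r + 1`. In the oscillating part, `s_{r+1}` is a constant times
`h^r V^(r)` plus a polynomial in lower derivatives. The latter is integrated by parts and gains `1 /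
lam`. The former is merely bounded and measurable; a Riemann–Lebesgue lemma, uniform because `h /
lam ≤ 2 / n`, makes it `o(h^r)`. These are the two error terms of the theorem
(`exists_phase_expansion`).

Inversion. The result `n h = lam + ∑ a_k lam⁻ᵏ + …` is solved for `lam` by a formal power series in
`1 / (n h)` (`exists_inversion`). All coefficients are polynomials in `h` and in the integrals,
hence bounded for `0 < h ≤ h₀`, which gives uniformity. -/

namespace PeriodicSL

/-! ### The Prüfer angle -/

/-- `θ` is a Prüfer angle of the system `h y' = Y`, `h Y' = -p y`. -/
def IsPruferAngle (h : ℝ) (p θ : ℝ → ℝ) : Prop :=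
  ∀ x, HasDerivAt θ ((cos (θ x) ^ 2 + p x * sin (θ x) ^ 2) / h) x

theorem sin_sq_sub_sin_sq (a b : ℝ) : sin a ^ 2 - sin b ^ 2 = sin (a - b) * sin (a + b) := by
  rw [sin_sub, sin_add]
  have ha := sin_sq_add_cos_sq a
  have hb := sin_sq_add_cos_sq b
  linear_combination (sin b ^ 2) * ha - sin a ^ 2 * hb

theorem dist_pruferField_le {h M c : ℝ} (hh : 0 < h) (hc : ‖c‖ ≤ M) (s t : ℝ) :
    dist ((cos s ^ 2 + c * sin s ^ 2) / h) ((cos t ^ 2 + c * sin t ^ 2) / h) ≤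
      (1 + M) / h * dist s t := by
  rw [Real.norm_eq_abs] at hc
  have key : (cos s ^ 2 + c * sin s ^ 2) / h - (cos t ^ 2 + c * sin t ^ 2) / h
      = (c - 1) / h * (sin (s - t) * sin (s + t)) := by
    rw [← sin_sq_sub_sin_sq, cos_sq' s, cos_sq' t]; ring
  rw [Real.dist_eq, Real.dist_eq, key, abs_mul, abs_mul, abs_div, abs_of_pos hh]
  have h1 : |c - 1| ≤ 1 + M := by
    rw [abs_le] at hc ⊢; constructor <;> linarith [hc.1, hc.2]
  have h2 : |sin (s - t)| * |sin (s + t)| ≤ |s - t| * 1 :=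
    mul_le_mul abs_sin_le_abs (abs_sin_le_one _) (abs_nonneg _) (abs_nonneg _)
  have hM0 : 0 ≤ M := (abs_nonneg _).trans hc
  calc |c - 1| / h * (|sin (s - t)| * |sin (s + t)|)
      ≤ (1 + M) / h * (|s - t| * 1) := by gcongr
    _ = (1 + M) / h * |s - t| := by ring

/-- The field is bounded by `(1 + M) / h` for all angles, so a ball of radius `(1 + M) / h * T` is
not left before time `T`, and Picard–Lindelöf reaches the ends of the interval. -/
theorem exists_pruferAngle_on {h : ℝ} (hh : 0 < h) {p : ℝ → ℝ} (hp : Continuous p) (x₀ θ₀ : ℝ)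
    {T : ℝ} (hT : 0 ≤ T) :
    ∃ θ : ℝ → ℝ, θ x₀ = θ₀ ∧ ∀ x ∈ Set.Icc (x₀ - T) (x₀ + T),
      HasDerivWithinAt θ ((cos (θ x) ^ 2 + p x * sin (θ x) ^ 2) / h)
        (Set.Icc (x₀ - T) (x₀ + T)) x := by
  obtain ⟨M, hM⟩ := (isCompact_Icc (a := x₀ - T) (b := x₀ + T)).exists_bound_of_continuousOn
    hp.continuousOn
  have hM0 : 0 ≤ M := (norm_nonneg _).trans (hM x₀ ⟨by linarith, by linarith⟩)
  have hB : 0 ≤ (1 + M) / h := by positivity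
  let B : NNReal := ⟨(1 + M) / h, hB⟩
  let a : NNReal := ⟨(1 + M) / h * T, by positivity⟩
  have hPL : IsPicardLindelof (fun x t => (cos t ^ 2 + p x * sin t ^ 2) / h)
      (⟨x₀, by constructor <;> linarith⟩ : Set.Icc (x₀ - T) (x₀ + T)) θ₀ a 0 B B := by
    refine ⟨fun x hx => ?_, fun t _ => by fun_prop, fun x hx t _ => ?_, ?_⟩
    · refine LipschitzOnWith.of_dist_le_mul fun s _ t _ => ?_
      exact dist_pruferField_le hh (hM x hx) s t
    · have hpx := hM x hx
      rw [Real.norm_eq_abs] at hpx ⊢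
      rw [abs_div, abs_of_pos hh]
      change _ ≤ (1 + M) / h
      gcongr
      calc |cos t ^ 2 + p x * sin t ^ 2| ≤ |cos t ^ 2| + |p x * sin t ^ 2| := abs_add_le _ _
        _ = cos t ^ 2 + |p x| * sin t ^ 2 := by
          rw [abs_mul, abs_of_nonneg (sq_nonneg (cos t)), abs_of_nonneg (sq_nonneg (sin t))]
        _ ≤ 1 + M * 1 := by
          gcongr
          · exact cos_sq_le_one t
          · exact sin_sq_le_one t
        _ = 1 + M := by ring
    · change (1 + M) / h * max (x₀ + T - x₀) (x₀ - (x₀ - T)) ≤ (1 + M) / h * T - 0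
      simp
  obtain ⟨θ, h0, h1⟩ := hPL.exists_eq_forall_mem_Icc_hasDerivWithinAt₀
  exact ⟨θ, h0, h1⟩

theorem exists_pruferAngle {h : ℝ} (hh : 0 < h) {p : ℝ → ℝ} (hp : Continuous p) (x₀ θ₀ : ℝ) :
    ∃ θ : ℝ → ℝ, θ x₀ = θ₀ ∧ IsPruferAngle h p θ := by
  choose f hf0 hf using fun n : ℕ =>
    exists_pruferAngle_on hh hp x₀ θ₀ (T := (n : ℝ) + 1) (by positivity)
  have hcomp : ∀ m n : ℕ, m ≤ n → Set.EqOn (f m) (f n) (Set.Icc (x₀ - (m + 1)) (x₀ + (m + 1))) := by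
    intro m n hmn
    have hmn' : (m : ℝ) ≤ n := by exact_mod_cast hmn
    have hsub : Set.Icc (x₀ - (m + 1)) (x₀ + (m + 1)) ⊆ Set.Icc (x₀ - (n + 1)) (x₀ + (n + 1)) :=
      Set.Icc_subset_Icc (by linarith) (by linarith)
    obtain ⟨M, hM⟩ := (isCompact_Icc (a := x₀ - ((m : ℝ) + 1))
      (b := x₀ + (m + 1))).exists_bound_of_continuousOn hp.continuousOn
    have hM0 : 0 ≤ M := (norm_nonneg _).trans
      (hM x₀ ⟨by linarith [m.cast_nonneg (α := ℝ)], by linarith [m.cast_nonneg (α := ℝ)]⟩)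
    let B : NNReal := ⟨(1 + M) / h, by positivity⟩
    refine ODE_solution_unique_of_mem_Icc (v := fun x t => (cos t ^ 2 + p x * sin t ^ 2) / h)
      (s := fun _ => Set.univ) (K := B) (t₀ := x₀) ?_ ?_ ?_ ?_ ?_ ?_ ?_ ?_ ?_
    · intro x hx
      refine LipschitzOnWith.of_dist_le_mul fun s _ t _ => ?_
      exact dist_pruferField_le hh (hM x (Set.Ioo_subset_Icc_self hx)) s t
    · constructor <;> linarith [m.cast_nonneg (α := ℝ)]
    · exact fun x hx => (hf m x hx).continuousWithinAt
    · exact fun x hx => (hf m x (Set.Ioo_subset_Icc_self hx)).hasDerivAt (Icc_mem_nhds hx.1 hx.2)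
    · exact fun _ _ => Set.mem_univ _
    · exact fun x hx => ((hf n x (hsub hx)).continuousWithinAt).mono hsub
    · intro x hx
      exact ((hf n x (hsub (Set.Ioo_subset_Icc_self hx))).mono hsub).hasDerivAt
        (Icc_mem_nhds hx.1 hx.2)
    · exact fun _ _ => Set.mem_univ _
    · rw [hf0, hf0]
  -- The solutions on growing intervals agree where both are defined, so the interval may be chosen
  -- depending on the point.
  refine ⟨fun x => f ⌈|x - x₀|⌉₊ x, by simp [hf0], fun x => ?_⟩
  set n := ⌈|x - x₀|⌉₊ + 1 with hn
  have hxn : |x - x₀| + 1 ≤ n := by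
    rw [hn]; push_cast; linarith [Nat.le_ceil |x - x₀|]
  have hev : (fun y => f ⌈|y - x₀|⌉₊ y) =ᶠ[𝓝 x] f n := by
    have hlt : ∀ᶠ y in 𝓝 x, |y - x₀| < n :=
      (by fun_prop : Continuous fun y : ℝ => |y - x₀|).continuousAt.eventually_lt_const
        (by linarith)
    filter_upwards [hlt] with y hy
    refine hcomp _ _ (Nat.ceil_le.2 hy.le) ?_
    have h1 := abs_le.1 ((Nat.le_ceil |y - x₀|).trans (le_add_of_nonneg_right zero_le_one))
    constructor <;> linarith [h1.1, h1.2]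
  have hxe : f ⌈|x - x₀|⌉₊ x = f n x := hev.self_of_nhds
  have habs := abs_le.1 (le_sub_iff_add_le.2 hxn)
  have hd := (hf n x ⟨by linarith [habs.1], by linarith [habs.2]⟩).hasDerivAt
    (Icc_mem_nhds (by linarith [habs.1]) (by linarith [habs.2]))
  simp only [hxe]
  exact hd.congr_of_eventuallyEq hev

/-- Solutions of the linear equation `d' = a d + b` by an integrating factor. -/
theorem linear_ode_formula {a b d : ℝ → ℝ} (ha : Continuous a) (hb : Continuous b)
    (hd : ∀ x, HasDerivAt d (a x * d x + b x) x) (x₀ x : ℝ) :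
    exp (-∫ t in x₀..x, a t) * d x = d x₀ + ∫ s in x₀..x, exp (-∫ t in x₀..s, a t) * b s := by
  have hA : ∀ x, HasDerivAt (fun x => ∫ t in x₀..x, a t) (a x) x := fun x =>
    ha.integral_hasStrictDerivAt x₀ x |>.hasDerivAt
  have hAc : Continuous fun x => ∫ t in x₀..x, a t :=
    continuous_iff_continuousAt.2 fun x => (hA x).continuousAt
  have h1 : ∀ x, HasDerivAt (fun x => exp (-∫ t in x₀..x, a t) * d x)
      (exp (-∫ t in x₀..x, a t) * b x) x := by
    intro x
    refine ((hA x).fun_neg.exp.fun_mul (hd x)).congr_deriv ?_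
    ring
  have h2 := intervalIntegral.integral_eq_sub_of_hasDerivAt (a := x₀) (b := x)
    (fun x _ => h1 x) ((by fun_prop : Continuous _).intervalIntegrable _ _)
  rw [h2]; simp

namespace IsPruferAngle

variable {h : ℝ} {p q θ φ : ℝ → ℝ}

theorem continuous (hθ : IsPruferAngle h p θ) : Continuous θ :=
  continuous_iff_continuousAt.2 fun x => (hθ x).continuousAt

/-- The difference of two Prüfer angles solves a linear equation. -/
theorem hasDerivAt_sub (hθ : IsPruferAngle h p θ) (hφ : IsPruferAngle h q φ) (x : ℝ) :
    HasDerivAt (fun x => φ x - θ x)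
      ((q x - 1) * sinc (φ x - θ x) * sin (φ x + θ x) / h * (φ x - θ x) +
        (q x - p x) * sin (θ x) ^ 2 / h) x := by
  refine ((hφ x).fun_sub (hθ x)).congr_deriv ?_
  have h1 : sinc (φ x - θ x) * (φ x - θ x) = sin (φ x - θ x) := by
    by_cases h0 : φ x - θ x = 0
    · simp [h0]
    · rw [sinc_of_ne_zero h0]; field_simp
  have h2 : (q x - 1) * sinc (φ x - θ x) * sin (φ x + θ x) / h * (φ x - θ x) =
      (q x - 1) * (sinc (φ x - θ x) * (φ x - θ x)) * sin (φ x + θ x) / h := by ring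
  have h3 := sin_sq_sub_sin_sq (φ x) (θ x)
  rw [h2, h1, cos_sq' (φ x), cos_sq' (θ x)]
  linear_combination (q x - 1) / h * h3

/-- Source of comparison, uniqueness, strict monotonicity and continuous dependence: the exponential
factor is positive, so the sign of the difference is governed by the initial gap and by `q - p`.
Using `sinc` keeps the coefficient of the linear equation continuous where the angles meet. -/
theorem sub_formula (hp : Continuous p) (hq : Continuous q)
    (hθ : IsPruferAngle h p θ) (hφ : IsPruferAngle h q φ) (x₀ x : ℝ) :
    exp (-∫ t in x₀..x, (q t - 1) * sinc (φ t - θ t) * sin (φ t + θ t) / h) * (φ x - θ x) =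
      φ x₀ - θ x₀ + ∫ s in x₀..x,
        exp (-∫ t in x₀..s, (q t - 1) * sinc (φ t - θ t) * sin (φ t + θ t) / h) *
          ((q s - p s) * sin (θ s) ^ 2 / h) := by
  have h1 := hθ.continuous
  have h2 := hφ.continuous
  exact linear_ode_formula (d := fun x => φ x - θ x) (by fun_prop) (by fun_prop)
    (hθ.hasDerivAt_sub hφ) x₀ x

theorem le_of_le (hh : 0 < h) (hp : Continuous p) (hq : Continuous q) (hpq : ∀ x, p x ≤ q x)
    (hθ : IsPruferAngle h p θ) (hφ : IsPruferAngle h q φ) {x₀ x : ℝ} (hx : x₀ ≤ x)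
    (h0 : θ x₀ ≤ φ x₀) : θ x ≤ φ x := by
  have h1 := sub_formula hp hq hθ hφ x₀ x
  have h2 : 0 ≤ ∫ s in x₀..x,
        exp (-∫ t in x₀..s, (q t - 1) * sinc (φ t - θ t) * sin (φ t + θ t) / h) *
          ((q s - p s) * sin (θ s) ^ 2 / h) := by
    refine intervalIntegral.integral_nonneg hx fun s _ => ?_
    have := sub_nonneg.2 (hpq s)
    positivity
  have h3 := pos_of_mul_pos_left (b := φ x - θ x)
    (a := exp (-∫ t in x₀..x, (q t - 1) * sinc (φ t - θ t) * sin (φ t + θ t) / h))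
  by_contra hlt
  push Not at hlt
  have h4 := mul_neg_of_pos_of_neg
    (exp_pos (-∫ t in x₀..x, (q t - 1) * sinc (φ t - θ t) * sin (φ t + θ t) / h))
    (sub_neg.2 hlt)
  linarith

theorem lt_of_lt (hp : Continuous p)
    (hθ : IsPruferAngle h p θ) (hφ : IsPruferAngle h p φ) {x₀ : ℝ} (x : ℝ)
    (h0 : θ x₀ < φ x₀) : θ x < φ x := by
  have h1 := sub_formula hp hp hθ hφ x₀ x
  simp only [sub_self, zero_mul, zero_div, mul_zero, intervalIntegral.integral_zero,
    add_zero] at h1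
  have h2 : 0 < φ x - θ x := by
    refine pos_of_mul_pos_right (h1 ▸ sub_pos.2 h0) (exp_pos _).le
  linarith

theorem eq_of_eq (hp : Continuous p)
    (hθ : IsPruferAngle h p θ) (hφ : IsPruferAngle h p φ) {x₀ : ℝ}
    (h0 : θ x₀ = φ x₀) : θ = φ := by
  funext x
  have h1 := sub_formula hp hp hθ hφ x₀ x
  simp only [sub_self, zero_mul, zero_div, mul_zero, intervalIntegral.integral_zero,
    add_zero, h0] at h1
  have := (mul_eq_zero.1 h1).resolve_left (exp_pos _).ne'
  linarith

theorem lt_of_potential_lt (hh : 0 < h) (hp : Continuous p) (hq : Continuous q)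
    (hpq : ∀ x, p x < q x) (hθ : IsPruferAngle h p θ) (hφ : IsPruferAngle h q φ) {x₀ x : ℝ}
    (hx : x₀ < x) (h0 : θ x₀ ≤ φ x₀) : θ x < φ x := by
  have h1 := sub_formula hp hq hθ hφ x₀ x
  have hθc := hθ.continuous
  have hφc := hφ.continuous
  have hA : Continuous fun s => ∫ t in x₀..s,
      (q t - 1) * sinc (φ t - θ t) * sin (φ t + θ t) / h := by
    refine intervalIntegral.continuous_primitive (fun a b => ?_) x₀
    exact (by fun_prop : Continuous _).intervalIntegrable _ _
  have h2 : 0 < ∫ s in x₀..x,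
        exp (-∫ t in x₀..s, (q t - 1) * sinc (φ t - θ t) * sin (φ t + θ t) / h) *
          ((q s - p s) * sin (θ s) ^ 2 / h) := by
    -- `sin ∘ θ` cannot vanish on an interval: at a zero its derivative is `cos³ / h ≠ 0`.
    obtain ⟨c, hc, hsc⟩ : ∃ c ∈ Set.Icc x₀ x, sin (θ c) ≠ 0 := by
      by_contra hcon
      push Not at hcon
      set c := (x₀ + x) / 2
      have hc : c ∈ Set.Ioo x₀ x := ⟨by simp only [c]; linarith, by simp only [c]; linarith⟩
      have hev : (fun y => sin (θ y)) =ᶠ[𝓝 c] fun _ => 0 := by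
        filter_upwards [Ioo_mem_nhds hc.1 hc.2] with y hy
        exact hcon y (Set.Ioo_subset_Icc_self hy)
      have hd := ((hθ c).sin).unique ((hasDerivAt_const c (0 : ℝ)).congr_of_eventuallyEq hev)
      have hs : sin (θ c) = 0 := hcon c (Set.Ioo_subset_Icc_self hc)
      have hcs := sin_sq_add_cos_sq (θ c)
      rw [hs] at hd hcs
      have hcc : cos (θ c) ≠ 0 := by intro h0; rw [h0] at hcs; norm_num at hcs
      simp [hcc, hh.ne'] at hd
    refine intervalIntegral.integral_pos hx (by fun_prop) (fun s _ => ?_) ⟨c, hc, ?_⟩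
    · have := (sub_pos.2 (hpq s)).le
      positivity
    · have := sub_pos.2 (hpq c)
      positivity
  have h4 : 0 < φ x - θ x := by
    refine pos_of_mul_pos_right (lt_of_lt_of_le ?_ h1.ge) (exp_pos _).le
    linarith
  linarith

/-- Continuous dependence on the initial value and the potential. -/
theorem abs_sub_le (hh : 0 < h) (hp : Continuous p) (hq : Continuous q)
    (hθ : IsPruferAngle h p θ) (hφ : IsPruferAngle h q φ) {x₀ x M δ : ℝ} (hx : x₀ ≤ x)
    (hM : ∀ x, |q x| ≤ M) (hδ : ∀ x, |q x - p x| ≤ δ) :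
    |φ x - θ x| ≤ exp (2 * ((1 + M) / h * (x - x₀))) * (|φ x₀ - θ x₀| + δ / h * (x - x₀)) := by
  have hM0 : 0 ≤ M := (abs_nonneg _).trans (hM 0)
  have hδ0 : 0 ≤ δ := (abs_nonneg _).trans (hδ 0)
  have hx' : 0 ≤ x - x₀ := sub_nonneg.2 hx
  have hA : ∀ s ∈ Set.Icc x₀ x,
      |∫ t in x₀..s, (q t - 1) * sinc (φ t - θ t) * sin (φ t + θ t) / h| ≤
        (1 + M) / h * (x - x₀) := by
    intro s hs
    have := intervalIntegral.norm_integral_le_of_norm_le_const (a := x₀) (b := s)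
      (f := fun t => (q t - 1) * sinc (φ t - θ t) * sin (φ t + θ t) / h) (C := (1 + M) / h) ?_
    · rw [Real.norm_eq_abs] at this
      refine this.trans ?_
      rw [abs_of_nonneg (sub_nonneg.2 hs.1)]
      gcongr
      exact hs.2
    · intro t _
      rw [Real.norm_eq_abs, abs_div, abs_of_pos hh, abs_mul, abs_mul]
      gcongr
      have h1 : |q t - 1| ≤ 1 + M := by
        have := abs_le.1 (hM t)
        rw [abs_le]; constructor <;> linarith [this.1, this.2]
      calc |q t - 1| * |sinc (φ t - θ t)| * |sin (φ t + θ t)| ≤ (1 + M) * 1 * 1 := by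
            gcongr
            · exact abs_sinc_le_one _
            · exact abs_sin_le_one _
        _ = 1 + M := by ring
  have hA' := hA x ⟨hx, le_rfl⟩
  have h1 := sub_formula hp hq hθ hφ x₀ x
  have h2 : |∫ s in x₀..x,
        exp (-∫ t in x₀..s, (q t - 1) * sinc (φ t - θ t) * sin (φ t + θ t) / h) *
          ((q s - p s) * sin (θ s) ^ 2 / h)| ≤
        exp ((1 + M) / h * (x - x₀)) * (δ / h) * (x - x₀) := by
    have := intervalIntegral.norm_integral_le_of_norm_le_const (a := x₀) (b := x)
      (f := fun s => exp (-∫ t in x₀..s, (q t - 1) * sinc (φ t - θ t) * sin (φ t + θ t) / h) *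
          ((q s - p s) * sin (θ s) ^ 2 / h)) (C := exp ((1 + M) / h * (x - x₀)) * (δ / h)) ?_
    · rwa [Real.norm_eq_abs, abs_of_nonneg hx'] at this
    · intro s hs
      rw [Set.uIoc_of_le hx] at hs
      have h3 := abs_le.1 (hA s (Set.Ioc_subset_Icc_self hs))
      rw [Real.norm_eq_abs, abs_mul, abs_of_pos (exp_pos _), abs_div, abs_of_pos hh, abs_mul,
        abs_of_nonneg (sq_nonneg (sin _))]
      gcongr
      · linarith [h3.1]
      · calc |q s - p s| * sin (θ s) ^ 2 ≤ δ * 1 := by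
              gcongr
              · exact hδ s
              · exact sin_sq_le_one _
          _ = δ := mul_one _
  set I := ∫ t in x₀..x, (q t - 1) * sinc (φ t - θ t) * sin (φ t + θ t) / h
  have h3 : φ x - θ x = exp I * (exp (-I) * (φ x - θ x)) := by
    rw [← mul_assoc, ← exp_add]; simp
  -- The exponent is doubled because the integrating factor is bounded once under the integral and
  -- once when it is divided out.
  rw [h3, h1, abs_mul, abs_of_pos (exp_pos _), two_mul, exp_add, mul_assoc]
  have hE : 1 ≤ exp ((1 + M) / h * (x - x₀)) := one_le_exp (by positivity)
  gcongr
  · exact (abs_le.1 hA').2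
  · refine (abs_add_le _ _).trans ((add_le_add le_rfl h2).trans ?_)
    rw [mul_add, ← mul_assoc]
    gcongr
    exact le_mul_of_one_le_left (abs_nonneg _) hE

end IsPruferAngle

/-! ### The period map of the Prüfer angle -/

namespace IsPruferAngle

variable {h : ℝ} {p θ : ℝ → ℝ}

theorem add_int_mul_pi (hθ : IsPruferAngle h p θ) (k : ℤ) :
    IsPruferAngle h p fun x => θ x + k * π := by
  intro x
  refine ((hθ x).add_const _).congr_deriv ?_
  have h1 : ((-1 : ℝ) ^ k) ^ 2 = 1 := by
    rcases Int.even_or_odd k with hk | hk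
    · simp [hk.neg_one_zpow]
    · simp [hk.neg_one_zpow]
  simp only [cos_add_int_mul_pi, sin_add_int_mul_pi, mul_pow, h1, one_mul]

/-- Since `cos² + p sin² = 1 + (p - 1) sin²`, the angle itself solves a linear equation with the
positive forcing term `1 / h`, whatever the sign of `p`. Thus zero is only crossed upwards. -/
theorem pos_of_eq_zero (hh : 0 < h) (hp : Continuous p) (hθ : IsPruferAngle h p θ) {x₀ x : ℝ}
    (hx : x₀ < x) (h0 : θ x₀ = 0) : 0 < θ x := by
  have hθc := hθ.continuous
  have hd : ∀ x, HasDerivAt θ ((p x - 1) * sinc (θ x) * sin (θ x) / h * θ x + 1 / h) x := by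
    intro x
    refine (hθ x).congr_deriv ?_
    have h1 : sinc (θ x) * θ x = sin (θ x) := by
      by_cases h0 : θ x = 0
      · simp [h0]
      · rw [sinc_of_ne_zero h0]; field_simp
    rw [cos_sq']
    linear_combination -(p x - 1) * sin (θ x) / h * h1
  have h1 := linear_ode_formula (b := fun _ => 1 / h) (by fun_prop) (by fun_prop) hd x₀ x
  have hA : Continuous fun s => ∫ t in x₀..s, (p t - 1) * sinc (θ t) * sin (θ t) / h := by
    refine intervalIntegral.continuous_primitive (fun a b => ?_) x₀
    exact (by fun_prop : Continuous _).intervalIntegrable _ _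
  have h2 : 0 < ∫ s in x₀..x,
      exp (-∫ t in x₀..s, (p t - 1) * sinc (θ t) * sin (θ t) / h) * (1 / h) := by
    refine intervalIntegral.integral_pos hx (by fun_prop) (fun s _ => by positivity)
      ⟨x, ⟨hx.le, le_rfl⟩, by positivity⟩
  refine pos_of_mul_pos_right (lt_of_lt_of_le ?_ h1.ge) (exp_pos _).le
  rw [h0, zero_add]; exact h2

end IsPruferAngle

/-- The Prüfer angle of the scaled system, as a function of the unscaled one. -/
noncomputable def scaledAngle (κ t : ℝ) : ℝ :=
  t + arctan ((κ - 1) * (sin t * cos t) / (cos t ^ 2 + κ * sin t ^ 2))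

theorem cos_sq_add_mul_sin_sq_pos {κ : ℝ} (hκ : 0 < κ) (t : ℝ) :
    0 < cos t ^ 2 + κ * sin t ^ 2 := by
  by_cases hs : sin t = 0
  · have := sin_sq_add_cos_sq t
    rw [hs] at this ⊢
    nlinarith
  · positivity

/-- `scaledAngle κ t` is the angle with tangent `κ tan t` on the branch within `π / 2` of `t`. For
the constant potential `p = κ²` it advances with the constant velocity `κ / h`, which is why it
serves for comparison. -/
theorem hasDerivAt_scaledAngle {κ : ℝ} (hκ : 0 < κ) (t : ℝ) :
    HasDerivAt (scaledAngle κ) (κ / (cos t ^ 2 + κ ^ 2 * sin t ^ 2)) t := by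
  have hD := cos_sq_add_mul_sin_sq_pos hκ t
  have hE := cos_sq_add_mul_sin_sq_pos (pow_pos hκ 2) t
  have hN : HasDerivAt (fun t => (κ - 1) * (sin t * cos t)) _ t :=
    ((hasDerivAt_sin t).mul (hasDerivAt_cos t)).const_mul (κ - 1)
  have hDd : HasDerivAt (fun t => cos t ^ 2 + κ * sin t ^ 2) _ t :=
    ((hasDerivAt_cos t).pow 2).add (((hasDerivAt_sin t).pow 2).const_mul κ)
  refine ((hasDerivAt_id t).fun_add (hN.fun_div hDd hD.ne').arctan).congr_deriv ?_
  have hcs := sin_sq_add_cos_sq t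
  set s := sin t
  set c := cos t
  have hkey : 1 + ((κ - 1) * (s * c) / (c ^ 2 + κ * s ^ 2)) ^ 2 =
      (c ^ 2 + κ ^ 2 * s ^ 2) / (c ^ 2 + κ * s ^ 2) ^ 2 := by
    rw [eq_div_iff (by positivity), add_mul, div_pow, div_mul_cancel₀ _ (by positivity)]
    linear_combination (c ^ 2 + κ ^ 2 * s ^ 2) * hcs
  rw [hkey]
  field_simp
  push_cast
  linear_combination (κ + c ^ 2 * κ - c ^ 2 - κ ^ 2 * s ^ 2 + κ * s ^ 2) * hcs

theorem abs_scaledAngle_sub_le (κ t : ℝ) : |scaledAngle κ t - t| ≤ π / 2 := by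
  rw [scaledAngle, add_sub_cancel_left, abs_le]
  exact ⟨(neg_pi_div_two_lt_arctan _).le, (arctan_lt_pi_div_two _).le⟩

namespace IsPruferAngle

variable {h : ℝ} {p θ : ℝ → ℝ}

/-- The scaled angle advances at least with velocity `κ / h`; passing to it and back costs `π / 2`
at each end. -/
theorem le_sub_of_sq_le (hh : 0 < h) {κ : ℝ} (hκ : 0 < κ) (hp : ∀ x, κ ^ 2 ≤ p x)
    (hθ : IsPruferAngle h p θ) {x₀ x : ℝ} (hx : x₀ ≤ x) :
    κ / h * (x - x₀) - π ≤ θ x - θ x₀ := by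
  have hd : ∀ x, HasDerivAt (fun x => scaledAngle κ (θ x) - κ / h * x)
      (κ / (cos (θ x) ^ 2 + κ ^ 2 * sin (θ x) ^ 2) * ((cos (θ x) ^ 2 + p x * sin (θ x) ^ 2) / h)
        - κ / h * 1) x := fun x =>
    ((hasDerivAt_scaledAngle hκ (θ x)).comp x (hθ x)).sub ((hasDerivAt_id x).const_mul _)
  have hm : Monotone (fun x => scaledAngle κ (θ x) - κ / h * x) := by
    refine monotone_of_hasDerivAt_nonneg hd fun x => ?_
    have hE := cos_sq_add_mul_sin_sq_pos (pow_pos hκ 2) (θ x)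
    have : κ / h * ((cos (θ x) ^ 2 + p x * sin (θ x) ^ 2) /
        (cos (θ x) ^ 2 + κ ^ 2 * sin (θ x) ^ 2)) ≥ κ / h * 1 := by
      gcongr
      rw [one_le_div hE]
      gcongr
      exact hp x
    refine sub_nonneg.2 (this.le.trans_eq ?_)
    field_simp
  have h1 := hm hx
  have h2 := abs_le.1 (abs_scaledAngle_sub_le κ (θ x))
  have h3 := abs_le.1 (abs_scaledAngle_sub_le κ (θ x₀))
  simp only at h1
  linarith [h2.2, h3.1]

theorem sub_le_of_le_sq (hh : 0 < h) {κ : ℝ} (hκ : 0 < κ) (hp : ∀ x, p x ≤ κ ^ 2)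
    (hθ : IsPruferAngle h p θ) {x₀ x : ℝ} (hx : x₀ ≤ x) :
    θ x - θ x₀ ≤ κ / h * (x - x₀) + π := by
  have hd : ∀ x, HasDerivAt (fun x => κ / h * x - scaledAngle κ (θ x))
      (κ / h * 1 -
        κ / (cos (θ x) ^ 2 + κ ^ 2 * sin (θ x) ^ 2) *
          ((cos (θ x) ^ 2 + p x * sin (θ x) ^ 2) / h)) x := fun x =>
    ((hasDerivAt_id x).const_mul _).sub ((hasDerivAt_scaledAngle hκ (θ x)).comp x (hθ x))
  have hm : Monotone (fun x => κ / h * x - scaledAngle κ (θ x)) := by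
    refine monotone_of_hasDerivAt_nonneg hd fun x => ?_
    have hE := cos_sq_add_mul_sin_sq_pos (pow_pos hκ 2) (θ x)
    have : κ / h * ((cos (θ x) ^ 2 + p x * sin (θ x) ^ 2) /
        (cos (θ x) ^ 2 + κ ^ 2 * sin (θ x) ^ 2)) ≤ κ / h * 1 := by
      gcongr
      rw [div_le_one hE]
      gcongr
      exact hp x
    refine sub_nonneg.2 (le_trans (le_of_eq ?_) this)
    field_simp
  have h1 := hm hx
  have h2 := abs_le.1 (abs_scaledAngle_sub_le κ (θ x))
  have h3 := abs_le.1 (abs_scaledAngle_sub_le κ (θ x₀))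
  simp only at h1
  linarith [h2.1, h3.2]

/-- The constant `π / 2` is a Prüfer angle for `p = 0`, hence a barrier for nonpositive `p`. -/
theorem le_pi_div_two (hh : 0 < h) (hpc : Continuous p) (hp : ∀ x, p x ≤ 0)
    (hθ : IsPruferAngle h p θ) {x₀ x : ℝ} (hx : x₀ ≤ x) (h0 : θ x₀ ≤ π / 2) : θ x ≤ π / 2 := by
  have hc : IsPruferAngle h (fun _ => 0) fun _ => π / 2 := fun x => by
    simpa using hasDerivAt_const x (π / 2)
  exact hθ.le_of_le hh hpc continuous_const hp hc hx h0

end IsPruferAngle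

/-- The Prüfer angle of `h² y'' + (μ - V) y = 0` with value `t` at `-π`. -/
noncomputable def angle (V : ℝ → ℝ) (h μ t : ℝ) : ℝ → ℝ :=
  Classical.epsilon fun θ => θ (-π) = t ∧ IsPruferAngle h (fun x => μ - V x) θ

/-- The increment over a period of the Prüfer angle that has the value `t` at `-π`. -/
noncomputable def turn (V : ℝ → ℝ) (h μ t : ℝ) : ℝ := angle V h μ t π - t

section
variable {V : ℝ → ℝ} {h : ℝ}

theorem angle_spec (hV : Continuous V) (hh : 0 < h) (μ t : ℝ) :
    angle V h μ t (-π) = t ∧ IsPruferAngle h (fun x => μ - V x) (angle V h μ t) :=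
  Classical.epsilon_spec (exists_pruferAngle hh (p := fun x => μ - V x) (by fun_prop) (-π) t)

theorem turn_eq (hV : Continuous V) (hh : 0 < h) {μ : ℝ} {θ : ℝ → ℝ}
    (hθ : IsPruferAngle h (fun x => μ - V x) θ) : turn V h μ (θ (-π)) = θ π - θ (-π) := by
  have h1 := angle_spec hV hh μ (θ (-π))
  rw [turn, h1.2.eq_of_eq (by fun_prop) hθ h1.1]

theorem turn_add_int_mul_pi (hV : Continuous V) (hh : 0 < h) (μ t : ℝ) (k : ℤ) :
    turn V h μ (t + k * π) = turn V h μ t := by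
  have h1 := angle_spec hV hh μ t
  have h2 := turn_eq hV hh (h1.2.add_int_mul_pi k)
  simp only [h1.1] at h2
  rw [h2, turn]; ring

theorem turn_lt_turn (hV : Continuous V) (hh : 0 < h) {μ ν : ℝ} (hμ : μ < ν) (t : ℝ) :
    turn V h μ t < turn V h ν t := by
  have h1 := angle_spec hV hh μ t
  have h2 := angle_spec hV hh ν t
  have := h1.2.lt_of_potential_lt (x₀ := -π) (x := π) hh (by fun_prop) (by fun_prop)
    (fun x => by linarith) h2.2 (by linarith [pi_pos]) (by rw [h1.1, h2.1])
  simp only [turn]; linarith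

theorem turn_le_turn (hV : Continuous V) (hh : 0 < h) {μ ν : ℝ} (hμ : μ ≤ ν) (t : ℝ) :
    turn V h μ t ≤ turn V h ν t := by
  rcases hμ.eq_or_lt with rfl | h1
  · rfl
  · exact (turn_lt_turn hV hh h1 t).le

/-- `t ↦ t + turn` is a strictly increasing lift of the action of the monodromy on directions.
Together with `π`-periodicity of `turn` this limits its oscillation in `t`. -/
theorem add_turn_lt (hV : Continuous V) (hh : 0 < h) (μ : ℝ) {s t : ℝ} (hst : s < t) :
    s + turn V h μ s < t + turn V h μ t := by
  have h1 := angle_spec hV hh μ s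
  have h2 := angle_spec hV hh μ t
  have := h1.2.lt_of_lt (x₀ := -π) (by fun_prop) h2.2 π (by rwa [h1.1, h2.1])
  simp only [turn]; linarith

theorem exists_int_shift (s t : ℝ) : ∃ k : ℤ, s < t + k * π ∧ t + k * π ≤ s + π := by
  refine ⟨⌊(s - t) / π⌋ + 1, ?_, ?_⟩
  · have := Int.lt_floor_add_one ((s - t) / π)
    rw [div_lt_iff₀ pi_pos] at this
    push_cast; linarith
  · have := Int.floor_le ((s - t) / π)
    rw [le_div_iff₀ pi_pos] at this
    push_cast; linarith

/-- The increments for different initial values differ by less than `π`. -/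
theorem turn_lt_turn_add_pi (hV : Continuous V) (hh : 0 < h) (μ s t : ℝ) :
    turn V h μ s < turn V h μ t + π := by
  obtain ⟨k, h1, h2⟩ := exists_int_shift s t
  have h3 := add_turn_lt hV hh μ h1
  rw [turn_add_int_mul_pi hV hh] at h3
  linarith

theorem turn_zero_pos (hV : Continuous V) (hh : 0 < h) (μ : ℝ) : 0 < turn V h μ 0 := by
  have h1 := angle_spec hV hh μ 0
  have := h1.2.pos_of_eq_zero hh (by fun_prop) (x₀ := -π) (x := π) (by linarith [pi_pos]) h1.1
  simpa [turn] using this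

/-- This excludes a negative number of full turns. -/
theorem neg_pi_lt_turn (hV : Continuous V) (hh : 0 < h) (μ t : ℝ) : -π < turn V h μ t := by
  linarith [turn_lt_turn_add_pi hV hh μ 0 t, turn_zero_pos hV hh μ]

theorem le_turn_of_sq_le (hV : Continuous V) (hh : 0 < h) {μ κ : ℝ} (hκ : 0 < κ)
    (hp : ∀ x, κ ^ 2 ≤ μ - V x) (t : ℝ) : 2 * π * κ / h - π ≤ turn V h μ t := by
  have h1 := angle_spec hV hh μ t
  have := h1.2.le_sub_of_sq_le hh hκ hp (x₀ := -π) (x := π) (by linarith [pi_pos])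
  rw [h1.1] at this
  rw [turn]
  refine le_trans (le_of_eq ?_) this
  ring

theorem turn_le_of_le_sq (hV : Continuous V) (hh : 0 < h) {μ κ : ℝ} (hκ : 0 < κ)
    (hp : ∀ x, μ - V x ≤ κ ^ 2) (t : ℝ) : turn V h μ t ≤ 2 * π * κ / h + π := by
  have h1 := angle_spec hV hh μ t
  have := h1.2.sub_le_of_le_sq hh hκ hp (x₀ := -π) (x := π) (by linarith [pi_pos])
  rw [h1.1] at this
  rw [turn]
  refine this.trans (le_of_eq ?_)
  ring

/-- A multiple of `π` moves the initial angle into `(-π/2, π/2]`, and the angle then cannot rise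
above the barrier `π / 2`. -/
theorem turn_lt_pi (hV : Continuous V) (hh : 0 < h) {μ : ℝ} (hμ : ∀ x, μ - V x ≤ 0) (t : ℝ) :
    turn V h μ t < π := by
  obtain ⟨k, hk1, hk2⟩ := exists_int_shift (-(π / 2)) t
  have h1 := angle_spec hV hh μ (t + k * π)
  have := h1.2.le_pi_div_two hh (by fun_prop) hμ (x₀ := -π) (x := π) (by linarith [pi_pos])
    (by rw [h1.1]; linarith)
  have h2 := turn_add_int_mul_pi hV hh μ t k
  rw [turn] at h2
  linarith

/-- In the Gronwall bound only the potential of the fixed parameter `μ` enters the exponent, so the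
factor `B` is the same for all nearby points. -/
theorem continuous_turn (hV : Continuous V) {M : ℝ} (hM : ∀ x, |V x| ≤ M) (hh : 0 < h) :
    Continuous fun q : ℝ × ℝ => turn V h q.1 q.2 := by
  rw [continuous_iff_continuousAt]
  rintro ⟨μ, t⟩
  set B := exp (2 * ((1 + (|μ| + M)) / h * (π - -π)))
  have key : ∀ q : ℝ × ℝ, |turn V h q.1 q.2 - turn V h μ t| ≤
      B * (|t - q.2| + |μ - q.1| / h * (π - -π)) + |t - q.2| := by
    rintro ⟨ν, s⟩
    have h1 := angle_spec hV hh μ t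
    have h2 := angle_spec hV hh ν s
    have := h2.2.abs_sub_le hh (by fun_prop) (by fun_prop) h1.2 (x₀ := -π) (x := π)
      (M := |μ| + M) (δ := |μ - ν|) (by linarith [pi_pos]) (fun x => ?_) (fun x => ?_)
    · rw [h1.1, h2.1] at this
      simp only [turn]
      calc |angle V h ν s π - s - (angle V h μ t π - t)|
          = |(t - s) - (angle V h μ t π - angle V h ν s π)| := by ring_nf
        _ ≤ |t - s| + |angle V h μ t π - angle V h ν s π| := abs_sub _ _
        _ ≤ _ := by linarith
    · exact (abs_sub _ _).trans (add_le_add le_rfl (hM x))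
    · exact le_of_eq (by ring_nf)
  rw [ContinuousAt, tendsto_iff_dist_tendsto_zero]
  refine squeeze_zero (fun _ => dist_nonneg) (fun q => (Real.dist_eq _ _).trans_le (key q)) ?_
  have hc : Continuous fun q : ℝ × ℝ =>
      B * (|t - q.2| + |μ - q.1| / h * (π - -π)) + |t - q.2| := by fun_prop
  simpa using hc.tendsto (μ, t)

end

/-! ### Linear solutions and the monodromy -/

/-- `(y, Y)` solves the system `h y' = Y`, `h Y' = -p y`. -/
structure IsLinearSolution (h : ℝ) (p y Y : ℝ → ℝ) : Prop where
  left : ∀ x, HasDerivAt y (Y x / h) x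
  right : ∀ x, HasDerivAt Y (-(p x * y x) / h) x

namespace IsLinearSolution

variable {h : ℝ} {p y Y z Z : ℝ → ℝ}

theorem wronskian_eq (hy : IsLinearSolution h p y Y) (hz : IsLinearSolution h p z Z) (a b : ℝ) :
    y a * Z a - z a * Y a = y b * Z b - z b * Y b := by
  have h1 : ∀ x, HasDerivAt (fun x => y x * Z x - z x * Y x) 0 x := fun x => by
    refine (((hy.left x).fun_mul (hz.right x)).fun_sub
      ((hz.left x).fun_mul (hy.right x))).congr_deriv ?_
    ring
  exact is_const_of_deriv_eq_zero (fun x => (h1 x).differentiableAt) (fun x => (h1 x).deriv) a b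

theorem add (hy : IsLinearSolution h p y Y) (hz : IsLinearSolution h p z Z) (a b : ℝ) :
    IsLinearSolution h p (fun x => a * y x + b * z x) (fun x => a * Y x + b * Z x) where
  left x := (((hy.left x).const_mul a).fun_add ((hz.left x).const_mul b)).congr_deriv (by ring)
  right x := (((hy.right x).const_mul a).fun_add ((hz.right x).const_mul b)).congr_deriv (by ring)

theorem comp_add_const {c : ℝ} (hp : Function.Periodic p c) (hy : IsLinearSolution h p y Y) :
    IsLinearSolution h p (fun x => y (x + c)) (fun x => Y (x + c)) where
  left x := (hy.left (x + c)).comp_add_const x c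
  right x := ((hy.right (x + c)).comp_add_const x c).congr_deriv (by rw [hp x])

theorem continuous_left (hy : IsLinearSolution h p y Y) : Continuous y :=
  continuous_iff_continuousAt.2 fun x => (hy.left x).continuousAt

end IsLinearSolution

/-- The amplitude belonging to the Prüfer angle `angle V h μ t`, with value `1` at `-π`. -/
noncomputable def amplitude (V : ℝ → ℝ) (h μ t x : ℝ) : ℝ :=
  exp (∫ s in (-π)..x, (1 - (μ - V s)) * sin (angle V h μ t s) * cos (angle V h μ t s) / h)

/-- The solution of `h² y'' + (μ - V) y = 0` with `y (-π) = sin t` and `h y' (-π) = cos t`. -/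
noncomputable def sol (V : ℝ → ℝ) (h μ t x : ℝ) : ℝ := amplitude V h μ t x * sin (angle V h μ t x)

/-- The scaled derivative `h y'` of `sol`. -/
noncomputable def dsol (V : ℝ → ℝ) (h μ t x : ℝ) : ℝ :=
  amplitude V h μ t x * cos (angle V h μ t x)

section
variable {V : ℝ → ℝ} {h : ℝ}

theorem amplitude_pos (V : ℝ → ℝ) (h μ t x : ℝ) : 0 < amplitude V h μ t x := exp_pos _

theorem hasDerivAt_amplitude (hV : Continuous V) (hh : 0 < h) (μ t x : ℝ) :
    HasDerivAt (amplitude V h μ t) (amplitude V h μ t x *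
      ((1 - (μ - V x)) * sin (angle V h μ t x) * cos (angle V h μ t x) / h)) x := by
  have hc := (angle_spec hV hh μ t).2.continuous
  exact ((by fun_prop : Continuous fun s => (1 - (μ - V s)) * sin (angle V h μ t s) *
    cos (angle V h μ t s) / h).integral_hasStrictDerivAt (-π) x).hasDerivAt.exp

theorem isLinearSolution_sol (hV : Continuous V) (hh : 0 < h) (μ t : ℝ) :
    IsLinearSolution h (fun x => μ - V x) (sol V h μ t) (dsol V h μ t) := by
  have hθ := (angle_spec hV hh μ t).2
  constructor
  · intro x
    refine ((hasDerivAt_amplitude hV hh μ t x).mul (hθ x).sin).congr_deriv ?_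
    have := sin_sq_add_cos_sq (angle V h μ t x)
    rw [dsol]
    linear_combination amplitude V h μ t x * cos (angle V h μ t x) / h * this
  · intro x
    refine ((hasDerivAt_amplitude hV hh μ t x).mul (hθ x).cos).congr_deriv ?_
    have := sin_sq_add_cos_sq (angle V h μ t x)
    rw [sol]
    linear_combination -amplitude V h μ t x * (μ - V x) * sin (angle V h μ t x) / h * this

theorem amplitude_neg_pi (V : ℝ → ℝ) (h μ t : ℝ) : amplitude V h μ t (-π) = 1 := by
  simp [amplitude]

theorem sol_neg_pi (hV : Continuous V) (hh : 0 < h) (μ t : ℝ) : sol V h μ t (-π) = sin t := by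
  rw [sol, amplitude_neg_pi, (angle_spec hV hh μ t).1, one_mul]

theorem dsol_neg_pi (hV : Continuous V) (hh : 0 < h) (μ t : ℝ) : dsol V h μ t (-π) = cos t := by
  rw [dsol, amplitude_neg_pi, (angle_spec hV hh μ t).1, one_mul]

theorem sol_pi (V : ℝ → ℝ) (h μ t : ℝ) :
    sol V h μ t π = amplitude V h μ t π * sin (t + turn V h μ t) := by
  rw [sol, turn, add_sub_cancel]

theorem dsol_pi (V : ℝ → ℝ) (h μ t : ℝ) :
    dsol V h μ t π = amplitude V h μ t π * cos (t + turn V h μ t) := by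
  rw [dsol, turn, add_sub_cancel]

/-- A solution is determined by its Cauchy data at one point. -/
theorem IsLinearSolution.eq_of_eq (hV : Continuous V) (hh : 0 < h) {μ : ℝ} {y Y z Z : ℝ → ℝ}
    (hy : IsLinearSolution h (fun x => μ - V x) y Y)
    (hz : IsLinearSolution h (fun x => μ - V x) z Z)
    {a : ℝ} (h0 : y a = z a) (h1 : Y a = Z a) : y = z ∧ Y = Z := by
  have hd := hy.add hz 1 (-1)
  have hC := isLinearSolution_sol hV hh μ (π / 2)
  have hS := isLinearSolution_sol hV hh μ 0
  have hW : ∀ x, _ := fun x => hC.wronskian_eq hS x (-π)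
  simp only [sol_neg_pi hV hh, dsol_neg_pi hV hh, sin_pi_div_two, cos_pi_div_two, sin_zero,
    cos_zero] at hW
  -- The difference has zero Wronskian with two solutions whose own Wronskian is 1; Cramer's rule
  -- then makes it vanish.
  have key : ∀ x, 1 * y x + -1 * z x = 0 ∧ 1 * Y x + -1 * Z x = 0 := by
    intro x
    have h2 := hd.wronskian_eq hC x a
    have h3 := hd.wronskian_eq hS x a
    have h4 := hW x
    simp only [h0, h1] at h2 h3
    constructor
    · linear_combination (-sol V h μ 0 x) * h2 + sol V h μ (π / 2) x * h3
        - (1 * y x + -1 * z x) * h4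
    · linear_combination (-dsol V h μ 0 x) * h2 + dsol V h μ (π / 2) x * h3
        - (1 * Y x + -1 * Z x) * h4
  constructor
  · funext x; linarith [(key x).1]
  · funext x; linarith [(key x).2]

theorem sol_eq_combination (hV : Continuous V) (hh : 0 < h) (μ t : ℝ) :
    (sol V h μ t = fun x => sin t * sol V h μ (π / 2) x + cos t * sol V h μ 0 x) ∧
      dsol V h μ t = fun x => sin t * dsol V h μ (π / 2) x + cos t * dsol V h μ 0 x := by
  refine (isLinearSolution_sol hV hh μ t).eq_of_eq hV hh (a := -π)
    ((isLinearSolution_sol hV hh μ (π / 2)).add (isLinearSolution_sol hV hh μ 0) _ _) ?_ ?_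
  · simp [sol_neg_pi hV hh]
  · simp [dsol_neg_pi hV hh]

theorem exists_polar (a b : ℝ) : ∃ c t : ℝ, a = c * sin t ∧ b = c * cos t := by
  refine ⟨‖(⟨b, a⟩ : ℂ)‖, Complex.arg ⟨b, a⟩, ?_, ?_⟩
  · exact (Complex.norm_mul_sin_arg ⟨b, a⟩).symm
  · exact (Complex.norm_mul_cos_arg ⟨b, a⟩).symm

theorem IsLinearSolution.exists_eq_mul_sol (hV : Continuous V) (hh : 0 < h) {μ : ℝ} {y Y : ℝ → ℝ}
    (hy : IsLinearSolution h (fun x => μ - V x) y Y) :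
    ∃ c t : ℝ, (y = fun x => c * sol V h μ t x) ∧ Y = fun x => c * dsol V h μ t x := by
  obtain ⟨c, t, h1, h2⟩ := exists_polar (y (-π)) (Y (-π))
  have hs := isLinearSolution_sol hV hh μ t
  obtain ⟨h3, h4⟩ := hy.eq_of_eq hV hh (a := -π) (hs.add hs c 0)
    (by simp [sol_neg_pi hV hh, h1]) (by simp [dsol_neg_pi hV hh, h2])
  refine ⟨c, t, ?_, ?_⟩
  · simpa using h3
  · simpa using h4

theorem IsPeriodicSolution.isLinearSolution (hh : 0 < h) {μ : ℝ} {y : ℝ → ℝ}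
    (hy : IsPeriodicSolution V h μ y) :
    IsLinearSolution h (fun x => μ - V x) y (fun x => h * deriv y x) := by
  have h1 : ContDiff ℝ 1 (deriv y) := (contDiff_succ_iff_deriv (n := 1)).1 hy.contDiff |>.2.2
  refine ⟨fun x => ?_, fun x => ?_⟩
  · rw [mul_div_cancel_left₀ _ hh.ne']
    exact (hy.contDiff.differentiable (by norm_num) x).hasDerivAt
  · refine ((h1.differentiable (by norm_num) x).hasDerivAt.const_mul h).congr_deriv ?_
    rw [eq_div_iff hh.ne']
    linear_combination hy.equation x

theorem IsLinearSolution.isPeriodicSolution (hV : Continuous V) (hper : Function.Periodic V (2 * π))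
    (hh : 0 < h) {μ : ℝ} {y Y : ℝ → ℝ} (hy : IsLinearSolution h (fun x => μ - V x) y Y)
    (h0 : y π = y (-π)) (h1 : Y π = Y (-π)) : IsPeriodicSolution V h μ y := by
  have hd : deriv y = fun x => Y x / h := funext fun x => (hy.left x).deriv
  have hdd : deriv (deriv y) = fun x => -((μ - V x) * y x) / h / h := by
    rw [hd]; exact funext fun x => ((hy.right x).div_const h).deriv
  refine ⟨?_, ?_, ?_⟩
  · rw [show (2 : WithTop ℕ∞) = 1 + 1 by norm_num, contDiff_succ_iff_deriv]
    refine ⟨fun x => (hy.left x).differentiableAt, by simp, ?_⟩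
    rw [contDiff_one_iff_deriv]
    refine ⟨?_, ?_⟩
    · rw [hd]; exact fun x => ((hy.right x).div_const h).differentiableAt
    · have := hy.continuous_left
      rw [hdd]; fun_prop
  · have hp : Function.Periodic (fun x => μ - V x) (2 * π) := fun x => by simp [hper x]
    have e : -π + 2 * π = π := by ring
    have := (hy.comp_add_const hp).eq_of_eq hV hh hy (a := -π) (by simp only [e, h0])
      (by simp only [e, h1])
    exact fun x => congrFun this.1 x
  · intro x
    rw [hdd]; field_simp; ring

/-- The periodic solutions are, up to a factor, the solutions whose Prüfer angle gains a multiple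
of `2π` in a period while the amplitude returns to its initial value. -/
theorem isPeriodicSolution_sol (hV : Continuous V) (hper : Function.Periodic V (2 * π))
    (hh : 0 < h) {μ t : ℝ} {n : ℕ} (h1 : turn V h μ t = 2 * π * n)
    (h2 : amplitude V h μ t π = 1) : IsPeriodicSolution V h μ (sol V h μ t) := by
  refine (isLinearSolution_sol hV hh μ t).isPeriodicSolution hV hper hh ?_ ?_
  · rw [sol_pi, h1, h2, sol_neg_pi hV hh, show 2 * π * (n : ℝ) = n * (2 * π) by ring,
      sin_add_nat_mul_two_pi, one_mul]
  · rw [dsol_pi, h1, h2, dsol_neg_pi hV hh, show 2 * π * (n : ℝ) = n * (2 * π) by ring,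
      cos_add_nat_mul_two_pi, one_mul]

theorem IsPeriodicSolution.exists_turn_eq (hV : Continuous V) (hh : 0 < h) {μ : ℝ} {y : ℝ → ℝ}
    (hy : IsPeriodicSolution V h μ y) (hne : y ≠ 0) :
    ∃ (c t : ℝ) (n : ℕ), c ≠ 0 ∧ (y = fun x => c * sol V h μ t x) ∧
      turn V h μ t = 2 * π * n ∧ amplitude V h μ t π = 1 := by
  obtain ⟨c, t, h1, h2⟩ := (hy.isLinearSolution hh).exists_eq_mul_sol hV hh
  have hc : c ≠ 0 := by
    rintro rfl
    exact hne (by rw [h1]; funext x; simp)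
  have hdp : deriv y π = deriv y (-π) := by
    have h3 : deriv (fun x => y (x + 2 * π)) (-π) = deriv y (-π) := by
      congr 1; exact funext hy.periodic
    rw [deriv_comp_add_const] at h3
    rw [← h3]; congr 1; ring
  have hyp : y π = y (-π) := by
    rw [← hy.periodic (-π)]; congr 1; ring
  have e1 : amplitude V h μ t π * sin (t + turn V h μ t) = sin t := by
    rw [h1] at hyp
    have := mul_left_cancel₀ hc hyp
    rwa [sol_pi, sol_neg_pi hV hh] at this
  have e2 : amplitude V h μ t π * cos (t + turn V h μ t) = cos t := by
    have h3 : h * deriv y π = h * deriv y (-π) := by rw [hdp]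
    rw [congrFun h2 π, congrFun h2 (-π)] at h3
    have := mul_left_cancel₀ hc h3
    rwa [dsol_pi, dsol_neg_pi hV hh] at this
  have hA : amplitude V h μ t π = 1 := by
    have h3 := sin_sq_add_cos_sq (t + turn V h μ t)
    have h4 := sin_sq_add_cos_sq t
    have h5 : amplitude V h μ t π ^ 2 = 1 := by
      rw [← e1, ← e2] at h4
      linear_combination h4 - amplitude V h μ t π ^ 2 * h3
    exact (pow_eq_one_iff_of_nonneg (amplitude_pos V h μ t π).le two_ne_zero).1 h5
  rw [hA, one_mul] at e1 e2
  have hcos : cos (turn V h μ t) = 1 := by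
    have h3 : cos (turn V h μ t) = cos (t + turn V h μ t - t) := by ring_nf
    rw [h3, cos_sub, e1, e2]
    linarith [sin_sq_add_cos_sq t]
  obtain ⟨n, hn⟩ := (cos_eq_one_iff _).1 hcos
  -- A negative `n` would mean an increment of at most `-2π`, below the bound `-π`.
  have hn0 : 0 ≤ n := by
    have h3 := neg_pi_lt_turn hV hh μ t
    rw [← hn] at h3
    have h4 : (-1 : ℝ) < n := by
      by_contra hcon
      push Not at hcon
      nlinarith [pi_pos]
    have h5 : (-1 : ℤ) < n := by exact_mod_cast h4
    omega
  obtain ⟨k, rfl⟩ := Int.eq_ofNat_of_zero_le hn0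
  refine ⟨c, t, k, hc, h1, ?_, hA⟩
  rw [← hn]; push_cast; ring

/-! The quadratic form `v ∧ M v` of the monodromy matrix `M`. -/

theorem monodromy_det (hV : Continuous V) (hh : 0 < h) (μ : ℝ) :
    sol V h μ (π / 2) π * dsol V h μ 0 π - sol V h μ 0 π * dsol V h μ (π / 2) π = 1 := by
  have := (isLinearSolution_sol hV hh μ (π / 2)).wronskian_eq (isLinearSolution_sol hV hh μ 0) π (-π)
  simpa [sol_neg_pi hV hh, dsol_neg_pi hV hh] using this

/-- The right side is a quadratic form in `(sin t, cos t)` and the amplitude is positive, so linear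
algebra of the monodromy controls the sign of `sin (turn)`. -/
theorem amplitude_mul_sin_turn (hV : Continuous V) (hh : 0 < h) (μ t : ℝ) :
    amplitude V h μ t π * sin (turn V h μ t) =
      (sin t * sol V h μ (π / 2) π + cos t * sol V h μ 0 π) * cos t -
        (sin t * dsol V h μ (π / 2) π + cos t * dsol V h μ 0 π) * sin t := by
  have h1 := congrFun (sol_eq_combination hV hh μ t).1 π
  have h2 := congrFun (sol_eq_combination hV hh μ t).2 π
  rw [← h1, ← h2, sol_pi, dsol_pi]
  have h3 : sin (turn V h μ t) = sin (t + turn V h μ t - t) := by ring_nf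
  rw [h3, sin_sub]; ring

theorem sol_pi_of_turn_eq (hV : Continuous V) (hh : 0 < h) {μ t : ℝ} {n : ℕ}
    (h1 : turn V h μ t = 2 * π * n) :
    sin t * sol V h μ (π / 2) π + cos t * sol V h μ 0 π = amplitude V h μ t π * sin t ∧
    sin t * dsol V h μ (π / 2) π + cos t * dsol V h μ 0 π = amplitude V h μ t π * cos t := by
  have e1 := congrFun (sol_eq_combination hV hh μ t).1 π
  have e2 := congrFun (sol_eq_combination hV hh μ t).2 π
  rw [← e1, ← e2, sol_pi, dsol_pi, h1, show 2 * π * (n : ℝ) = n * (2 * π) by ring,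
    sin_add_nat_mul_two_pi, cos_add_nat_mul_two_pi]
  exact ⟨rfl, rfl⟩

/-- If there is a periodic solution, then the form `v ∧ M v` is a multiple of a square, and if it
vanishes, then all solutions are periodic. -/
theorem exists_amplitude_mul_sin_turn_eq (hV : Continuous V) (hh : 0 < h) {μ t₀ : ℝ} {n : ℕ}
    (h1 : turn V h μ t₀ = 2 * π * n) (h2 : amplitude V h μ t₀ π = 1) :
    ∃ k : ℝ, (∀ t, amplitude V h μ t π * sin (turn V h μ t) = k * sin (t - t₀) ^ 2) ∧
      (k = 0 → ∀ t, amplitude V h μ t π = 1 ∧ turn V h μ t = 2 * π * n) := by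
  obtain ⟨e1, e2⟩ := sol_pi_of_turn_eq hV hh h1
  have hdet := monodromy_det hV hh μ
  have hq := amplitude_mul_sin_turn hV hh μ
  have hcs := sin_sq_add_cos_sq t₀
  have hcomb := sol_eq_combination hV hh μ
  rw [h2, one_mul, ← sub_eq_zero] at e1 e2
  set a := sol V h μ (π / 2) π with ha
  set b := sol V h μ 0 π with hb
  set c := dsol V h μ (π / 2) π with hc
  set d := dsol V h μ 0 π with hd
  set s := sin t₀ with hs
  set u := cos t₀ with hu
  -- The matrix fixes the nonzero vector `(s, u)`, so `det (M - 1) = 0`; with `det M = 1` the trace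
  -- is 2.
  have htr : a + d = 2 := by
    have h3 : ((a - 1) * (d - 1) - b * c) * s = 0 := by
      linear_combination (d - 1) * e1 - b * e2
    have h4 : ((a - 1) * (d - 1) - b * c) * u = 0 := by
      linear_combination (-c) * e1 + (a - 1) * e2
    have h5 : (a - 1) * (d - 1) - b * c = 0 := by
      linear_combination s * h3 + u * h4 - ((a - 1) * (d - 1) - b * c) * hcs
    linear_combination hdet - h5
  -- `M - 1` is nilpotent and annihilates `(s, u)`, so all its entries are multiples of the single
  -- number `c - b`, which becomes `-k`.
  have hA : a - 1 = (c - b) * (s * u) := by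
    linear_combination s * e1 - u * (e2 - u * htr) - (a - 1) * hcs
  have hB : -b = (c - b) * s ^ 2 := by
    linear_combination (-u) * e1 - s * (e2 - u * htr) + b * hcs
  have hC : c = (c - b) * u ^ 2 := by
    linear_combination u * e1 + s * (e2 - u * htr) - c * hcs
  refine ⟨b - c, fun t => ?_, fun hk t => ?_⟩
  · rw [hq t, sin_sub, ← hs, ← hu]
    linear_combination (-cos t ^ 2) * hB + sin t * cos t * (2 * hA - htr) - sin t ^ 2 * hC
  · have hk' : c - b = 0 := by linarith
    rw [hk', zero_mul] at hA hB hC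
    have ha1 : a = 1 := by linarith
    have hb1 : b = 0 := by linarith
    have hd1 : d = 1 := by linarith
    have f1 := congrFun (hcomb t).1 π
    have f2 := congrFun (hcomb t).2 π
    simp only [← ha, ← hb, ← hc, ← hd, ha1, hb1, hC, hd1, mul_one, mul_zero, add_zero,
      zero_add] at f1 f2
    rw [sol_pi] at f1
    rw [dsol_pi] at f2
    have hA : amplitude V h μ t π = 1 := by
      have h3 := sin_sq_add_cos_sq (t + turn V h μ t)
      have h4 := sin_sq_add_cos_sq t
      have h5 : amplitude V h μ t π ^ 2 = 1 := by
        rw [← f1, ← f2] at h4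
        linear_combination h4 - amplitude V h μ t π ^ 2 * h3
      exact (pow_eq_one_iff_of_nonneg (amplitude_pos V h μ t π).le two_ne_zero).1 h5
    refine ⟨hA, ?_⟩
    have h3 := hq t
    rw [ha1, hb1, hC, hd1, hA] at h3
    -- This leaves the multiples of `π`; since increments differ by less than `π`, only `2πn`
    -- remains.
    have h4 : sin (turn V h μ t - n * (2 * π)) = 0 := by
      rw [sin_sub_nat_mul_two_pi]; linarith
    have h5 := turn_lt_turn_add_pi hV hh μ t t₀
    have h6 := turn_lt_turn_add_pi hV hh μ t₀ t
    rw [h1] at h5 h6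
    have := (sin_eq_zero_iff_of_lt_of_lt (by linarith) (by linarith)).1 h4
    linarith

/-- At an extremal increment the multiplier is `1`. -/
theorem amplitude_eq_one_of_extremal (hV : Continuous V) (hh : 0 < h) {μ t₀ : ℝ} {n : ℕ}
    (h1 : turn V h μ t₀ = 2 * π * n)
    (h2 : (∀ t, 2 * π * n ≤ turn V h μ t) ∨ ∀ t, turn V h μ t ≤ 2 * π * n) :
    amplitude V h μ t₀ π = 1 := by
  obtain ⟨e1, e2⟩ := sol_pi_of_turn_eq hV hh h1
  have hdet := monodromy_det hV hh μ
  have hcs := sin_sq_add_cos_sq t₀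
  have hq := amplitude_mul_sin_turn hV hh μ
  have hr := amplitude_pos V h μ t₀ π
  have hsin : ∀ t, sin (turn V h μ t) = sin (turn V h μ t - 2 * π * n) := fun t => by
    rw [show turn V h μ t - 2 * π * n = turn V h μ t - n * (2 * π) by ring,
      sin_sub_nat_mul_two_pi]
  have h0 : amplitude V h μ t₀ π * sin (turn V h μ t₀) = 0 := by rw [hsin, h1]; simp
  have hext : IsLocalExtr (fun t => amplitude V h μ t π * sin (turn V h μ t)) t₀ := by
    rcases h2 with h2 | h2
    · refine Or.inl (Eventually.of_forall fun t => ?_)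
      simp only [h0]
      refine mul_nonneg (amplitude_pos _ _ _ _ _).le ?_
      rw [hsin]
      exact sin_nonneg_of_nonneg_of_le_pi (by linarith [h2 t])
        (by linarith [turn_lt_turn_add_pi hV hh μ t t₀])
    · refine Or.inr (Eventually.of_forall fun t => ?_)
      simp only [h0]
      refine mul_nonpos_of_nonneg_of_nonpos (amplitude_pos _ _ _ _ _).le ?_
      rw [hsin]
      exact sin_nonpos_of_nonpos_of_neg_pi_le (by linarith [h2 t])
        (by linarith [turn_lt_turn_add_pi hV hh μ t₀ t])
  rw [funext hq] at hext
  set a := sol V h μ (π / 2) π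
  set b := sol V h μ 0 π
  set c := dsol V h μ (π / 2) π
  set d := dsol V h μ 0 π
  have hd0 := hext.hasDerivAt_eq_zero
    (((((hasDerivAt_sin t₀).mul_const a).add ((hasDerivAt_cos t₀).mul_const b)).mul
      (hasDerivAt_cos t₀)).sub ((((hasDerivAt_sin t₀).mul_const c).add
        ((hasDerivAt_cos t₀).mul_const d)).mul (hasDerivAt_sin t₀)))
  simp only [Pi.add_apply] at hd0
  set r := amplitude V h μ t₀ π
  set s := sin t₀
  set u := cos t₀
  -- `r` is an eigenvalue of the monodromy and `a + d - r` is the other one. Stationarity of the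
  -- quadratic form at the eigenvector says that they coincide; their product is 1 and `r > 0`, so
  -- `r = 1`.
  have h3 : (a + d - r) - r = 0 := by
    linear_combination hd0 + 2 * s * e1 + 2 * u * e2 - (a + d - 2 * r) * hcs
  have h4 : r * (a + d - r) = 1 := by
    have h3 : ((a - r) * (d - r) - b * c) * s = 0 := by
      linear_combination (d - r) * e1 - b * e2
    have h4 : ((a - r) * (d - r) - b * c) * u = 0 := by
      linear_combination (-c) * e1 + (a - r) * e2
    have h5 : (a - r) * (d - r) - b * c = 0 := by
      linear_combination s * h3 + u * h4 - ((a - r) * (d - r) - b * c) * hcs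
    linear_combination hdet - h5
  nlinarith

end

/-! ### Counting the periodic eigenvalues -/

section
variable {V : ℝ → ℝ} {h : ℝ}

/-- `sol V h μ t` is a periodic solution whose Prüfer angle makes `n` turns in a period. -/
def IsPeriodicDatum (V : ℝ → ℝ) (h : ℝ) (n : ℕ) (μ t : ℝ) : Prop :=
  turn V h μ t = 2 * π * n ∧ amplitude V h μ t π = 1

/-- `turn` increases with `μ`, and a change of the initial angle shifts it by less than half a turn,
so the number of turns is monotone in `μ` whatever the initial angles are. -/
theorem turn_monotone_counts (hV : Continuous V) (hh : 0 < h) {μ ν s t : ℝ} {m n : ℕ}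
    (h1 : turn V h μ s = 2 * π * m) (h2 : turn V h ν t = 2 * π * n) (hμ : μ ≤ ν) : m ≤ n := by
  have h3 := turn_le_turn hV hh hμ s
  have h4 := turn_lt_turn_add_pi hV hh ν s t
  have h5 : (m : ℝ) < n + 1 := by
    by_contra hcon
    push Not at hcon
    nlinarith [pi_pos]
  have h6 : m < n + 1 := by exact_mod_cast h5
  omega

/-- Parallel initial data give proportional solutions. -/
theorem sol_parallel (hV : Continuous V) (hh : 0 < h) {μ s t : ℝ} (hst : sin (s - t) = 0) (x : ℝ) :
    cos t * sol V h μ s x - cos s * sol V h μ t x = 0 ∧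
      sin t * sol V h μ s x - sin s * sol V h μ t x = 0 := by
  rw [(sol_eq_combination hV hh μ s).1, (sol_eq_combination hV hh μ t).1]
  rw [sin_sub] at hst
  constructor
  · linear_combination sol V h μ (π / 2) x * hst
  · linear_combination (-sol V h μ 0 x) * hst

theorem sin_sub_ne_zero_of_linearIndependent (hV : Continuous V) (hh : 0 < h) {μ s t : ℝ}
    (hli : LinearIndependent ℝ ![sol V h μ s, sol V h μ t]) : sin (s - t) ≠ 0 := by
  intro hst
  rw [LinearIndependent.pair_iff] at hli
  have h1 := hli (cos t) (-cos s) (by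
    funext x
    simpa [sub_eq_add_neg] using (sol_parallel hV hh hst x).1)
  have h2 := hli (sin t) (-sin s) (by
    funext x
    simpa [sub_eq_add_neg] using (sol_parallel hV hh hst x).2)
  have := sin_sq_add_cos_sq t
  rw [h1.1, h2.1] at this
  norm_num at this

/-- The form is `k sin² (t - t₀)`, of one sign, and `|turn - 2πn| < π`, so the sign of `sin (turn)`
is that of `turn - 2πn`. The cases correspond to `k = 0`, `k > 0`, `k < 0`. -/
theorem IsPeriodicDatum.dichotomy (hV : Continuous V) (hh : 0 < h) {μ t₀ : ℝ} {n : ℕ}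
    (hd : IsPeriodicDatum V h n μ t₀) :
    (∀ t, turn V h μ t = 2 * π * n) ∨
    (∀ t, 2 * π * n ≤ turn V h μ t ∧ (turn V h μ t = 2 * π * n → sin (t - t₀) = 0)) ∨
    (∀ t, turn V h μ t ≤ 2 * π * n ∧ (turn V h μ t = 2 * π * n → sin (t - t₀) = 0)) := by
  obtain ⟨k, hk, hk0⟩ := exists_amplitude_mul_sin_turn_eq hV hh hd.1 hd.2
  have hsin : ∀ t, sin (turn V h μ t) = sin (turn V h μ t - 2 * π * n) := fun t => by
    rw [show turn V h μ t - 2 * π * n = turn V h μ t - n * (2 * π) by ring,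
      sin_sub_nat_mul_two_pi]
  have hz : k ≠ 0 → ∀ t, turn V h μ t = 2 * π * n → sin (t - t₀) = 0 := by
    intro hk1 t ht
    have h1 := hk t
    rw [hsin, ht, sub_self, sin_zero, mul_zero] at h1
    simpa [hk1] using h1.symm
  have hb : ∀ t, -π < turn V h μ t - 2 * π * n ∧ turn V h μ t - 2 * π * n < π := fun t => by
    have h1 := turn_lt_turn_add_pi hV hh μ t t₀
    have h2 := turn_lt_turn_add_pi hV hh μ t₀ t
    rw [hd.1] at h1 h2
    constructor <;> linarith
  rcases lt_trichotomy k 0 with h0 | h0 | h0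
  · refine Or.inr (Or.inr fun t => ⟨?_, hz h0.ne t⟩)
    by_contra hcon
    push Not at hcon
    have h1 := sin_pos_of_pos_of_lt_pi (sub_pos.2 hcon) (hb t).2
    have h2 := mul_pos (amplitude_pos V h μ t π) h1
    rw [← hsin, hk t] at h2
    nlinarith [sq_nonneg (sin (t - t₀))]
  · exact Or.inl fun t => (hk0 h0 t).2
  · refine Or.inr (Or.inl fun t => ⟨?_, hz h0.ne' t⟩)
    by_contra hcon
    push Not at hcon
    have h1 := sin_neg_of_neg_of_neg_pi_lt (sub_neg.2 hcon) (hb t).1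
    have h2 := mul_neg_of_pos_of_neg (amplitude_pos V h μ t π) h1
    rw [← hsin, hk t] at h2
    nlinarith [sq_nonneg (sin (t - t₀))]

/-- Look at the middle parameter `μ 1`. If all directions make `n` turns there, strict monotonicity
forces all three parameters to coincide, and the solution space has dimension 2. Otherwise `turn`
lies on one side of `2πn`, so the upper or the lower neighbour must have the same parameter and a
parallel direction. -/
theorem no_three_periodicData (hV : Continuous V) (hh : 0 < h) {n : ℕ} {μ t : Fin 3 → ℝ}
    (hd : ∀ i, IsPeriodicDatum V h n (μ i) (t i)) (h01 : μ 0 ≤ μ 1) (h12 : μ 1 ≤ μ 2) :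
    ¬ LinearIndependent ℝ fun i => sol V h (μ i) (t i) := by
  intro hli
  have hpair : ∀ i j, i ≠ j → LinearIndependent ℝ ![sol V h (μ i) (t i), sol V h (μ j) (t j)] := by
    intro i j hij
    have hinj : Function.Injective ![i, j] := by
      intro a b hab
      fin_cases a <;> fin_cases b <;> simp_all
    convert hli.comp _ hinj using 1
    funext a
    fin_cases a <;> rfl
  have hne : ∀ i j, i ≠ j → μ i = μ j → sin (t i - t j) ≠ 0 := by
    intro i j hij he
    have := hpair i j hij
    rw [he] at this
    exact sin_sub_ne_zero_of_linearIndependent hV hh this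
  rcases (hd 1).dichotomy hV hh with h1 | h1 | h1
  · have e0 : μ 0 = μ 1 := by
      refine h01.eq_of_not_lt fun hlt => ?_
      have := turn_lt_turn hV hh hlt (t 0)
      rw [(hd 0).1, h1] at this
      exact lt_irrefl _ this
    have e2 : μ 2 = μ 1 := by
      refine (h12.eq_of_not_lt fun hlt => ?_).symm
      have := turn_lt_turn hV hh hlt (t 2)
      rw [(hd 2).1, h1] at this
      exact lt_irrefl _ this
    rw [Fintype.linearIndependent_iff] at hli
    have := hli ![sin (t 1 - t 2), sin (t 2 - t 0), sin (t 0 - t 1)] (by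
      funext x
      simp only [Fin.sum_univ_three, Pi.add_apply, Pi.smul_apply, smul_eq_mul, e0, e2,
        Matrix.cons_val_zero, Matrix.cons_val_one, Matrix.cons_val, Pi.zero_apply]
      rw [(sol_eq_combination hV hh (μ 1) (t 0)).1, (sol_eq_combination hV hh (μ 1) (t 1)).1,
        (sol_eq_combination hV hh (μ 1) (t 2)).1]
      simp only [sin_sub]
      ring) 2
    exact hne 0 1 (by decide) e0 (by simpa using this)
  · have e2 : μ 2 = μ 1 := by
      refine (h12.eq_of_not_lt fun hlt => ?_).symm
      have := turn_lt_turn hV hh hlt (t 2)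
      rw [(hd 2).1] at this
      exact absurd (h1 (t 2)).1 (not_le.2 this)
    have := (h1 (t 2)).2
    rw [← e2] at this
    exact hne 2 1 (by decide) e2 (this (hd 2).1)
  · have e0 : μ 0 = μ 1 := by
      refine h01.eq_of_not_lt fun hlt => ?_
      have := turn_lt_turn hV hh hlt (t 0)
      rw [(hd 0).1] at this
      exact absurd (h1 (t 0)).1 (not_le.2 this)
    have := (h1 (t 0)).2
    rw [← e0] at this
    exact hne 0 1 (by decide) e0 (this (hd 0).1)

/-- The direction `t = 0` always has a positive increment, so for `n = 0` only the case `turn ≥ 0`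
is possible, which leaves a single direction and no larger parameter. -/
theorem no_two_periodicData_zero (hV : Continuous V) (hh : 0 < h) {μ t ν s : ℝ}
    (h1 : IsPeriodicDatum V h 0 μ t) (h2 : IsPeriodicDatum V h 0 ν s) (hμ : μ ≤ ν) :
    ¬ LinearIndependent ℝ ![sol V h μ t, sol V h ν s] := by
  intro hli
  have h0 := turn_zero_pos hV hh μ
  rcases h1.dichotomy hV hh with h3 | h3 | h3
  · have := h3 0
    simp at this; linarith
  · have e : μ = ν := by
      refine hμ.eq_of_not_lt fun hlt => ?_
      have := turn_lt_turn hV hh hlt s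
      rw [h2.1] at this
      exact absurd (h3 s).1 (not_le.2 this)
    subst e
    refine sin_sub_ne_zero_of_linearIndependent hV hh hli ?_
    rw [← neg_sub, sin_neg, (h3 s).2 h2.1, neg_zero]
  · have := (h3 0).1
    simp at this; linarith

/-- At most one independent solution without turns and at most two for each of the numbers `1, …,
m`. -/
theorem card_le_of_turn_le (hV : Continuous V) (hh : 0 < h) {k m : ℕ} {μ t : Fin k → ℝ}
    {n : Fin k → ℕ} (hd : ∀ i, IsPeriodicDatum V h (n i) (μ i) (t i)) (hn : ∀ i, n i ≤ m)
    (hli : LinearIndependent ℝ fun i => sol V h (μ i) (t i)) : k ≤ 2 * m + 1 := by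
  have hc2 : ∀ l, (Finset.univ.filter fun i => n i = l).card ≤ 2 := by
    intro l
    by_contra hcon
    push Not at hcon
    obtain ⟨a, b, c, ha, hb, hc, hab, hac, hbc⟩ := Finset.two_lt_card_iff.1 hcon
    simp only [Finset.mem_filter, Finset.mem_univ, true_and] at ha hb hc
    have key : ∀ a b c, n a = l → n b = l → n c = l → a ≠ b → a ≠ c → b ≠ c → μ a ≤ μ b →
        μ b ≤ μ c → False := by
      intro a b c ha hb hc hab hac hbc h1 h2
      have hinj : Function.Injective ![a, b, c] := by
        intro i j hij
        fin_cases i <;> fin_cases j <;> simp_all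
      refine no_three_periodicData hV hh (n := l) (μ := fun i => μ (![a, b, c] i))
        (t := fun i => t (![a, b, c] i)) ?_ h1 h2 (hli.comp _ hinj)
      intro i
      fin_cases i
      · exact ha ▸ hd a
      · exact hb ▸ hd b
      · exact hc ▸ hd c
    rcases le_total (μ a) (μ b) with h1 | h1 <;> rcases le_total (μ b) (μ c) with h2 | h2 <;>
      rcases le_total (μ a) (μ c) with h3 | h3
    · exact key a b c ha hb hc hab hac hbc h1 h2
    · exact key a b c ha hb hc hab hac hbc h1 h2
    · exact key a c b ha hc hb hac hab hbc.symm h3 h2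
    · exact key c a b hc ha hb hac.symm hbc.symm hab h3 h1
    · exact key b a c hb ha hc hab.symm hbc hac h1 h3
    · exact key b c a hb hc ha hbc hab.symm hac.symm h2 h3
    · exact key c b a hc hb ha hbc.symm hac.symm hab.symm h2 h1
    · exact key c b a hc hb ha hbc.symm hac.symm hab.symm h2 h1
  have hc1 : (Finset.univ.filter fun i => n i = 0).card ≤ 1 := by
    rw [Finset.card_le_one]
    intro a ha b hb
    simp only [Finset.mem_filter, Finset.mem_univ, true_and] at ha hb
    by_contra hab
    have key : ∀ a b, n a = 0 → n b = 0 → a ≠ b → μ a ≤ μ b → False := by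
      intro a b ha hb hab h1
      have hinj : Function.Injective ![a, b] := by
        intro i j hij
        fin_cases i <;> fin_cases j <;> simp_all
      refine no_two_periodicData_zero hV hh (ha ▸ hd a) (hb ▸ hd b) h1 ?_
      convert hli.comp _ hinj using 1
      funext i
      fin_cases i <;> rfl
    rcases le_total (μ a) (μ b) with h1 | h1
    · exact key a b ha hb hab h1
    · exact key b a hb ha (Ne.symm hab) h1
  have hcard := Finset.card_eq_sum_card_fiberwise (f := n) (s := Finset.univ)
    (t := Finset.range (m + 1)) (fun i _ => by simpa using Nat.lt_succ_of_le (hn i))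
  rw [Finset.card_univ, Fintype.card_fin, Finset.sum_range_succ'] at hcard
  have hsum := Finset.sum_le_sum fun (l : ℕ) (_ : l ∈ Finset.range m) => hc2 (l + 1)
  simp only [Finset.sum_const, Finset.card_range, smul_eq_mul] at hsum
  omega

/-! Existence. -/

theorem exists_turn_ge (hV : Continuous V) {M : ℝ} (hM : ∀ x, |V x| ≤ M) (hh : 0 < h) (n : ℕ) :
    ∃ ν, ∀ t, 2 * π * n + 1 ≤ turn V h ν t := by
  have hκ : 0 < h * (n + 2) := by positivity
  refine ⟨(h * (n + 2)) ^ 2 + M, fun t => ?_⟩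
  have h1 := le_turn_of_sq_le hV hh hκ (μ := (h * (n + 2)) ^ 2 + M)
    (fun x => by linarith [(abs_le.1 (hM x)).2]) t
  have h2 : 2 * π * (h * (n + 2)) / h = 2 * π * (n + 2) := by field_simp
  rw [h2] at h1
  nlinarith [pi_gt_three]

theorem exists_turn_eq_between (hV : Continuous V) {M : ℝ} (hM : ∀ x, |V x| ≤ M) (hh : 0 < h)
    {a b t c : ℝ} (hab : a ≤ b) (h1 : turn V h a t ≤ c) (h2 : c ≤ turn V h b t) :
    ∃ μ ∈ Set.Icc a b, turn V h μ t = c := by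
  have hc : Continuous fun μ => turn V h μ t :=
    (continuous_turn hV hM hh).comp (continuous_id.prodMk continuous_const)
  exact intermediate_value_Icc hab hc.continuousOn ⟨h1, h2⟩

theorem exists_reduced_angle (hV : Continuous V) (hh : 0 < h) (μ t : ℝ) :
    ∃ s ∈ Set.Icc 0 π, turn V h μ s = turn V h μ t := by
  obtain ⟨k, h1, h2⟩ := exists_int_shift 0 t
  exact ⟨t + k * π, ⟨h1.le, by linarith⟩, turn_add_int_mul_pi hV hh μ t k⟩

theorem isCompact_turn_eq (hV : Continuous V) {M : ℝ} (hM : ∀ x, |V x| ≤ M) (hh : 0 < h)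
    (a b c : ℝ) : IsCompact {μ | μ ∈ Set.Icc a b ∧ ∃ t, turn V h μ t = c} := by
  have h1 : IsCompact ((Set.Icc a b ×ˢ Set.Icc 0 π) ∩ {q : ℝ × ℝ | turn V h q.1 q.2 = c}) :=
    (isCompact_Icc.prod isCompact_Icc).inter_right
      (isClosed_eq (continuous_turn hV hM hh) continuous_const)
  convert h1.image continuous_fst using 1
  ext μ
  constructor
  · rintro ⟨hμ, t, ht⟩
    obtain ⟨s, hs, hst⟩ := exists_reduced_angle hV hh μ t
    exact ⟨(μ, s), ⟨⟨hμ, hs⟩, hst.trans ht⟩, rfl⟩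
  · rintro ⟨⟨ν, s⟩, ⟨⟨hν, hs⟩, hst⟩, rfl⟩
    exact ⟨hν, s, hst⟩

/-- The largest `μ` with a given number of turns. -/
theorem exists_greatest_periodicDatum (hV : Continuous V) {M : ℝ} (hM : ∀ x, |V x| ≤ M)
    (hh : 0 < h) (n : ℕ) :
    ∃ μ t, IsPeriodicDatum V h n μ t ∧ (∀ s, 2 * π * n ≤ turn V h μ s) ∧
      ∀ ν s, turn V h ν s = 2 * π * n → ν ≤ μ := by
  obtain ⟨β, hβ⟩ := exists_turn_ge hV hM hh n
  have hub : ∀ ν s, turn V h ν s = 2 * π * n → ν ≤ β := by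
    intro ν s hs
    by_contra hcon
    push Not at hcon
    have := turn_lt_turn hV hh hcon s
    linarith [hβ s]
  obtain ⟨α, t₀, hα⟩ : ∃ α t₀, turn V h α t₀ = 2 * π * n := by
    obtain ⟨a, t, hat⟩ : ∃ a t, turn V h a t ≤ 2 * π * n := by
      rcases Nat.eq_zero_or_pos n with rfl | hn
      -- For `n = 0` the estimate `turn < π` is too weak; starting on the barrier `π / 2` gives
      -- `turn ≤ 0`.
      · refine ⟨-M - 1, π / 2, ?_⟩
        have h1 := angle_spec hV hh (-M - 1) (π / 2)
        have := h1.2.le_pi_div_two (x₀ := -π) (x := π) hh (by fun_prop)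
          (fun x => by linarith [(abs_le.1 (hM x)).1]) (by linarith [pi_pos]) h1.1.le
        simp only [turn]
        simpa using this
      · refine ⟨-M, 0, ?_⟩
        have := turn_lt_pi hV hh (μ := -M) (fun x => by linarith [(abs_le.1 (hM x)).1]) 0
        have h2 : (1 : ℝ) ≤ n := by exact_mod_cast hn
        nlinarith [pi_pos]
    rcases le_total a β with hab | hab
    · obtain ⟨μ, -, hμ⟩ := exists_turn_eq_between hV hM hh hab hat (by linarith [hβ t])
      exact ⟨μ, t, hμ⟩
    · have := turn_le_turn hV hh hab t
      linarith [hβ t]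
  obtain ⟨μ, ⟨hμ1, t, ht⟩, hμ2⟩ := (isCompact_turn_eq hV hM hh α β (2 * π * n)).exists_isGreatest
    ⟨α, ⟨le_rfl, hub _ _ hα⟩, t₀, hα⟩
  have hmax : ∀ ν s, turn V h ν s = 2 * π * n → ν ≤ μ := by
    intro ν s hs
    by_contra hcon
    push Not at hcon
    exact absurd (hμ2 ⟨⟨hμ1.1.trans hcon.le, hub _ _ hs⟩, s, hs⟩) (not_le.2 hcon)
  -- A direction with fewer turns would reach `2πn` at a larger parameter, contradicting maximality.
  -- So `2πn` is the minimum over directions and the multiplier is 1.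
  have hext : ∀ s, 2 * π * n ≤ turn V h μ s := by
    intro s
    by_contra hcon
    push Not at hcon
    obtain ⟨ν, hν, hνs⟩ := exists_turn_eq_between hV hM hh hμ1.2 hcon.le (by linarith [hβ s])
    have := hmax ν s hνs
    have : ν = μ := le_antisymm this hν.1
    rw [this] at hνs
    exact hcon.ne hνs
  exact ⟨μ, t, ⟨ht, amplitude_eq_one_of_extremal hV hh ht (Or.inl hext)⟩, hext, hmax⟩

/-- The smallest `μ` with a given positive number of turns. -/
theorem exists_least_periodicDatum (hV : Continuous V) {M : ℝ} (hM : ∀ x, |V x| ≤ M)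
    (hh : 0 < h) {n : ℕ} (hn : 1 ≤ n) :
    ∃ μ t, IsPeriodicDatum V h n μ t ∧ (∀ s, turn V h μ s ≤ 2 * π * n) ∧
      ∀ ν s, turn V h ν s = 2 * π * n → μ ≤ ν := by
  obtain ⟨β, t₀, hβ, -, hub⟩ := exists_greatest_periodicDatum hV hM hh n
  have hα : ∀ t, turn V h (-M) t < 2 * π * n := by
    intro t
    have := turn_lt_pi hV hh (μ := -M) (fun x => by linarith [(abs_le.1 (hM x)).1]) t
    have h2 : (1 : ℝ) ≤ n := by exact_mod_cast hn
    nlinarith [pi_pos]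
  have hlb : ∀ ν s, turn V h ν s = 2 * π * n → -M ≤ ν := by
    intro ν s hs
    by_contra hcon
    push Not at hcon
    have := turn_lt_turn hV hh hcon s
    linarith [hα s]
  obtain ⟨μ, ⟨hμ1, t, ht⟩, hμ2⟩ :=
    (isCompact_turn_eq hV hM hh (-M) β (2 * π * n)).exists_isLeast
    ⟨β, ⟨hlb _ _ hβ.1, le_rfl⟩, t₀, hβ.1⟩
  have hmin : ∀ ν s, turn V h ν s = 2 * π * n → μ ≤ ν := fun ν s hs =>
    hμ2 ⟨⟨hlb _ _ hs, hub _ _ hs⟩, s, hs⟩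
  have hext : ∀ s, turn V h μ s ≤ 2 * π * n := by
    intro s
    by_contra hcon
    push Not at hcon
    obtain ⟨ν, hν, hνs⟩ := exists_turn_eq_between hV hM hh hμ1.1 (hα s).le hcon.le
    have := hmin ν s hνs
    have : ν = μ := le_antisymm hν.2 this
    rw [this] at hνs
    exact hcon.ne' hνs
  exact ⟨μ, t, ⟨ht, amplitude_eq_one_of_extremal hV hh ht (Or.inr hext)⟩, hext, hmin⟩

theorem sol_ne_zero (hV : Continuous V) (hh : 0 < h) (μ t : ℝ) : sol V h μ t ≠ 0 := by
  intro h0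
  have h1 := isLinearSolution_sol hV hh μ t
  have h2 : cos t = 0 := by
    have h3 := h1.left (-π)
    rw [h0] at h3
    have := h3.unique (hasDerivAt_const (-π) (0 : ℝ))
    rw [dsol_neg_pi hV hh] at this
    simpa [hh.ne'] using this
  have h3 : sin t = 0 := by rw [← sol_neg_pi hV hh μ t, h0]; rfl
  have := sin_sq_add_cos_sq t
  rw [h2, h3] at this
  norm_num at this

/-! ### Orthogonality of periodic solutions and location of the eigenvalues. -/

theorem integral_sq_ne_zero {μ : ℝ} {y : ℝ → ℝ}
    (hy : IsPeriodicSolution V h μ y) (hne : y ≠ 0) : (∫ x in (-π)..π, y x * y x) ≠ 0 := by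
  intro h0
  have hc := hy.contDiff.continuous
  have hpos : ∃ c ∈ Set.Icc (-π) π, y c ≠ 0 := by
    by_contra hcon
    push Not at hcon
    refine hne (funext fun x => ?_)
    obtain ⟨z, hz, hxz⟩ := hy.periodic.exists_mem_Ico (by positivity) x (-π)
    rw [hxz]
    exact hcon z ⟨hz.1, by linarith [hz.2]⟩
  obtain ⟨c, hc1, hc2⟩ := hpos
  have := intervalIntegral.integral_pos (a := -π) (b := π) (f := fun x => y x * y x)
    (by linarith [pi_pos]) (by fun_prop) (fun x _ => mul_self_nonneg _)
    ⟨c, hc1, mul_self_pos.2 hc2⟩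
  linarith

/-- Lagrange's identity: the Wronskian has derivative `(μ - ν) / h · y z` and is periodic. -/
theorem integral_mul_eq_zero (hh : 0 < h) {μ ν : ℝ} {y z : ℝ → ℝ}
    (hy : IsPeriodicSolution V h μ y) (hz : IsPeriodicSolution V h ν z) (hμν : μ ≠ ν) :
    (∫ x in (-π)..π, y x * z x) = 0 := by
  have h1 := hy.isLinearSolution hh
  have h2 := hz.isLinearSolution hh
  have hcy := hy.contDiff.continuous
  have hcz := hz.contDiff.continuous
  have hd : ∀ x, HasDerivAt (fun x => y x * (h * deriv z x) - z x * (h * deriv y x))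
      ((μ - ν) / h * (y x * z x)) x := fun x => by
    refine (((h1.left x).fun_mul (h2.right x)).fun_sub
      ((h2.left x).fun_mul (h1.right x))).congr_deriv ?_
    ring
  have h3 := intervalIntegral.integral_eq_sub_of_hasDerivAt (a := -π) (b := π)
    (fun x _ => hd x) ((by fun_prop : Continuous _).intervalIntegrable _ _)
  have hper : ∀ {μ y}, IsPeriodicSolution V h μ y → y π = y (-π) ∧ deriv y π = deriv y (-π) := by
    intro μ y hy
    have e : -π + 2 * π = π := by ring
    have h3 : deriv (fun x => y (x + 2 * π)) (-π) = deriv y (-π) := by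
      congr 1; exact funext hy.periodic
    rw [deriv_comp_add_const, e] at h3
    have h4 := hy.periodic (-π)
    rw [e] at h4
    exact ⟨h4, h3⟩
  rw [(hper hy).1, (hper hy).2, (hper hz).1, (hper hz).2, sub_self,
    intervalIntegral.integral_const_mul] at h3
  refine (mul_eq_zero.1 h3).resolve_left ?_
  exact div_ne_zero (sub_ne_zero.2 hμν) hh.ne'

/-- For every positive number of turns there are two orthogonal periodic solutions. -/
theorem exists_two_periodicSolutions (hV : Continuous V) (hper : Function.Periodic V (2 * π))
    {M : ℝ} (hM : ∀ x, |V x| ≤ M) (hh : 0 < h) {n : ℕ} (hn : 1 ≤ n) :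
    ∃ (μ : Bool → ℝ) (y : Bool → ℝ → ℝ), (∀ b, IsPeriodicSolution V h (μ b) (y b)) ∧
      (∀ b, y b ≠ 0) ∧ (∀ b, ∃ t, turn V h (μ b) t = 2 * π * n) ∧
      ∫ x in (-π)..π, y false x * y true x = 0 := by
  obtain ⟨μ, s, hs, hs1, -⟩ := exists_greatest_periodicDatum hV hM hh n
  obtain ⟨ν, t, ht, ht1, -⟩ := exists_least_periodicDatum hV hM hh hn
  -- If the greatest and the least parameter coincide, every direction makes exactly `n` turns, so
  -- all solutions are periodic and a Gram–Schmidt step gives an orthogonal pair. Otherwise the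
  -- eigenvalues differ and orthogonality is automatic.
  by_cases hμν : μ = ν
  · subst hμν
    have hall : ∀ r, IsPeriodicDatum V h n μ r := fun r => by
      have h1 : ∀ r, turn V h μ r = 2 * π * n := fun r => le_antisymm (ht1 r) (hs1 r)
      exact ⟨h1 r, amplitude_eq_one_of_extremal hV hh (h1 r) (Or.inl hs1)⟩
    have hP : ∀ r, IsPeriodicSolution V h μ (sol V h μ r) := fun r =>
      isPeriodicSolution_sol hV hper hh (hall r).1 (hall r).2
    have hne := integral_sq_ne_zero (hP 0) (sol_ne_zero hV hh μ 0)
    set k := (∫ x in (-π)..π, sol V h μ 0 x * sol V h μ (π / 2) x) /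
      ∫ x in (-π)..π, sol V h μ 0 x * sol V h μ 0 x with hk
    have hL0 := isLinearSolution_sol hV hh μ 0
    have hL1 := isLinearSolution_sol hV hh μ (π / 2)
    have hL := hL1.add hL0 1 (-k)
    obtain ⟨c, r, hcr, -⟩ := hL.exists_eq_mul_sol hV hh
    have hy2 : IsPeriodicSolution V h μ fun x => 1 * sol V h μ (π / 2) x + -k * sol V h μ 0 x := by
      refine hL.isPeriodicSolution hV hper hh ?_ ?_
      · have e : -π + 2 * π = π := by ring
        have h1 := (hP 0).periodic (-π)
        have h2 := (hP (π / 2)).periodic (-π)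
        rw [e] at h1 h2
        simp only [h1, h2]
      · simp only [dsol_pi, dsol_neg_pi hV hh, (hall _).1, (hall _).2,
          show 2 * π * (n : ℝ) = n * (2 * π) by ring, cos_add_nat_mul_two_pi, one_mul]
    refine ⟨fun _ => μ, fun b => bif b then
      (fun x => 1 * sol V h μ (π / 2) x + -k * sol V h μ 0 x) else sol V h μ 0, ?_, ?_,
      fun _ => ⟨s, hs.1⟩, ?_⟩
    · rintro (_ | _)
      · exact hP 0
      · exact hy2
    · rintro (_ | _)
      · exact sol_ne_zero hV hh μ 0
      · intro h0
        have := congrFun h0 (-π)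
        simp [sol_neg_pi hV hh] at this
    · have hc0 := hL0.continuous_left
      have hc1 := hL1.continuous_left
      simp only [cond_false, cond_true]
      have : ∀ x, sol V h μ 0 x * (1 * sol V h μ (π / 2) x + -k * sol V h μ 0 x) =
          sol V h μ 0 x * sol V h μ (π / 2) x - k * (sol V h μ 0 x * sol V h μ 0 x) := fun x => by
        ring
      simp only [this]
      rw [intervalIntegral.integral_sub ((by fun_prop : Continuous _).intervalIntegrable _ _)
        ((by fun_prop : Continuous _).intervalIntegrable _ _),
        intervalIntegral.integral_const_mul, hk, div_mul_cancel₀ _ hne, sub_self]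
  · have h1 := isPeriodicSolution_sol hV hper hh hs.1 hs.2
    have h2 := isPeriodicSolution_sol hV hper hh ht.1 ht.2
    refine ⟨fun b => bif b then μ else ν, fun b => bif b then sol V h μ s else sol V h ν t,
      ?_, ?_, ?_, ?_⟩
    · rintro (_ | _)
      · exact h2
      · exact h1
    · rintro (_ | _)
      · exact sol_ne_zero hV hh _ _
      · exact sol_ne_zero hV hh _ _
    · rintro (_ | _)
      · exact ⟨t, ht.1⟩
      · exact ⟨s, hs.1⟩
    · exact integral_mul_eq_zero hh h2 h1 (Ne.symm hμν)

theorem linearIndependent_of_integral_mul_eq_zero {ι : Type*} {y : ι → ℝ → ℝ}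
    (hc : ∀ i, Continuous (y i)) (h1 : ∀ i, (∫ x in (-π)..π, y i x * y i x) ≠ 0)
    (h2 : ∀ i j, i ≠ j → (∫ x in (-π)..π, y i x * y j x) = 0) : LinearIndependent ℝ y := by
  rw [linearIndependent_iff']
  intro s g hg i hi
  have h3 : (∫ x in (-π)..π, (∑ j ∈ s, g j • y j) x * y i x) = 0 := by rw [hg]; simp
  have h4 : ∀ x, (∑ j ∈ s, g j • y j) x * y i x = ∑ j ∈ s, g j * (y j x * y i x) := fun x => by
    simp [Finset.sum_apply, Finset.sum_mul, mul_assoc]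
  simp only [h4] at h3
  rw [intervalIntegral.integral_finsetSum] at h3
  · simp only [intervalIntegral.integral_const_mul] at h3
    rw [Finset.sum_eq_single_of_mem i hi] at h3
    · exact (mul_eq_zero.1 h3).resolve_right (h1 i)
    · intro j _ hj
      rw [h2 j i hj, mul_zero]
  · intro j _
    have := hc i
    have := hc j
    exact (by fun_prop : Continuous _).intervalIntegrable _ _

/-- The eigenvalues with indices `2m+1` and `2m+2` lie between the bounds that hold for all `μ`
for which some Prüfer angle makes exactly `m+1` turns. -/
theorem eigenvalue_mem_Icc (hV : Continuous V) (hper : Function.Periodic V (2 * π))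
    {M : ℝ} (hM : ∀ x, |V x| ≤ M) (hh : 0 < h) {m : ℕ} {L U : ℝ}
    (hLU : ∀ μ t, turn V h μ t = 2 * π * (m + 1 : ℕ) → L ≤ μ ∧ μ ≤ U) {j : ℕ}
    (hj : j = 1 ∨ j = 2) : eigenvalue V h (2 * m + j) ∈ Set.Icc L U := by
  obtain ⟨μ₀, t₀, hd₀, -, -⟩ := exists_greatest_periodicDatum hV hM hh (m + 1)
  obtain ⟨ν, s, hds, -, -⟩ := exists_greatest_periodicDatum hV hM hh 0
  choose μ y hμy hy0 hturn horth using fun n : Fin (m + 1) =>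
    exists_two_periodicSolutions hV hper hM hh (n := n + 1) (by omega)
  -- A family of `2m + 3` periodic solutions: `none` is the one without turns, and `some (n, b)` are
  -- the two with `n + 1` turns.
  let lam : Option (Fin (m + 1) × Bool) → ℝ := fun o => o.elim ν fun q => μ q.1 q.2
  let f : Option (Fin (m + 1) × Bool) → ℝ → ℝ := fun o => o.elim (sol V h ν s) fun q => y q.1 q.2
  let num : Option (Fin (m + 1) × Bool) → ℕ := fun o => o.elim 0 fun q => q.1 + 1
  have hf : ∀ o, IsPeriodicSolution V h (lam o) (f o) := by
    rintro (_ | q)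
    · exact isPeriodicSolution_sol hV hper hh hds.1 hds.2
    · exact hμy q.1 q.2
  have hf0 : ∀ o, f o ≠ 0 := by
    rintro (_ | q)
    · exact sol_ne_zero hV hh _ _
    · exact hy0 q.1 q.2
  have hnum : ∀ o, ∃ t, turn V h (lam o) t = 2 * π * num o := by
    rintro (_ | q)
    · exact ⟨s, hds.1⟩
    · exact hturn q.1 q.2
  have hne : ∀ o o', num o ≠ num o' → lam o ≠ lam o' := by
    intro o o' hoo heq
    obtain ⟨t, ht⟩ := hnum o
    obtain ⟨t', ht'⟩ := hnum o'
    exact hoo (le_antisymm (turn_monotone_counts hV hh ht ht' heq.le)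
      (turn_monotone_counts hV hh ht' ht heq.ge))
  have hli : LinearIndependent ℝ f := by
    refine linearIndependent_of_integral_mul_eq_zero (fun o => (hf o).contDiff.continuous)
      (fun o => integral_sq_ne_zero (hf o) (hf0 o)) fun o o' hoo => ?_
    by_cases hn : num o = num o'
    · rcases o with _ | ⟨a, b⟩ <;> rcases o' with _ | ⟨a', b'⟩
      · exact absurd rfl hoo
      · simp [num] at hn
      · simp [num] at hn
      · have haa : a = a' := Fin.ext (by simpa [num] using hn)
        subst haa
        rcases b with _ | _ <;> rcases b' with _ | _
        · exact absurd rfl hoo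
        · exact horth a
        · simp only [f, Option.elim]
          simp only [mul_comm (y a true _)]
          exact horth a
        · exact absurd rfl hoo
    · exact integral_mul_eq_zero hh (hf o) (hf o') (hne o o' hn)
  have hlamU : ∀ o, lam o ≤ U := by
    intro o
    obtain ⟨t, ht⟩ := hnum o
    by_cases hn : num o = m + 1
    · exact (hLU _ t (hn ▸ ht)).2
    · refine le_trans ?_ (hLU _ _ hd₀.1).2
      by_contra hcon
      push Not at hcon
      have h1 := turn_monotone_counts hV hh hd₀.1 ht hcon.le
      have h2 : num o ≤ m + 1 := by
        rcases o with _ | ⟨a, b⟩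
        · simp [num]
        · simp only [num, Option.elim]; omega
      omega
  have hmem : U ∈ {lam : ℝ | ∃ y : Fin (2 * m + j + 1) → ℝ → ℝ, LinearIndependent ℝ y ∧
      ∀ i, ∃ μ ≤ lam, IsPeriodicSolution V h μ (y i)} := by
    have hcard : Fintype.card (Fin (2 * m + j + 1)) ≤
        Fintype.card (Option (Fin (m + 1) × Bool)) := by
      simp only [Fintype.card_fin, Fintype.card_option, Fintype.card_prod, Fintype.card_bool]
      omega
    obtain ⟨e⟩ := Function.Embedding.nonempty_of_card_le hcard
    exact ⟨fun i => f (e i), hli.comp _ e.injective, fun i => ⟨lam (e i), hlamU _, hf _⟩⟩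
  have hlb : ∀ lam ∈ {lam : ℝ | ∃ y : Fin (2 * m + j + 1) → ℝ → ℝ, LinearIndependent ℝ y ∧
      ∀ i, ∃ μ ≤ lam, IsPeriodicSolution V h μ (y i)}, L ≤ lam := by
    rintro lam ⟨y, hyli, hy⟩
    choose μ hμ hyμ using hy
    choose c t n hc hyc ht ha using fun i => (hyμ i).exists_turn_eq hV hh (hyli.ne_zero i)
    have hli' : LinearIndependent ℝ fun i => sol V h (μ i) (t i) := by
      have := hyli.units_smul fun i => (Units.mk0 (c i) (hc i))⁻¹
      convert this using 1
      funext i x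
      rw [Pi.smul_apply', hyc i]
      simp [Units.smul_def, hc i]
    -- There are `2m + j + 1 ≥ 2m + 2` independent solutions, while at most `2m + 1` can have `m`
    -- turns or fewer.
    have hex : ∃ i, m + 1 ≤ n i := by
      by_contra hcon
      push Not at hcon
      have := card_le_of_turn_le hV hh (fun i => ⟨ht i, ha i⟩)
        (fun i => Nat.le_of_lt_succ (hcon i)) hli'
      omega
    obtain ⟨i, hi⟩ := hex
    refine le_trans ?_ (hμ i)
    rcases hi.eq_or_lt with h1 | h1
    · exact (hLU _ (t i) (h1 ▸ ht i)).1
    · refine (hLU _ _ hd₀.1).1.trans ?_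
      by_contra hcon
      push Not at hcon
      have h2 := turn_monotone_counts hV hh (ht i) hd₀.1 hcon.le
      omega
  exact ⟨le_csInf ⟨U, hmem⟩ hlb, csInf_le ⟨L, hlb⟩ hmem⟩

end

/-! ### The phase of an approximate WKB solution -/

section
open Complex ComplexConjugate

/-- The complex amplitude of a solution with Prüfer angle `θ` relative to the approximate
logarithmic derivative `i S / h`. -/
noncomputable def wave (S : ℝ → ℂ) (θ : ℝ → ℝ) (x : ℝ) : ℂ :=
  ((Real.sin (θ x) : ℝ) : ℂ) -
    I * (((Real.cos (θ x) + (S x).im * Real.sin (θ x)) / (S x).re : ℝ) : ℂ)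

/-- `z = wave S θ x` is determined by `Re z = sin θ` and `Re (i S z) = cos θ`: the exact solution is
the real part of `ρ z`, and its scaled derivative is that of `i S ρ z`. Both cannot vanish. -/
theorem wave_ne_zero {S : ℝ → ℂ} {x : ℝ} (hS : 0 < (S x).re) (θ : ℝ → ℝ) : wave S θ x ≠ 0 := by
  intro h0
  have h1 := congrArg Complex.re h0
  have h2 := congrArg Complex.im h0
  simp only [wave, sub_re, ofReal_re, mul_re, I_re, I_im, ofReal_im, zero_mul, one_mul,
    sub_zero, zero_re, sub_im, mul_im, zero_im, zero_sub, zero_add, mul_zero] at h1 h2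
  rw [h1, mul_zero, add_zero, neg_eq_zero, div_eq_zero_iff] at h2
  have h3 := Real.sin_sq_add_cos_sq (θ x)
  rw [h1, h2.resolve_right hS.ne'] at h3
  norm_num at h3

/-- The residual of `i S / h` in the Riccati equation of `h² y'' + (μ - V) y = 0`. -/
noncomputable def residual (V : ℝ → ℝ) (h μ : ℝ) (S S' : ℝ → ℂ) (x : ℝ) : ℂ :=
  I * h * S' x - S x ^ 2 + (μ - V x : ℝ)

/-- The phase velocity, multiplied by `h`, when the conjugate phase factor is `u`. -/
noncomputable def phaseVelocity (V : ℝ → ℝ) (h μ : ℝ) (S S' u : ℝ → ℂ) (x : ℝ) : ℝ :=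
  (S x + (residual V h μ S S' x + conj (residual V h μ S S' x) * u x) / (2 * (S x).re : ℝ)).re

/-- With zero residual, `ρ z` would have the logarithmic derivative `i S / h`. The residual couples
`z` to its conjugate, and the last real term accounts for the amplitude `ρ` that has been divided
out. -/
theorem hasDerivAt_wave {V : ℝ → ℝ} {h μ : ℝ} (hh : 0 < h) {θ : ℝ → ℝ}
    (hθ : IsPruferAngle h (fun x => μ - V x) θ) {S S' : ℝ → ℂ} {x : ℝ} (hS : 0 < (S x).re)
    (hd : HasDerivAt S (S' x) x) :
    HasDerivAt (wave S θ) (wave S θ x / h * (I * (S x + (residual V h μ S S' x +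
        conj (residual V h μ S S' x) * (conj (wave S θ x) / wave S θ x)) / (2 * (S x).re : ℝ)) -
      ((1 - (μ - V x)) * Real.sin (θ x) * Real.cos (θ x) : ℝ))) x := by
  have hre : HasDerivAt (fun x => (S x).re) (S' x).re x :=
    Complex.reCLM.hasFDerivAt.comp_hasDerivAt x hd
  have him : HasDerivAt (fun x => (S x).im) (S' x).im x :=
    Complex.imCLM.hasFDerivAt.comp_hasDerivAt x hd
  have h1 := (((hθ x).cos.fun_add (him.fun_mul (hθ x).sin)).fun_div hre hS.ne').ofReal_comp
  refine ((hθ x).sin.ofReal_comp.fun_sub (h1.const_mul I)).congr_deriv ?_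
  have hz := wave_ne_zero hS θ
  have hh' : (h : ℂ) ≠ 0 := ofReal_ne_zero.2 hh.ne'
  have hP : ((S x).re : ℂ) ≠ 0 := ofReal_ne_zero.2 hS.ne'
  have hcs := Real.sin_sq_add_cos_sq (θ x)
  have e : wave S θ x / h * (I * (S x + (residual V h μ S S' x +
        conj (residual V h μ S S' x) * (conj (wave S θ x) / wave S θ x)) / (2 * (S x).re : ℝ)) -
      ((1 - (μ - V x)) * Real.sin (θ x) * Real.cos (θ x) : ℝ)) =
      (1 / h) * (I * (S x * wave S θ x + (residual V h μ S S' x * wave S θ x +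
        conj (residual V h μ S S' x) * conj (wave S θ x)) / (2 * (S x).re : ℝ)) -
      ((1 - (μ - V x)) * Real.sin (θ x) * Real.cos (θ x) : ℝ) * wave S θ x) := by
    push_cast
    field_simp
  rw [e]
  have e2 : residual V h μ S S' x * wave S θ x +
        conj (residual V h μ S S' x) * conj (wave S θ x) =
      ((2 * (residual V h μ S S' x * wave S θ x).re : ℝ) : ℂ) := by
    rw [← map_mul, Complex.add_conj]
  rw [e2, ← ofReal_div]
  have hsre : ∀ w : ℂ, ((1 / (h : ℂ)) * w).re = 1 / h * w.re := fun w => by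
    rw [← ofReal_one, ← ofReal_div, re_ofReal_mul]
  have hsim : ∀ w : ℂ, ((1 / (h : ℂ)) * w).im = 1 / h * w.im := fun w => by
    rw [← ofReal_one, ← ofReal_div, im_ofReal_mul]
  set s := Real.sin (θ x)
  set c := Real.cos (θ x)
  have hh0 := hh.ne'
  have hP0 := hS.ne'
  have hres_re : (residual V h μ S S' x).re =
      -h * (S' x).im - ((S x).re ^ 2 - (S x).im ^ 2) + (μ - V x) := by
    simp [residual, sq]
  have hres_im : (residual V h μ S S' x).im = h * (S' x).re - 2 * (S x).re * (S x).im := by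
    simp [residual, sq]; ring
  have hw_re : (wave S θ x).re = s := by
    simp only [wave, sub_re, mul_re, ofReal_re, ofReal_im, I_re, I_im, zero_mul, mul_zero,
      sub_zero, s]
  have hw_im : (wave S θ x).im = -((c + (S x).im * s) / (S x).re) := by
    simp only [wave, sub_im, mul_im, ofReal_re, ofReal_im, I_re, I_im, zero_mul, one_mul,
      zero_sub, zero_add, s, c]
  generalize wave S θ x = z at *
  generalize residual V h μ S S' x = R at *
  apply Complex.ext
  · rw [hsre]
    simp only [sub_re, mul_re, ofReal_re, ofReal_im, I_re, I_im, add_re, add_im, mul_im, hw_re, hw_im,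
      hres_re, hres_im, zero_mul, one_mul, mul_zero, sub_zero, zero_sub, add_zero]
    field_simp
    linear_combination c * hcs
  · rw [hsim]
    simp only [sub_im, mul_re, ofReal_re, ofReal_im, I_re, I_im, add_re, add_im, mul_im, hw_re, hw_im,
      hres_re, hres_im, zero_mul, one_mul, mul_zero, zero_sub, zero_add, add_zero]
    field_simp
    linear_combination (S x).re * ((μ - V x) * s - (S x).im * c) * hcs

/-- The second factor is `i e^{-iθ}`: some value of `arg z` always stays within less than `π` of `θ
- π / 2`, so that it can be followed continuously without counting windings. -/
theorem wave_mul_mem_slitPlane {S : ℝ → ℂ} {x : ℝ} (hS : 0 < (S x).re) (θ : ℝ → ℝ) :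
    wave S θ x * ((Real.sin (θ x) : ℝ) + I * (Real.cos (θ x) : ℝ)) ∈ slitPlane := by
  set s := Real.sin (θ x) with hs
  set c := Real.cos (θ x) with hc
  have hcs : s ^ 2 + c ^ 2 = 1 := Real.sin_sq_add_cos_sq (θ x)
  set r := (c + (S x).im * s) / (S x).re with hr
  have hw : wave S θ x = (s : ℂ) - I * (r : ℂ) := rfl
  rw [hw, mem_slitPlane_iff]
  have e : ((s : ℂ) - I * r) * (s + I * c) = ((s * s + r * c : ℝ) : ℂ) + (s * c - s * r : ℝ) * I := by
    push_cast
    linear_combination (-(r : ℂ) * c) * I_mul_I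
  rw [e]
  simp only [add_re, ofReal_re, mul_re, ofReal_im, I_re, I_im, mul_zero, sub_zero,
    add_zero, add_im, mul_im, mul_one, zero_add]
  by_cases h0 : s * c - s * r = 0
  · left
    rw [← mul_sub] at h0
    rcases mul_eq_zero.1 h0 with h1 | h1
    · rw [h1] at hcs hr ⊢
      have h2 : 0 < c ^ 2 := by nlinarith
      have : r * c = c ^ 2 / (S x).re := by rw [hr]; ring
      rw [this]
      have := div_pos h2 hS
      linarith
    · rw [← sub_eq_zero.1 h1]; nlinarith
  · exact Or.inr h0

/-- The exact phase identity: the phase increment of a solution that makes `n` turns, computed from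
an approximate logarithmic derivative `i S / h`. -/
theorem exists_phase {V : ℝ → ℝ} (hV : Continuous V) {h μ t : ℝ} (hh : 0 < h) {n : ℕ}
    (hn : turn V h μ t = 2 * π * n) {S S' : ℝ → ℂ} (hSc : Continuous S) (hper : S π = S (-π))
    (hpos : ∀ x, 0 < (S x).re) {E : Set ℝ} (hE : E.Countable)
    (hd : ∀ x ∉ E, HasDerivAt S (S' x) x)
    (hint : IntervalIntegrable S' MeasureTheory.volume (-π) π) :
    ∃ u : ℝ → ℂ, Continuous u ∧ (∀ x, ‖u x‖ = 1) ∧ u π = u (-π) ∧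
      (∀ x ∉ E, HasDerivAt u (-(2 * I / h) * phaseVelocity V h μ S S' u x * u x) x) ∧
      IntervalIntegrable (phaseVelocity V h μ S S' u) MeasureTheory.volume (-π) π ∧
      ∫ x in (-π)..π, phaseVelocity V h μ S S' u x = 2 * π * n * h := by
  set θ := angle V h μ t with hθdef
  have hθ : IsPruferAngle h (fun x => μ - V x) θ := (angle_spec hV hh μ t).2
  have hθc := hθ.continuous
  have hθπ : θ π = θ (-π) + n * (2 * π) := by
    have h1 := (angle_spec hV hh μ t).1
    have h2 : turn V h μ t = θ π - t := rfl
    rw [← hθdef] at h1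
    rw [h1]; linarith
  have hz : ∀ x, wave S θ x ≠ 0 := fun x => wave_ne_zero (hpos x) θ
  have hre : Continuous fun x => (S x).re := Complex.continuous_re.comp hSc
  have him : Continuous fun x => (S x).im := Complex.continuous_im.comp hSc
  have hzc : Continuous (wave S θ) := by
    unfold wave
    have : Continuous fun x => (Real.cos (θ x) + (S x).im * Real.sin (θ x)) / (S x).re :=
      Continuous.div (by fun_prop) hre fun x => (hpos x).ne'
    fun_prop
  have hwper : wave S θ π = wave S θ (-π) := by
    simp only [wave, hper, hθπ, Real.sin_add_nat_mul_two_pi, Real.cos_add_nat_mul_two_pi]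
  have huc : Continuous fun x => conj (wave S θ x) / wave S θ x :=
    Continuous.div (Complex.continuous_conj.comp hzc) hzc hz
  set u : ℝ → ℂ := fun x => conj (wave S θ x) / wave S θ x with hu
  set ω := phaseVelocity V h μ S S' u with hω
  have hh' : (h : ℂ) ≠ 0 := ofReal_ne_zero.2 hh.ne'
  have hzd : ∀ x ∉ E, HasDerivAt (wave S θ) (wave S θ x / h *
      (I * (S x + (residual V h μ S S' x + conj (residual V h μ S S' x) * u x) /
        (2 * (S x).re : ℝ)) - ((1 - (μ - V x)) * Real.sin (θ x) * Real.cos (θ x) : ℝ))) x :=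
    fun x hx => hasDerivAt_wave hh hθ (hpos x) (hd x hx)
  have hint' : IntervalIntegrable ω MeasureTheory.volume (-π) π := by
    have h2P : Continuous fun x => (1 / (2 * (S x).re : ℝ) : ℂ) := by
      have : Continuous fun x => 1 / (2 * (S x).re) :=
        Continuous.div (by fun_prop) (by fun_prop) fun x => by linarith [hpos x]
      have h2 : (fun x => (1 / (2 * (S x).re : ℝ) : ℂ)) =
          fun x => (((1 / (2 * (S x).re) : ℝ)) : ℂ) := by
        funext x; push_cast; rfl
      rw [h2]; fun_prop
    have hR : IntervalIntegrable (residual V h μ S S') MeasureTheory.volume (-π) π := by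
      unfold residual
      exact ((hint.const_mul _).sub ((by fun_prop : Continuous _).intervalIntegrable _ _)).add
        ((by fun_prop : Continuous _).intervalIntegrable _ _)
    have hRc : IntervalIntegrable (fun x => conj (residual V h μ S S' x))
        MeasureTheory.volume (-π) π := by
      rw [intervalIntegrable_iff] at hR ⊢
      exact Complex.conjCLE.toContinuousLinearMap.integrable_comp hR
    have hC : IntervalIntegrable (fun x => S x + (residual V h μ S S' x +
        conj (residual V h μ S S' x) * u x) / (2 * (S x).re : ℝ)) MeasureTheory.volume (-π) π := by
      have h3 := (hSc.intervalIntegrable (μ := MeasureTheory.volume) (-π) π).add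
        ((hR.add (hRc.mul_continuousOn huc.continuousOn)).mul_continuousOn h2P.continuousOn)
      refine h3.congr (fun x _ => ?_)
      simp only [div_eq_mul_inv, one_mul]
    rw [intervalIntegrable_iff] at hC ⊢
    exact Complex.reCLM.integrable_comp hC
  refine ⟨u, huc, ?_, ?_, ?_, hint', ?_⟩
  · intro x
    rw [hu]
    simp only [norm_div, RCLike.norm_conj]
    exact div_self (norm_ne_zero_iff.2 (hz x))
  · simp only [hu, hwper]
  · intro x hx
    have h1 := hzd x hx
    have h2 : HasDerivAt (fun x => conj (wave S θ x)) _ x :=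
      Complex.conjCLE.toContinuousLinearMap.hasFDerivAt.comp_hasDerivAt x h1
    refine (h2.fun_div h1 (hz x)).congr_deriv ?_
    set F := S x + (residual V h μ S S' x + conj (residual V h μ S S' x) * u x) /
        (2 * (S x).re : ℝ) with hF
    have hFre : ((F.re : ℝ) : ℂ) = (F + conj F) / 2 := by
      rw [Complex.add_conj]; push_cast; ring
    change _ = -(2 * I / h) * ((F.re : ℝ) : ℂ) * u x
    rw [hFre]
    have hux : u x = conj (wave S θ x) / wave S θ x := rfl
    rw [hux]
    simp only [ContinuousLinearEquiv.coe_apply,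
      conjCLE_apply, map_mul, map_div₀, map_sub, conj_I, conj_ofReal]
    have := hz x
    field_simp
    ring
  · have hw : ∀ x, wave S θ x * ((Real.sin (θ x) : ℝ) + I * (Real.cos (θ x) : ℝ)) ∈ slitPlane :=
      fun x => wave_mul_mem_slitPlane (hpos x) θ
    set e : ℝ → ℂ := fun x => (Real.sin (θ x) : ℝ) + I * (Real.cos (θ x) : ℝ) with he
    have hec : Continuous e := by fun_prop
    -- `g` is a continuous branch of `arg z + π / 2`. The logarithm is periodic, so the increment of
    -- `g` is that of `θ`, namely `2πn`; its derivative is `ω / h`.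
    set g : ℝ → ℝ := fun x => (Complex.log (wave S θ x * e x)).im + θ x with hg
    have hgc : Continuous g := by
      have hl : Continuous fun x => Complex.log (wave S θ x * e x) := by
        rw [continuous_iff_continuousAt]
        intro x
        exact ((hzc.mul hec).continuousAt).clog (hw x)
      exact (Complex.continuous_im.comp hl).add hθc
    have hgd : ∀ x ∉ E, HasDerivAt g (ω x / h) x := by
      intro x hx
      have hes : HasDerivAt e (-(I * ((Real.cos (θ x) ^ 2 + (μ - V x) * Real.sin (θ x) ^ 2) / h : ℝ))
          * e x) x := by
        refine ((hθ x).sin.ofReal_comp.fun_add ((hθ x).cos.ofReal_comp.const_mul I)).congr_deriv ?_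
        simp only [he]
        generalize Real.sin (θ x) = s
        generalize Real.cos (θ x) = c
        push_cast
        linear_combination (((c : ℂ) ^ 2 + (μ - V x) * s ^ 2) / h) * c * I_mul_I
      have h1 := ((hzd x hx).mul hes).clog_real (hw x)
      have h2 : HasDerivAt (fun x => (Complex.log (wave S θ x * e x)).im) _ x :=
        Complex.imCLM.hasFDerivAt.comp_hasDerivAt x h1
      refine (h2.fun_add (hθ x)).congr_deriv ?_
      set F := S x + (residual V h μ S S' x + conj (residual V h μ S S' x) * u x) /
        (2 * (S x).re : ℝ) with hF
      have hωF : ω x = F.re := rfl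
      have hex : e x ≠ 0 := right_ne_zero_of_mul (slitPlane_ne_zero (hw x))
      set k : ℝ := (1 - (μ - V x)) * Real.sin (θ x) * Real.cos (θ x)
      set q : ℝ := (Real.cos (θ x) ^ 2 + (μ - V x) * Real.sin (θ x) ^ 2) / h
      have h3 : (wave S θ x / h * (I * F - k) * e x + wave S θ x * (-(I * q) * e x)) /
          (wave S θ x * e x) = ((1 / h : ℝ) : ℂ) * (I * F - k) - I * q := by
        have := hz x
        push_cast
        field_simp
        ring
      simp only [Pi.mul_apply] at h3 ⊢
      rw [h3, hωF]
      simp only [imCLM_apply, sub_im, mul_im, I_re, I_im, ofReal_re, ofReal_im]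
      ring
    have h1 := MeasureTheory.integral_eq_of_hasDerivAt_off_countable g (fun x => ω x / h) hE
      (a := -π) (b := π) hgc.continuousOn (fun x hx => hgd x hx.2) (hint'.div_const h)
    rw [intervalIntegral.integral_div, div_eq_iff hh.ne'] at h1
    rw [h1]
    simp only [hg, he, hwper, hθπ, Real.sin_add_nat_mul_two_pi, Real.cos_add_nat_mul_two_pi]
    ring

end

/-! ### Oscillatory integrals -/

section
open MeasureTheory

/-- `u` is a periodic phase factor with the phase velocity `-2 ω / h`, where `|ω - lam| ≤ e`. -/
structure IsPhaseFactor (h lam e : ℝ) (u : ℝ → ℂ) : Prop where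
  continuous : Continuous u
  norm_eq : ∀ x, ‖u x‖ = 1
  exists_velocity : ∃ (ω : ℝ → ℝ) (E : Set ℝ), E.Countable ∧ IntervalIntegrable ω volume (-π) π ∧
    (∀ x, |ω x - lam| ≤ e) ∧ ∀ x ∉ E, HasDerivAt u (-(2 * Complex.I / h) * ω x * u x) x

theorem norm_integral_le_of_abs_le {f : ℝ → ℂ} {C : ℝ} (hf : ∀ x ∈ Set.Icc (-π) π, ‖f x‖ ≤ C) :
    ‖∫ x in (-π)..π, f x‖ ≤ C * (2 * π) := by
  have h1 := intervalIntegral.norm_integral_le_of_norm_le_const (a := -π) (b := π) (f := f) (C := C)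
    (fun x hx => hf x (by
      rw [Set.uIoc_of_le (by linarith [pi_pos])] at hx
      exact Set.Ioc_subset_Icc_self hx))
  rwa [show π - -π = 2 * π by ring, abs_of_pos two_pi_pos] at h1

/-- Integration by parts against `u' ≈ -(2 i lam / h) u`. The boundary values and `G'` gain the
factor `h / lam`; the deviation of the velocity from `lam` costs `e / lam`. -/
theorem IsPhaseFactor.norm_integral_le {h lam e : ℝ} (hh : 0 < h) (hlam : 0 < lam) {u : ℝ → ℂ}
    (hu : IsPhaseFactor h lam e u) {G G' : ℝ → ℂ} {B₀ B₁ : ℝ} (hG : Continuous G)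
    (hG' : IntervalIntegrable G' volume (-π) π) {E : Set ℝ} (hE : E.Countable)
    (hd : ∀ x ∉ E, HasDerivAt G (G' x) x) (h0 : ∀ x ∈ Set.Icc (-π) π, ‖G x‖ ≤ B₀)
    (h1 : ∀ x ∈ Set.Icc (-π) π, ‖G' x‖ ≤ B₁) :
    ‖∫ x in (-π)..π, G x * u x‖ ≤ h / lam * (B₀ + π * B₁) + 2 * π * B₀ * (e / lam) := by
  obtain ⟨ω, F, hF, hωi, hω, hud⟩ := hu.exists_velocity
  have huc := hu.continuous
  have e0 : 0 ≤ e := (abs_nonneg _).trans (hω 0)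
  have hpi : (-π) ≤ π := by linarith [pi_pos]
  have hB0 : 0 ≤ B₀ := (norm_nonneg _).trans (h0 π ⟨hpi, le_rfl⟩)
  have hωc : IntervalIntegrable (fun x => ((ω x - lam : ℝ) : ℂ)) volume (-π) π := by
    have : IntervalIntegrable (fun x => ω x - lam) volume (-π) π :=
      hωi.sub (continuous_const.intervalIntegrable _ _)
    rw [intervalIntegrable_iff] at this ⊢
    exact this.ofReal
  have hi1 : IntervalIntegrable (fun x => G' x * u x) volume (-π) π :=
    hG'.mul_continuousOn huc.continuousOn
  have hi2 : IntervalIntegrable (fun x => G x * u x) volume (-π) π :=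
    (hG.mul huc).intervalIntegrable _ _
  have hi3 : IntervalIntegrable (fun x => ((ω x - lam : ℝ) : ℂ) * (G x * u x)) volume (-π) π :=
    hωc.mul_continuousOn (hG.mul huc).continuousOn
  have hftc := integral_eq_of_hasDerivAt_off_countable (fun x => G x * u x)
    (fun x => G' x * u x - 2 * Complex.I * lam / h * (G x * u x) -
      2 * Complex.I / h * (((ω x - lam : ℝ) : ℂ) * (G x * u x))) (hE.union hF) (a := -π) (b := π)
    (hG.mul huc).continuousOn (fun x hx => by
      refine ((hd x fun hx' => hx.2 (Or.inl hx')).fun_mul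
        (hud x fun hx' => hx.2 (Or.inr hx'))).congr_deriv ?_
      push_cast; ring) ((hi1.sub (hi2.const_mul _)).sub (hi3.const_mul _))
  rw [intervalIntegral.integral_sub (hi1.sub (hi2.const_mul _)) (hi3.const_mul _),
    intervalIntegral.integral_sub hi1 (hi2.const_mul _), intervalIntegral.integral_const_mul,
    intervalIntegral.integral_const_mul] at hftc
  set J := ∫ x in (-π)..π, G x * u x
  set J1 := ∫ x in (-π)..π, G' x * u x
  set J2 := ∫ x in (-π)..π, ((ω x - lam : ℝ) : ℂ) * (G x * u x)
  have hJ1 : ‖J1‖ ≤ B₁ * (2 * π) := norm_integral_le_of_abs_le fun x hx => by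
    rw [norm_mul, hu.norm_eq, mul_one]; exact h1 x hx
  have hJ2 : ‖J2‖ ≤ e * B₀ * (2 * π) := norm_integral_le_of_abs_le fun x hx => by
    rw [norm_mul, norm_mul, hu.norm_eq, mul_one, Complex.norm_real, Real.norm_eq_abs]
    exact mul_le_mul (hω x) (h0 x hx) (norm_nonneg _) e0
  have hb : ‖G π * u π - G (-π) * u (-π)‖ ≤ 2 * B₀ := by
    refine (norm_sub_le _ _).trans ?_
    rw [norm_mul, norm_mul, hu.norm_eq, hu.norm_eq, mul_one, mul_one]
    linarith [h0 π ⟨hpi, le_rfl⟩, h0 (-π) ⟨le_rfl, hpi⟩]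
  have hh' : (h : ℂ) ≠ 0 := Complex.ofReal_ne_zero.2 hh.ne'
  have hl' : (lam : ℂ) ≠ 0 := Complex.ofReal_ne_zero.2 hlam.ne'
  have hJ : J = ((h / (2 * lam) : ℝ) : ℂ) * (-Complex.I *
      (J1 - (G π * u π - G (-π) * u (-π)))) - ((1 / lam : ℝ) : ℂ) * J2 := by
    rw [← hftc]
    push_cast
    field_simp
    linear_combination (2 * J * lam + 2 * J2) * Complex.I_sq
  rw [hJ]
  refine (norm_sub_le _ _).trans ?_
  rw [norm_mul, norm_mul, norm_mul, norm_neg, Complex.norm_I, one_mul, Complex.norm_real,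
    Complex.norm_real, Real.norm_of_nonneg (by positivity), Real.norm_of_nonneg (by positivity)]
  have h2 : ‖J1 - (G π * u π - G (-π) * u (-π))‖ ≤ B₁ * (2 * π) + 2 * B₀ :=
    (norm_sub_le _ _).trans (add_le_add hJ1 hb)
  calc h / (2 * lam) * ‖J1 - (G π * u π - G (-π) * u (-π))‖ + 1 / lam * ‖J2‖
      ≤ h / (2 * lam) * (B₁ * (2 * π) + 2 * B₀) + 1 / lam * (e * B₀ * (2 * π)) := by gcongr
    _ = _ := by field_simp; ring

/-- Bounded functions are `L¹`-limits of uniformly bounded polynomials. -/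
theorem exists_polynomial_integral_sub_le {g : ℝ → ℝ} (hg : IntervalIntegrable g volume (-π) π)
    {B : ℝ} (hB : ∀ x, |g x| ≤ B) {δ : ℝ} (hδ : 0 < δ) :
    ∃ p : Polynomial ℝ, (∀ x ∈ Set.Icc (-π) π, |p.eval x| ≤ B + 1) ∧
      ∫ x in (-π)..π, |g x - p.eval x| ≤ δ := by
  have hpi : (-π) ≤ π := by linarith [pi_pos]
  have hB0 : 0 ≤ B := (abs_nonneg _).trans (hB 0)
  obtain ⟨φ, -, hφ, hφc, hφi⟩ := (((intervalIntegrable_iff_integrableOn_Ioc_of_le hpi).1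
    hg).integrable_indicator measurableSet_Ioc).exists_hasCompactSupport_integral_sub_le
    (half_pos hδ)
  set ψ : ℝ → ℝ := fun x => max (-B) (min B (φ x)) with hψ
  have hψc : Continuous ψ := by fun_prop
  -- The tolerance 1 keeps the polynomial below `B + 1`, and `δ / (4π)` contributes `δ / 2` to the
  -- integral.
  obtain ⟨p, hp⟩ := exists_polynomial_near_of_continuousOn (-π) π ψ hψc.continuousOn
    (min 1 (δ / (4 * π))) (by positivity)
  have hψB : ∀ x, |ψ x| ≤ B := fun x => abs_le.2
    ⟨le_max_left _ _, max_le (by linarith) (min_le_left _ _)⟩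
  refine ⟨p, fun x hx => ?_, ?_⟩
  · have h1 := (hp x hx).le.trans (min_le_left _ _)
    have h2 := abs_add_le (p.eval x - ψ x) (ψ x)
    rw [sub_add_cancel] at h2
    linarith [hψB x]
  · have hpc : Continuous fun x => p.eval x := p.continuous
    have hI1 : IntervalIntegrable (fun x => |g x - φ x|) volume (-π) π :=
      (hg.sub (hφc.intervalIntegrable _ _)).abs
    have hI : IntervalIntegrable (fun x => |g x - φ x| + δ / (4 * π)) volume (-π) π :=
      hI1.add (continuous_const.intervalIntegrable _ _)
    calc ∫ x in (-π)..π, |g x - p.eval x| ≤ ∫ x in (-π)..π, (|g x - φ x| + δ / (4 * π)) := by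
          refine intervalIntegral.integral_mono_on hpi
            (hg.sub (hpc.intervalIntegrable _ _)).abs hI fun x hx => ?_
          -- Truncating to `[-B, B]` does not increase the distance to `g`, whose values lie there.
          have h1 : |g x - ψ x| ≤ |g x - φ x| := by
            have hgx := abs_le.1 (hB x)
            simp only [hψ]
            rcases le_total (φ x) B with h2 | h2
            · rw [min_eq_right h2]
              rcases le_total (-B) (φ x) with h3 | h3
              · rw [max_eq_right h3]
              · rw [max_eq_left h3, abs_of_nonneg (by linarith [hgx.1]),
                  abs_of_nonneg (by linarith [hgx.1])]
                linarith
            · rw [min_eq_left h2, max_eq_right (by linarith), abs_of_nonpos (by linarith [hgx.2]),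
                abs_of_nonpos (by linarith [hgx.2])]
              linarith
          have h2 := (hp x hx).le.trans (min_le_right _ _)
          have h3 := abs_sub (g x - ψ x) (p.eval x - ψ x)
          rw [sub_sub_sub_cancel_right] at h3
          linarith
      _ = (∫ x in (-π)..π, |g x - φ x|) + δ / 2 := by
          rw [intervalIntegral.integral_add hI1 (continuous_const.intervalIntegrable _ _),
            intervalIntegral.integral_const]
          congr 1
          rw [smul_eq_mul]
          have := pi_pos
          field_simp
          ring
      _ ≤ δ / 2 + δ / 2 := by
          gcongr
          refine le_trans ?_ hφ
          rw [intervalIntegral.integral_of_le hpi]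
          calc ∫ x in Set.Ioc (-π) π, |g x - φ x|
              = ∫ x in Set.Ioc (-π) π, ‖(Set.Ioc (-π) π).indicator g x - φ x‖ := by
                refine setIntegral_congr_fun measurableSet_Ioc fun x hx => ?_
                simp only [Set.indicator_of_mem hx, Real.norm_eq_abs]
            _ ≤ _ := by
                refine setIntegral_le_integral ?_ (Eventually.of_forall fun x => norm_nonneg _)
                refine Integrable.norm (Integrable.sub ?_ hφi)
                exact ((intervalIntegrable_iff_integrableOn_Ioc_of_le hpi).1
                  hg).integrable_indicator measurableSet_Ioc
      _ = δ := by ring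

/-- A uniform Riemann–Lebesgue lemma. -/
theorem exists_riemann_lebesgue {g : ℝ → ℝ} (hg : IntervalIntegrable g volume (-π) π)
    {B : ℝ} (hB : ∀ x, |g x| ≤ B) :
    ∃ ε : ℕ → ℝ, Tendsto ε atTop (𝓝 0) ∧ (∀ N, 0 ≤ ε N) ∧ ∀ (N : ℕ) (h lam e : ℝ) (u : ℝ → ℂ),
      0 < h → 0 < lam → h / lam ≤ 2 / N → IsPhaseFactor h lam e u →
      ‖∫ x in (-π)..π, (g x : ℂ) * u x‖ ≤ ε N + 2 * π * (B + 1) * (e / lam) := by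
  have hpi : (-π) ≤ π := by linarith [pi_pos]
  have hB0 : 0 ≤ B := (abs_nonneg _).trans (hB 0)
  choose p hp1 hp2 using fun k : ℕ =>
    exists_polynomial_integral_sub_le hg hB (δ := 1 / ((k : ℝ) + 1)) (by positivity)
  choose D hD using fun k : ℕ => (isCompact_Icc (a := -π) (b := π)).exists_bound_of_continuousOn
    ((p k).derivative.continuous.continuousOn)
  have hD0 : ∀ k, 0 ≤ D k := fun k => (norm_nonneg _).trans (hD k π ⟨hpi, le_rfl⟩)
  have hc0 : ∀ k, 0 ≤ 2 * (B + 1 + π * D k) := fun k => by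
    have := hD0 k
    positivity
  have hbdd : ∀ N : ℕ, BddBelow (Set.range fun k : ℕ => 1 / ((k : ℝ) + 1) +
      2 * (B + 1 + π * D k) / N) := fun N => ⟨0, by
    rintro _ ⟨k, rfl⟩
    have := hc0 k
    positivity⟩
  -- The infimum optimises between the `L¹` error of the polynomial `p k` and the size `D k` of its
  -- derivative. It depends on `N` alone, not on `h`, `lam` or `u`; this is the uniformity.
  refine ⟨fun N => ⨅ k : ℕ, (1 / ((k : ℝ) + 1) + 2 * (B + 1 + π * D k) / N), ?_, ?_, ?_⟩
  · refine Metric.tendsto_atTop.2 fun δ hδ => ?_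
    obtain ⟨k, hk⟩ := exists_nat_one_div_lt (half_pos hδ)
    have hlim : Tendsto (fun N : ℕ => 2 * (B + 1 + π * D k) / (N : ℝ)) atTop (𝓝 0) :=
      tendsto_const_div_atTop_nhds_zero_nat _
    obtain ⟨N₀, hN₀⟩ := eventually_atTop.1 (hlim.eventually_lt_const (half_pos hδ))
    refine ⟨N₀, fun N hN => ?_⟩
    rw [Real.dist_eq, sub_zero, abs_of_nonneg]
    · refine (ciInf_le (hbdd N) k).trans_lt ?_
      linarith [hN₀ N hN]
    · refine le_ciInf fun k => ?_
      have := hc0 k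
      positivity
  · intro N
    refine le_ciInf fun k => ?_
    have := hc0 k
    positivity
  · intro N h lam e u hh hlam hhl hu
    rw [← sub_le_iff_le_add]
    refine le_ciInf fun k => ?_
    rw [sub_le_iff_le_add]
    have hpc : Continuous fun x => (((p k).eval x : ℝ) : ℂ) :=
      Complex.continuous_ofReal.comp (p k).continuous
    have hpc' : Continuous fun x => (((p k).derivative.eval x : ℝ) : ℂ) :=
      Complex.continuous_ofReal.comp (p k).derivative.continuous
    have h1 := hu.norm_integral_le hh hlam (G := fun x => (((p k).eval x : ℝ) : ℂ))
      (G' := fun x => (((p k).derivative.eval x : ℝ) : ℂ)) (B₀ := B + 1) (B₁ := D k)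
      hpc (hpc'.intervalIntegrable _ _) Set.countable_empty
      (fun x _ => ((p k).hasDerivAt x).ofReal_comp)
      (fun x hx => by rw [Complex.norm_real]; exact hp1 k x hx)
      (fun x hx => by rw [Complex.norm_real]; exact hD k x hx)
    have hgc : IntervalIntegrable (fun x => (g x : ℂ)) volume (-π) π := by
      rw [intervalIntegrable_iff] at hg ⊢
      exact hg.ofReal
    have hi1 : IntervalIntegrable (fun x => ((g x : ℂ) - ((p k).eval x : ℝ)) * u x) volume (-π) π :=
      (hgc.sub (hpc.intervalIntegrable _ _)).mul_continuousOn hu.continuous.continuousOn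
    have h2 : ‖∫ x in (-π)..π, ((g x : ℂ) - ((p k).eval x : ℝ)) * u x‖ ≤ 1 / ((k : ℝ) + 1) := by
      refine (intervalIntegral.norm_integral_le_integral_norm hpi).trans ?_
      refine le_trans (le_of_eq ?_) (hp2 k)
      refine intervalIntegral.integral_congr fun x _ => ?_
      simp only [norm_mul, hu.norm_eq, mul_one]
      rw [← Complex.ofReal_sub, Complex.norm_real, Real.norm_eq_abs]
    have h3 : ∫ x in (-π)..π, (g x : ℂ) * u x =
        (∫ x in (-π)..π, ((g x : ℂ) - ((p k).eval x : ℝ)) * u x) +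
          ∫ x in (-π)..π, (((p k).eval x : ℝ) : ℂ) * u x := by
      have hi2 : IntervalIntegrable (fun x => (((p k).eval x : ℝ) : ℂ) * u x) volume (-π) π :=
        (hpc.mul hu.continuous).intervalIntegrable _ _
      rw [← intervalIntegral.integral_add hi1 hi2]
      refine intervalIntegral.integral_congr fun x _ => ?_
      ring
    rw [h3]
    refine (norm_add_le _ _).trans ((add_le_add h2 h1).trans ?_)
    have h4 : h / lam * (B + 1 + π * D k) ≤ 2 / N * (B + 1 + π * D k) := by
      have := hD0 k
      gcongr
    have h5 : 2 / (N : ℝ) * (B + 1 + π * D k) = 2 * (B + 1 + π * D k) / N := by ring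
    linarith

end

/-! ### The formal WKB series -/

section
open MvPolynomial

/-- Differential polynomials in the variables `g` (`none`) and `v, v', v'', …` (`some i`). -/
abbrev DiffPoly := MvPolynomial (Option ℕ) ℝ

/-- The formal derivative with `g' = 0`. -/
noncomputable def formalDeriv : Derivation ℝ DiffPoly DiffPoly :=
  mkDerivation ℝ fun o => o.elim 0 fun i => X (some (i + 1))

@[simp] theorem formalDeriv_X_none : formalDeriv (X none) = 0 := by
  simp [formalDeriv, mkDerivation_X]

@[simp] theorem formalDeriv_X_some (i : ℕ) : formalDeriv (X (some i)) = X (some (i + 1)) := by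
  simp [formalDeriv, mkDerivation_X]

/-- The coefficients `s_k` of the formal solution `lam + ∑ s_k lam⁻ᵏ` of the Riccati equation
`g S' - S² + lam² - v = 0`. -/
noncomputable def wkb : ℕ → DiffPoly
  | 0 => 0
  | 1 => C (-1 / 2) * X (some 0)
  | (k + 2) => C (1 / 2) * (X none * formalDeriv (wkb (k + 1)) -
      ∑ i : Fin (k + 2), wkb i * wkb (k + 1 - i))
termination_by k => k
decreasing_by all_goals omega

theorem wkb_zero : wkb 0 = 0 := by rw [wkb]

theorem wkb_one : wkb 1 = C (-1 / 2) * X (some 0) := by rw [wkb]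

theorem wkb_add_two (k : ℕ) : wkb (k + 2) = C (1 / 2) * (X none * formalDeriv (wkb (k + 1)) -
    ∑ p ∈ Finset.HasAntidiagonal.antidiagonal (k + 1), wkb p.1 * wkb p.2) := by
  rw [wkb, Finset.Nat.sum_antidiagonal_eq_sum_range_succ (fun i j => wkb i * wkb j),
    Finset.sum_range]

/-- The differential polynomials in `g` and `v, …, v^(k-1)`. -/
noncomputable def lowOrder (k : ℕ) : Subalgebra ℝ DiffPoly := supported ℝ {o | ∀ i ∈ o, i < k}

theorem X_none_mem_lowOrder (k : ℕ) : (X none : DiffPoly) ∈ lowOrder k :=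
  Algebra.subset_adjoin ⟨none, by simp, rfl⟩

theorem X_some_mem_lowOrder {i k : ℕ} (h : i < k) : (X (some i) : DiffPoly) ∈ lowOrder k :=
  Algebra.subset_adjoin ⟨some i, by simpa using h, rfl⟩

theorem C_mem_lowOrder (k : ℕ) (c : ℝ) : (C c : DiffPoly) ∈ lowOrder k :=
  (lowOrder k).algebraMap_mem c

theorem lowOrder_mono {j k : ℕ} (h : j ≤ k) : lowOrder j ≤ lowOrder k :=
  supported_mono fun _ ho i hi => (ho i hi).trans_le h

theorem lowOrder_induction {k : ℕ} {P : DiffPoly → Prop} (hC : ∀ c, P (C c)) (hg : P (X none))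
    (hv : ∀ i < k, P (X (some i))) (hadd : ∀ p q, P p → P q → P (p + q))
    (hmul : ∀ p q, P p → P q → P (p * q)) {p : DiffPoly} (hp : p ∈ lowOrder k) : P p := by
  refine Algebra.adjoin_induction (p := fun p _ => P p) ?_ hC (fun p q _ _ => hadd p q)
    (fun p q _ _ => hmul p q) hp
  rintro _ ⟨o, ho, rfl⟩
  rcases o with _ | i
  · exact hg
  · exact hv i (ho i rfl)

theorem formalDeriv_mem_lowOrder {k : ℕ} {p : DiffPoly} (hp : p ∈ lowOrder k) :
    formalDeriv p ∈ lowOrder (k + 1) := by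
  suffices h : p ∈ lowOrder (k + 1) ∧ formalDeriv p ∈ lowOrder (k + 1) from h.2
  refine lowOrder_induction (P := fun p => p ∈ lowOrder (k + 1) ∧ formalDeriv p ∈ lowOrder (k + 1))
    ?_ ?_ ?_ ?_ ?_ hp
  · exact fun c => ⟨C_mem_lowOrder _ c, by
      rw [← algebraMap_eq, Derivation.map_algebraMap]; exact zero_mem _⟩
  · exact ⟨X_none_mem_lowOrder _, by rw [formalDeriv_X_none]; exact zero_mem _⟩
  · exact fun i hi => ⟨X_some_mem_lowOrder (by omega), by
      rw [formalDeriv_X_some]; exact X_some_mem_lowOrder (by omega)⟩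
  · exact fun p q h1 h2 => ⟨add_mem h1.1 h2.1, by rw [map_add]; exact add_mem h1.2 h2.2⟩
  · refine fun p q h1 h2 => ⟨mul_mem h1.1 h2.1, ?_⟩
    rw [Derivation.leibniz]
    exact add_mem (mul_mem h1.1 h2.2) (mul_mem h2.1 h1.2)

theorem wkb_mem_lowOrder (k : ℕ) : wkb k ∈ lowOrder k := by
  induction k using Nat.strong_induction_on with
  | _ k ih =>
    rcases k with _ | _ | k
    · rw [wkb_zero]; exact zero_mem _
    · rw [wkb_one]; exact mul_mem (C_mem_lowOrder _ _) (X_some_mem_lowOrder one_pos)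
    · rw [wkb_add_two]
      refine mul_mem (C_mem_lowOrder _ _) (sub_mem (mul_mem (X_none_mem_lowOrder _)
        (formalDeriv_mem_lowOrder (ih (k + 1) (by omega)))) (sum_mem fun p hp => ?_))
      have := Finset.HasAntidiagonal.mem_antidiagonal.1 hp
      exact mul_mem (lowOrder_mono (by omega) (ih p.1 (by omega)))
        (lowOrder_mono (by omega) (ih p.2 (by omega)))

/-- `s_{k+1}` without its term of highest order, which is linear in `v^(k)`. -/
noncomputable def wkbRest (k : ℕ) : DiffPoly :=
  wkb (k + 1) + C ((1 / 2) ^ (k + 1)) * (X none ^ k * X (some k))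

theorem wkbRest_zero : wkbRest 0 = 0 := by
  rw [wkbRest, wkb_one, zero_add, pow_zero, pow_one, one_mul, ← add_mul, ← C_add]
  norm_num

/-- Applying `g / 2` times the formal derivative to the leading term of `s_{k+1}` yields exactly
that of `s_{k+2}`, so the rest satisfies the same recursion. -/
theorem wkbRest_succ (k : ℕ) : wkbRest (k + 1) = C (1 / 2) * (X none * formalDeriv (wkbRest k) -
    ∑ p ∈ Finset.HasAntidiagonal.antidiagonal (k + 1), wkb p.1 * wkb p.2) := by
  have h1 : formalDeriv (C ((1 / 2) ^ (k + 1)) * (X none ^ k * X (some k)) : DiffPoly) =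
      C ((1 / 2) ^ (k + 1)) * (X none ^ k * X (some (k + 1))) := by
    rw [Derivation.leibniz, Derivation.leibniz, Derivation.leibniz_pow, ← algebraMap_eq,
      Derivation.map_algebraMap]
    simp
  rw [wkbRest, wkbRest, wkb_add_two, map_add, h1, pow_succ (1 / 2 : ℝ) (k + 1), C_mul]
  ring

theorem wkbRest_one : wkbRest 1 = 0 := by
  rw [wkbRest_succ, wkbRest_zero, map_zero, mul_zero, zero_add,
    Finset.Nat.sum_antidiagonal_eq_sum_range_succ (fun i j => wkb i * wkb j)]
  simp [Finset.sum_range_succ, wkb_zero]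

theorem wkbRest_two : wkbRest 2 = C (-1 / 8) * X (some 0) ^ 2 := by
  rw [wkbRest_succ, wkbRest_one, map_zero, mul_zero,
    Finset.Nat.sum_antidiagonal_eq_sum_range_succ (fun i j => wkb i * wkb j)]
  have h1 : (C (-1 / 8) : DiffPoly) = -(C (1 / 2) * (C (-1 / 2) * C (-1 / 2))) := by
    rw [← C_mul, ← C_mul, ← C_neg]; norm_num
  have h2 : ∑ k ∈ Finset.range (1 + 1).succ, wkb k * wkb (1 + 1 - k) = wkb 1 * wkb 1 := by
    simp [Finset.sum_range_succ, wkb_zero]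
  rw [h1, h2, wkb_one]
  ring

/-- In the quadratic sum for the step `k + 1`, an index `k + 1` is paired with `s_0 = 0`, so only
products of coefficients of index at most `k` occur. -/
theorem wkbRest_mem_lowOrder (k : ℕ) : wkbRest k ∈ lowOrder k := by
  induction k with
  | zero => rw [wkbRest_zero]; exact zero_mem _
  | succ k ih =>
    rw [wkbRest_succ]
    refine mul_mem (C_mem_lowOrder _ _) (sub_mem (mul_mem (X_none_mem_lowOrder _)
      (formalDeriv_mem_lowOrder ih)) (sum_mem fun p hp => ?_))
    have hp' := Finset.HasAntidiagonal.mem_antidiagonal.1 hp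
    by_cases h1 : p.1 = k + 1
    · rw [show p.2 = 0 by omega, wkb_zero, mul_zero]; exact zero_mem _
    by_cases h2 : p.2 = k + 1
    · rw [show p.1 = 0 by omega, wkb_zero, zero_mul]; exact zero_mem _
    exact mul_mem (lowOrder_mono (by omega) (wkb_mem_lowOrder p.1))
      (lowOrder_mono (by omega) (wkb_mem_lowOrder p.2))

/-! Functionals given by differential polynomials. -/

namespace IsDiffPolyFunctional

variable {r : ℕ} {A B : ℝ → (ℝ → ℝ) → ℝ}

theorem const (r : ℕ) (c : ℝ) : IsDiffPolyFunctional r fun _ _ => c :=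
  ⟨0, Fin.elim0, C c, fun h V => by simp⟩

theorem var (r : ℕ) : IsDiffPolyFunctional r fun h _ => h :=
  ⟨0, Fin.elim0, X none, fun h V => by simp⟩

theorem integral (F : MvPolynomial (Fin r) ℝ) :
    IsDiffPolyFunctional r fun _ V => diffIntegral F V :=
  ⟨1, fun _ => F, X (some 0), fun h V => by simp⟩

/-- With a common list of integrals, sums and products act only on the outer polynomials. -/
theorem exists_common (hA : IsDiffPolyFunctional r A) (hB : IsDiffPolyFunctional r B) :
    ∃ (s : ℕ) (F : Fin s → MvPolynomial (Fin r) ℝ) (Q Q' : MvPolynomial (Option (Fin s)) ℝ),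
      ∀ (h : ℝ) (V : ℝ → ℝ),
        A h V = eval (fun o => o.elim h (fun j => diffIntegral (F j) V)) Q ∧
        B h V = eval (fun o => o.elim h (fun j => diffIntegral (F j) V)) Q' := by
  obtain ⟨s, F, Q, hQ⟩ := hA
  obtain ⟨s', F', Q', hQ'⟩ := hB
  refine ⟨s + s', Fin.append F F', rename (Option.map (Fin.castAdd s')) Q,
    rename (Option.map (Fin.natAdd s)) Q', fun h V => ⟨?_, ?_⟩⟩
  · rw [hQ, eval_rename]
    congr 2
    funext o
    cases o <;> simp
  · rw [hQ', eval_rename]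
    congr 2
    funext o
    cases o <;> simp

theorem add (hA : IsDiffPolyFunctional r A) (hB : IsDiffPolyFunctional r B) :
    IsDiffPolyFunctional r fun h V => A h V + B h V := by
  obtain ⟨s, F, Q, Q', h1⟩ := exists_common hA hB
  exact ⟨s, F, Q + Q', fun h V => by simp only [(h1 h V).1, (h1 h V).2, map_add]⟩

theorem mul (hA : IsDiffPolyFunctional r A) (hB : IsDiffPolyFunctional r B) :
    IsDiffPolyFunctional r fun h V => A h V * B h V := by
  obtain ⟨s, F, Q, Q', h1⟩ := exists_common hA hB
  exact ⟨s, F, Q * Q', fun h V => by simp only [(h1 h V).1, (h1 h V).2, map_mul]⟩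

theorem pow (hA : IsDiffPolyFunctional r A) (n : ℕ) :
    IsDiffPolyFunctional r fun h V => A h V ^ n := by
  obtain ⟨s, F, Q, h1⟩ := hA
  exact ⟨s, F, Q ^ n, fun h V => by simp only [h1 h V, map_pow]⟩

theorem sum {ι : Type*} (s : Finset ι) {A : ι → ℝ → (ℝ → ℝ) → ℝ}
    (hA : ∀ i ∈ s, IsDiffPolyFunctional r (A i)) :
    IsDiffPolyFunctional r fun h V => ∑ i ∈ s, A i h V := by
  classical
  induction s using Finset.induction_on with
  | empty => simpa using const r 0
  | insert a s ha ih =>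
    simp only [Finset.sum_insert ha]
    exact (hA a (by simp)).add (ih fun i hi => hA i (by simp [hi]))

end IsDiffPolyFunctional

/-- The integral over a period of a monomial in `V, V', …`. -/
noncomputable def monomialIntegral (d : Option ℕ →₀ ℕ) (V : ℝ → ℝ) : ℝ :=
  ∫ x in (-π)..π, d.some.prod fun i e => iteratedDeriv i V x ^ e

/-- The real part of the integral over a period of a differential polynomial with `g = i h`,
expressed by integrals of monomials. -/
noncomputable def formalIntegral (p : DiffPoly) (h : ℝ) (V : ℝ → ℝ) : ℝ :=
  ∑ d ∈ p.support, p.coeff d *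
    ((Complex.I ^ d none).re * h ^ d none * monomialIntegral d V)

theorem formalIntegral_monomial (d : Option ℕ →₀ ℕ) (c h : ℝ) (V : ℝ → ℝ) :
    formalIntegral (monomial d c) h V =
      c * ((Complex.I ^ d none).re * h ^ d none * monomialIntegral d V) := by
  classical
  rw [formalIntegral, support_monomial]
  split_ifs with hc
  · simp [hc]
  · rw [Finset.sum_singleton, coeff_monomial, if_pos rfl]

theorem formalIntegral_zero (h : ℝ) (V : ℝ → ℝ) : formalIntegral 0 h V = 0 := by
  simp [formalIntegral]

/-- In `formalIntegral` the sum over monomials stands outside the integral. Hence the representation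
holds for arbitrary functions `V`, even when some monomials are not integrable. -/
theorem isDiffPolyFunctional_formalIntegral {r : ℕ} {p : DiffPoly} (hp : p ∈ lowOrder r) :
    IsDiffPolyFunctional r (formalIntegral p) := by
  have hvars : ∀ d ∈ p.support, ∀ i, d (some i) ≠ 0 → i < r := by
    intro d hd i hi
    have h1 := mem_supported.1 hp
    have h2 : some i ∈ p.vars := (mem_vars_iff_mem_support _).2 ⟨d, hd, Finsupp.mem_support_iff.2 hi⟩
    exact h1 h2 i rfl
  change IsDiffPolyFunctional r fun h V => ∑ d ∈ p.support, p.coeff d *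
    ((Complex.I ^ d none).re * h ^ d none * monomialIntegral d V)
  refine IsDiffPolyFunctional.sum _ fun d hd => (IsDiffPolyFunctional.const r _).mul
    (((IsDiffPolyFunctional.const r _).mul ((IsDiffPolyFunctional.var r).pow _)).mul ?_)
  convert IsDiffPolyFunctional.integral (∏ i : Fin r, X i ^ d (some i)) using 3 with h V
  unfold monomialIntegral diffIntegral
  congr 1
  funext x
  rw [map_prod, Finsupp.prod_of_support_subset (s := Finset.range r), Finset.prod_range]
  · simp
  · intro i hi
    simpa using hvars d hd i (by simpa using hi)
  · simp

theorem formalIntegral_wkb_one (h : ℝ) (V : ℝ → ℝ) :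
    formalIntegral (wkb 1) h V = -1 / 2 * ∫ x in (-π)..π, V x := by
  have h1 : wkb 1 = monomial (Finsupp.single (some 0) 1) (-1 / 2) := by
    rw [wkb_one, X, C_mul_monomial, mul_one]
  have h2 : ((Finsupp.single (some 0) 1 : Option ℕ →₀ ℕ)).some = Finsupp.single 0 1 := by
    ext i; simp [Finsupp.single_apply]
  rw [h1, formalIntegral_monomial, monomialIntegral, h2]
  simp

theorem formalIntegral_wkbRest_two (h : ℝ) (V : ℝ → ℝ) :
    formalIntegral (wkbRest 2) h V = -1 / 8 * ∫ x in (-π)..π, V x ^ 2 := by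
  have h1 : wkbRest 2 = monomial (Finsupp.single (some 0) 2) (-1 / 8) := by
    rw [wkbRest_two, X_pow_eq_monomial, C_mul_monomial, mul_one]
  have h2 : ((Finsupp.single (some 0) 2 : Option ℕ →₀ ℕ)).some = Finsupp.single 0 2 := by
    ext i; simp [Finsupp.single_apply]
  rw [h1, formalIntegral_monomial, monomialIntegral, h2]
  simp

end

/-! ### Potentials with a piecewise continuous derivative -/

theorem IsPiecewiseContinuous.exists_bound {g : ℝ → ℝ} (hg : IsPiecewiseContinuous g)
    (hper : Function.Periodic g (2 * π)) : ∃ B, ∀ x, |g x| ≤ B := by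
  have h1 : ∃ B, ∀ x ∈ Set.Icc (-π) π, |g x| ≤ B := by
    refine (isCompact_Icc (a := -π) (b := π)).induction_on (p := fun s => ∃ B, ∀ x ∈ s, |g x| ≤ B)
      ⟨0, by simp⟩ (fun s t hst ⟨B, hB⟩ => ⟨B, fun x hx => hB x (hst hx)⟩) ?_ ?_
    · rintro s t ⟨B, hB⟩ ⟨B', hB'⟩
      refine ⟨max B B', fun x hx => ?_⟩
      rcases hx with hx | hx
      · exact (hB x hx).trans (le_max_left _ _)
      · exact (hB' x hx).trans (le_max_right _ _)
    · intro x _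
      obtain ⟨⟨l, hl⟩, ⟨l', hl'⟩⟩ := hg.2 x
      have e1 : ∀ᶠ y in 𝓝[<] x, |g y| ≤ |l| + 1 :=
        (hl.abs.eventually_lt_const (lt_add_one |l|)).mono fun _ h => h.le
      have e2 : ∀ᶠ y in 𝓝[>] x, |g y| ≤ |l'| + 1 :=
        (hl'.abs.eventually_lt_const (lt_add_one |l'|)).mono fun _ h => h.le
      -- The one-sided limits bound `g` near `x` except at `x` itself, whose value is included
      -- separately.
      have e3 : ∀ᶠ y in 𝓝[≠] x, |g y| ≤ max (|l| + 1) (|l'| + 1) := by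
        rw [← Set.Iio_union_Ioi, nhdsWithin_union]
        exact eventually_sup.2 ⟨e1.mono fun _ h => h.trans (le_max_left _ _),
          e2.mono fun _ h => h.trans (le_max_right _ _)⟩
      refine ⟨{y | |g y| ≤ max (max (|l| + 1) (|l'| + 1)) |g x|}, ?_, _, fun y hy => hy⟩
      refine mem_nhdsWithin_of_mem_nhds ?_
      rw [eventually_nhdsWithin_iff] at e3
      filter_upwards [e3] with y hy
      by_cases hyx : y = x
      · subst hyx; exact le_max_right _ _
      · exact (hy hyx).trans (le_max_left _ _)
  obtain ⟨B, hB⟩ := h1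
  refine ⟨B, fun x => ?_⟩
  obtain ⟨z, hz, hxz⟩ := hper.exists_mem_Ico (by positivity) x (-π)
  rw [hxz]
  exact hB z ⟨hz.1, by linarith [hz.2]⟩

theorem periodic_iteratedDeriv {V : ℝ → ℝ} {c : ℝ} (hper : Function.Periodic V c) (i : ℕ) :
    Function.Periodic (iteratedDeriv i V) c := by
  induction i with
  | zero => rwa [iteratedDeriv_zero]
  | succ i ih =>
    intro x
    rw [iteratedDeriv_succ, ← deriv_comp_add_const, funext ih]

/-- The points where the `r`-th derivative need not exist. -/
def exceptionalSet (r : ℕ) (V : ℝ → ℝ) : Set ℝ :=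
  {x | ¬ DifferentiableAt ℝ (iteratedDeriv (r - 1) V) x}

namespace HasPiecewiseContinuousDeriv

variable {r : ℕ} {V : ℝ → ℝ}

theorem countable_exceptionalSet (hV : HasPiecewiseContinuousDeriv r V) :
    (exceptionalSet r V).Countable := by
  have h1 : exceptionalSet r V ⊆ ⋃ n : ℕ,
      ({x | ¬ DifferentiableAt ℝ (iteratedDeriv (r - 1) V) x} ∩ Set.Icc (-(n : ℝ)) n) := by
    intro x hx
    obtain ⟨n, hn⟩ := exists_nat_ge |x|
    exact Set.mem_iUnion.2 ⟨n, hx, abs_le.1 hn⟩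
  exact (Set.countable_iUnion fun n => (hV.differentiableAt _ _).countable).mono h1

theorem continuous_iteratedDeriv (hV : HasPiecewiseContinuousDeriv r V) {i : ℕ} (hi : i < r) :
    Continuous (iteratedDeriv i V) :=
  hV.contDiff.continuous_iteratedDeriv i (by exact_mod_cast (by omega : i ≤ r - 1))

theorem continuous (hV : HasPiecewiseContinuousDeriv r V) : Continuous V := hV.contDiff.continuous

theorem hasDerivAt_iteratedDeriv (hV : HasPiecewiseContinuousDeriv r V) {i : ℕ} (hi : i < r)
    {x : ℝ} (hx : x ∉ exceptionalSet r V) :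
    HasDerivAt (iteratedDeriv i V) (iteratedDeriv (i + 1) V x) x := by
  rw [iteratedDeriv_succ]
  refine DifferentiableAt.hasDerivAt ?_
  by_cases h1 : i = r - 1
  · rw [h1]; exact not_not.1 hx
  · exact hV.contDiff.differentiable_iteratedDeriv i
      (by exact_mod_cast (by omega : i < r - 1)) x

theorem measurable_iteratedDeriv (hV : HasPiecewiseContinuousDeriv r V) (hr : 1 ≤ r) {i : ℕ}
    (hi : i ≤ r) : Measurable (iteratedDeriv i V) := by
  rcases hi.lt_or_eq with h | h
  · exact (hV.continuous_iteratedDeriv h).measurable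
  · obtain ⟨k, rfl⟩ : ∃ k, i = k + 1 := ⟨i - 1, by omega⟩
    rw [iteratedDeriv_succ]
    exact measurable_deriv _

theorem exists_bound (hV : HasPiecewiseContinuousDeriv r V)
    (hper : Function.Periodic V (2 * π)) :
    ∃ B, 0 ≤ B ∧ ∀ i ≤ r, ∀ x, |iteratedDeriv i V x| ≤ B := by
  have h1 : ∀ i, ∃ B, i ≤ r → ∀ x, |iteratedDeriv i V x| ≤ B := by
    intro i
    by_cases hi : i ≤ r
    · rcases hi.lt_or_eq with h | h
      · have hc := hV.continuous_iteratedDeriv h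
        have hpc : IsPiecewiseContinuous (iteratedDeriv i V) := by
          refine ⟨fun a b => ?_, fun x => ⟨⟨_, hc.continuousWithinAt⟩, ⟨_, hc.continuousWithinAt⟩⟩⟩
          convert Set.finite_empty
          ext x
          simp [hc.continuousAt]
        obtain ⟨B, hB⟩ := hpc.exists_bound (periodic_iteratedDeriv hper i)
        exact ⟨B, fun _ => hB⟩
      · subst h
        obtain ⟨B, hB⟩ := hV.piecewise.exists_bound (periodic_iteratedDeriv hper i)
        exact ⟨B, fun _ => hB⟩
    · exact ⟨0, fun h => absurd h hi⟩
  choose B hB using h1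
  have hB0 : ∀ i ≤ r, 0 ≤ B i := fun i hi => (abs_nonneg _).trans (hB i hi 0)
  refine ⟨∑ i ∈ Finset.range (r + 1), B i, Finset.sum_nonneg fun i hi =>
    hB0 i (Nat.lt_succ_iff.1 (Finset.mem_range.1 hi)), fun i hi x => (hB i hi x).trans ?_⟩
  exact Finset.single_le_sum (f := B) (fun i hi => hB0 i (Nat.lt_succ_iff.1 (Finset.mem_range.1 hi)))
    (Finset.mem_range.2 (Nat.lt_succ_iff.2 hi))

end HasPiecewiseContinuousDeriv

/-! ### Differential polynomials evaluated along a potential. -/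

section
open MvPolynomial MeasureTheory

/-- The values of the variables `g = i h` and `v, v', …, v^(r)` at the point `x`. -/
noncomputable def jet (r : ℕ) (h : ℝ) (V : ℝ → ℝ) (x : ℝ) (o : Option ℕ) : ℂ :=
  o.elim (Complex.I * h) fun i => if i ≤ r then ((iteratedDeriv i V x : ℝ) : ℂ) else 0

/-- The value of a differential polynomial at the point `x`. -/
noncomputable def jetEval (r : ℕ) (h : ℝ) (V : ℝ → ℝ) (p : DiffPoly) (x : ℝ) : ℂ :=
  aeval (jet r h V x) p

variable {r : ℕ} {V : ℝ → ℝ}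

theorem jetEval_C (r : ℕ) (h : ℝ) (V : ℝ → ℝ) (c : ℝ) : jetEval r h V (C c) = fun _ => (c : ℂ) := by
  funext x; simp [jetEval]

theorem jetEval_X_none (r : ℕ) (h : ℝ) (V : ℝ → ℝ) :
    jetEval r h V (X none) = fun _ => Complex.I * h := by
  funext x; simp [jetEval, jet]

theorem jetEval_X_some {i : ℕ} (hi : i ≤ r) (h : ℝ) (V : ℝ → ℝ) :
    jetEval r h V (X (some i)) = fun x => ((iteratedDeriv i V x : ℝ) : ℂ) := by
  funext x; simp [jetEval, jet, hi]

theorem jetEval_add (r : ℕ) (h : ℝ) (V : ℝ → ℝ) (p q : DiffPoly) :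
    jetEval r h V (p + q) = fun x => jetEval r h V p x + jetEval r h V q x := by
  funext x; simp [jetEval]

theorem jetEval_mul (r : ℕ) (h : ℝ) (V : ℝ → ℝ) (p q : DiffPoly) :
    jetEval r h V (p * q) = fun x => jetEval r h V p x * jetEval r h V q x := by
  funext x; simp [jetEval]

/-- Order below `r` is needed: the formal derivative may then contain `v^(r)`, but not `v^(r+1)`,
which `jet` replaces by zero. -/
theorem hasDerivAt_jetEval (hV : HasPiecewiseContinuousDeriv r V) (h : ℝ) {p : DiffPoly}
    (hp : p ∈ lowOrder r) {x : ℝ} (hx : x ∉ exceptionalSet r V) :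
    HasDerivAt (jetEval r h V p) (jetEval r h V (formalDeriv p) x) x := by
  refine lowOrder_induction
    (P := fun p => HasDerivAt (jetEval r h V p) (jetEval r h V (formalDeriv p) x) x)
    ?_ ?_ ?_ ?_ ?_ hp
  · intro c
    rw [jetEval_C, ← algebraMap_eq, Derivation.map_algebraMap]
    simpa [jetEval] using hasDerivAt_const x (c : ℂ)
  · rw [jetEval_X_none, formalDeriv_X_none]
    simpa [jetEval] using hasDerivAt_const x (Complex.I * (h : ℂ))
  · intro i hi
    rw [formalDeriv_X_some, jetEval_X_some hi.le, jetEval_X_some (Nat.succ_le_of_lt hi)]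
    exact (hV.hasDerivAt_iteratedDeriv hi hx).ofReal_comp
  · intro p q h1 h2
    rw [map_add, jetEval_add, jetEval_add]
    exact h1.fun_add h2
  · intro p q h1 h2
    rw [jetEval_mul]
    refine (h1.fun_mul h2).congr_deriv ?_
    simp only [jetEval, map_mul, Derivation.leibniz, map_add, smul_eq_mul]
    ring

theorem continuous_jetEval (hV : HasPiecewiseContinuousDeriv r V) (h : ℝ) {p : DiffPoly}
    (hp : p ∈ lowOrder r) : Continuous (jetEval r h V p) := by
  refine lowOrder_induction (P := fun p => Continuous (jetEval r h V p)) ?_ ?_ ?_ ?_ ?_ hp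
  · intro c
    rw [jetEval_C]; exact continuous_const
  · rw [jetEval_X_none]; exact continuous_const
  · intro i hi
    rw [jetEval_X_some hi.le]
    exact Complex.continuous_ofReal.comp (hV.continuous_iteratedDeriv hi)
  · intro p q h1 h2
    rw [jetEval_add]; exact h1.add h2
  · intro p q h1 h2
    rw [jetEval_mul]; exact h1.mul h2

theorem periodic_jetEval (hper : Function.Periodic V (2 * π)) (h : ℝ) (p : DiffPoly) :
    Function.Periodic (jetEval r h V p) (2 * π) := by
  intro x
  unfold jetEval
  congr 2
  funext o
  rcases o with _ | i
  · rfl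
  · simp only [jet, Option.elim, periodic_iteratedDeriv hper i x]

theorem measurable_jetEval (hV : HasPiecewiseContinuousDeriv r V) (hr : 1 ≤ r) (h : ℝ)
    (p : DiffPoly) : Measurable (jetEval r h V p) := by
  induction p using MvPolynomial.induction_on with
  | C c => rw [jetEval_C]; exact measurable_const
  | add p q h1 h2 => rw [jetEval_add]; exact h1.add h2
  | mul_X p o h1 =>
    have h2 : Measurable (jetEval r h V (X o)) := by
      rcases o with _ | i
      · rw [jetEval_X_none]; exact measurable_const
      · by_cases hi : i ≤ r
        · rw [jetEval_X_some hi]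
          exact Complex.measurable_ofReal.comp (hV.measurable_iteratedDeriv hr hi)
        · have : jetEval r h V (X (some i)) = fun _ => 0 := by
            funext x; simp [jetEval, jet, hi]
          rw [this]; exact measurable_const
    rw [jetEval_mul]; exact h1.mul h2

theorem exists_bound_jetEval (hV : HasPiecewiseContinuousDeriv r V)
    (hper : Function.Periodic V (2 * π)) (h₀ : ℝ) (p : DiffPoly) :
    ∃ C, 0 ≤ C ∧ ∀ h, 0 < h → h ≤ h₀ → ∀ x, ‖jetEval r h V p x‖ ≤ C := by
  obtain ⟨B, hB0, hB⟩ := hV.exists_bound hper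
  induction p using MvPolynomial.induction_on with
  | C c => exact ⟨|c|, abs_nonneg c, fun h _ _ x => by simp [jetEval]⟩
  | add p q h1 h2 =>
    obtain ⟨C, hC0, hC⟩ := h1
    obtain ⟨C', hC0', hC'⟩ := h2
    refine ⟨C + C', by positivity, fun h hh hh0 x => ?_⟩
    have := (norm_add_le _ _).trans (add_le_add (hC h hh hh0 x) (hC' h hh hh0 x))
    simpa [jetEval] using this
  | mul_X p o h1 =>
    obtain ⟨C, hC0, hC⟩ := h1
    refine ⟨C * (|h₀| + B), by positivity, fun h hh hh0 x => ?_⟩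
    have h2 : ‖jet r h V x o‖ ≤ |h₀| + B := by
      rcases o with _ | i
      · simp only [jet, Option.elim, norm_mul, Complex.norm_I, one_mul, Complex.norm_real,
          Real.norm_eq_abs, abs_of_pos hh]
        linarith [le_abs_self h₀]
      · by_cases hi : i ≤ r
        · simp only [jet, Option.elim, hi, if_true, Complex.norm_real, Real.norm_eq_abs]
          linarith [hB i hi x, abs_nonneg h₀]
        · simp only [jet, Option.elim, hi, if_false, norm_zero]
          positivity
    have := mul_le_mul (hC h hh hh0 x) h2 (norm_nonneg _) hC0
    simpa [jetEval] using this

theorem intervalIntegrable_jetEval (hV : HasPiecewiseContinuousDeriv r V) (hr : 1 ≤ r)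
    (hper : Function.Periodic V (2 * π)) {h : ℝ} (hh : 0 < h) (p : DiffPoly) (a b : ℝ) :
    IntervalIntegrable (jetEval r h V p) volume a b := by
  obtain ⟨C, -, hC⟩ := exists_bound_jetEval hV hper h p
  rw [intervalIntegrable_iff]
  exact Measure.integrableOn_of_bounded (by simp) (measurable_jetEval hV hr h p).aestronglyMeasurable
    (M := C) (Eventually.of_forall fun x => hC h hh le_rfl x)

/-- For a regular potential the monomials are continuous, so sum and integral commute; the
derivatives being real, the real part affects only the powers of `i`. -/
theorem re_integral_jetEval (hV : HasPiecewiseContinuousDeriv r V) (h : ℝ) {p : DiffPoly}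
    (hp : p ∈ lowOrder r) :
    (∫ x in (-π)..π, jetEval r h V p x).re = formalIntegral p h V := by
  have hvars : ∀ d ∈ p.support, ∀ i ∈ d.some.support, i < r := by
    intro d hd i hi
    have h1 := mem_supported.1 hp
    have h2 : some i ∈ p.vars := (mem_vars_iff_mem_support _).2
      ⟨d, hd, Finsupp.mem_support_iff.2 (by simpa using hi)⟩
    exact h1 h2 i rfl
  have hc : ∀ d ∈ p.support, Continuous fun x => d.some.prod fun i e => iteratedDeriv i V x ^ e := by
    intro d hd
    unfold Finsupp.prod
    refine continuous_finsetProd _ fun i hi => ?_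
    exact (hV.continuous_iteratedDeriv (hvars d hd i hi)).pow _
  have h1 : ∀ x, jetEval r h V p x = ∑ d ∈ p.support,
      (((p.coeff d * h ^ d none * d.some.prod fun i e => iteratedDeriv i V x ^ e : ℝ)) : ℂ) *
        Complex.I ^ d none := by
    intro x
    rw [jetEval, aeval_def, eval₂_eq]
    refine Finset.sum_congr rfl fun d hd => ?_
    have h2 : ∏ o ∈ d.support, jet r h V x o ^ d o = d.prod fun o e => jet r h V x o ^ e := rfl
    have h3 : (d.some.prod fun i e => jet r h V x (some i) ^ e) =
        ((d.some.prod fun i e => iteratedDeriv i V x ^ e : ℝ) : ℂ) := by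
      unfold Finsupp.prod
      rw [Complex.ofReal_prod]
      refine Finset.prod_congr rfl fun i hi => ?_
      have := (hvars d hd i hi).le
      simp [jet, this]
    rw [h2, Finsupp.prod_option_index _ _ (by simp) (by intros; rw [pow_add]), h3]
    simp only [jet, Option.elim, mul_pow, Complex.coe_algebraMap]
    push_cast
    ring
  simp only [h1]
  rw [intervalIntegral.integral_finsetSum, Complex.re_sum, formalIntegral]
  · refine Finset.sum_congr rfl fun d hd => ?_
    rw [intervalIntegral.integral_mul_const, intervalIntegral.integral_ofReal,
      Complex.re_ofReal_mul, intervalIntegral.integral_const_mul]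
    simp only [monomialIntegral]
    ring
  · intro d hd
    have := hc d hd
    exact (by fun_prop : Continuous _).intervalIntegrable _ _

/-- The Riccati residual of a truncated formal series, as an algebraic identity. -/
theorem riccati_truncation {a b : ℕ → ℂ} {g v l : ℂ} (hl : l ≠ 0) (h0 : a 0 = 0)
    (hab : ∀ k, g * b k = 2 * a (k + 1) +
      (∑ p ∈ Finset.HasAntidiagonal.antidiagonal k, a p.1 * a p.2) + if k = 0 then v else 0)
    (r : ℕ) :
    g * (∑ k ∈ Finset.range (r + 1), b k / l ^ k) -
        (l + ∑ k ∈ Finset.range (r + 1), a k / l ^ k) ^ 2 + (l ^ 2 - v) =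
      2 * a (r + 1) / l ^ r -
        ∑ p ∈ (Finset.range (r + 1) ×ˢ Finset.range (r + 1)).filter fun p => r < p.1 + p.2,
          a p.1 / l ^ p.1 * (a p.2 / l ^ p.2) := by
  have h1 : g * (∑ k ∈ Finset.range (r + 1), b k / l ^ k) =
      (∑ k ∈ Finset.range (r + 1), 2 * a (k + 1) / l ^ k) +
      (∑ k ∈ Finset.range (r + 1), ∑ p ∈ Finset.HasAntidiagonal.antidiagonal k,
        a p.1 / l ^ p.1 * (a p.2 / l ^ p.2)) + v := by
    have h2 : ∀ k, g * (b k / l ^ k) = 2 * a (k + 1) / l ^ k +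
        (∑ p ∈ Finset.HasAntidiagonal.antidiagonal k, a p.1 / l ^ p.1 * (a p.2 / l ^ p.2)) +
        if k = 0 then v else 0 := by
      intro k
      have h3 : (∑ p ∈ Finset.HasAntidiagonal.antidiagonal k,
          a p.1 / l ^ p.1 * (a p.2 / l ^ p.2)) =
          (∑ p ∈ Finset.HasAntidiagonal.antidiagonal k, a p.1 * a p.2) / l ^ k := by
        rw [Finset.sum_div]
        refine Finset.sum_congr rfl fun p hp => ?_
        rw [← Finset.HasAntidiagonal.mem_antidiagonal.1 hp, pow_add]
        field_simp
      rw [← mul_div_assoc, hab, h3, add_div, add_div]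
      congr 1
      split_ifs with hk
      · simp [hk]
      · simp
    rw [Finset.mul_sum, Finset.sum_congr rfl fun k _ => h2 k, Finset.sum_add_distrib,
      Finset.sum_add_distrib]
    simp
  -- An index shift, which loses nothing because `a 0 = 0`; the top index leaves the uncancelled
  -- term.
  have h2 : (∑ k ∈ Finset.range (r + 1), 2 * a (k + 1) / l ^ k) =
      2 * l * (∑ k ∈ Finset.range (r + 1), a k / l ^ k) + 2 * a (r + 1) / l ^ r := by
    have h3 := Finset.sum_range_succ (fun k => a k / l ^ k) (r + 1)
    rw [Finset.sum_range_succ'] at h3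
    simp only [h0, zero_div, add_zero] at h3
    have h4 : (∑ k ∈ Finset.range (r + 1), 2 * a (k + 1) / l ^ k) =
        2 * l * ∑ k ∈ Finset.range (r + 1), a (k + 1) / l ^ (k + 1) := by
      rw [Finset.mul_sum]
      refine Finset.sum_congr rfl fun k _ => ?_
      rw [pow_succ]; field_simp
    rw [h4, h3, pow_succ]
    field_simp
  have h5 : (∑ k ∈ Finset.range (r + 1), ∑ p ∈ Finset.HasAntidiagonal.antidiagonal k,
        a p.1 / l ^ p.1 * (a p.2 / l ^ p.2)) =
      ∑ p ∈ (Finset.range (r + 1) ×ˢ Finset.range (r + 1)).filter fun p => ¬ r < p.1 + p.2,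
          a p.1 / l ^ p.1 * (a p.2 / l ^ p.2) := by
    have h7 := Finset.sum_fiberwise_of_maps_to
      (s := (Finset.range (r + 1) ×ˢ Finset.range (r + 1)).filter fun p => ¬ r < p.1 + p.2)
      (t := Finset.range (r + 1)) (g := fun p => p.1 + p.2) (fun p hp => by
        simp only [Finset.mem_filter, Finset.mem_product, Finset.mem_range] at hp ⊢
        omega) fun p => a p.1 / l ^ p.1 * (a p.2 / l ^ p.2)
    rw [← h7]
    · refine Finset.sum_congr rfl fun k hk => Finset.sum_congr ?_ fun _ _ => rfl
      ext p
      have := Finset.mem_range.1 hk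
      simp only [Finset.HasAntidiagonal.mem_antidiagonal, Finset.mem_filter, Finset.mem_product,
        Finset.mem_range]
      omega
  -- Products of total index at most `r` are those in the recursion and cancel; the others remain in
  -- the residual.
  have h6 : (∑ k ∈ Finset.range (r + 1), a k / l ^ k) ^ 2 =
      (∑ p ∈ (Finset.range (r + 1) ×ˢ Finset.range (r + 1)).filter fun p => r < p.1 + p.2,
          a p.1 / l ^ p.1 * (a p.2 / l ^ p.2)) +
      ∑ p ∈ (Finset.range (r + 1) ×ˢ Finset.range (r + 1)).filter fun p => ¬ r < p.1 + p.2,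
          a p.1 / l ^ p.1 * (a p.2 / l ^ p.2) := by
    rw [Finset.sum_filter_add_sum_filter_not, Finset.sum_product, sq, Finset.sum_mul_sum]
  rw [h1, h2, h5]
  linear_combination -h6

/-- The truncated WKB series `lam + ∑_{k ≤ r} s_k lam⁻ᵏ`. -/
noncomputable def wkbSeries (r : ℕ) (h lam : ℝ) (V : ℝ → ℝ) (x : ℝ) : ℂ :=
  lam + ∑ k ∈ Finset.range (r + 1), jetEval r h V (wkb k) x / (lam : ℂ) ^ k

/-- The derivative of `wkbSeries`. -/
noncomputable def wkbSeriesDeriv (r : ℕ) (h lam : ℝ) (V : ℝ → ℝ) (x : ℝ) : ℂ :=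
  ∑ k ∈ Finset.range (r + 1), jetEval r h V (formalDeriv (wkb k)) x / (lam : ℂ) ^ k

/-- What survives is `2 s_{r+1} lam⁻ʳ` and products of order at least `r + 1` in `1 / lam`. -/
theorem residual_wkbSeries (r : ℕ) (h : ℝ) {lam : ℝ} (hlam : lam ≠ 0) (V : ℝ → ℝ) (x : ℝ) :
    residual V h (lam ^ 2) (wkbSeries r h lam V) (wkbSeriesDeriv r h lam V) x =
      2 * jetEval r h V (wkb (r + 1)) x / (lam : ℂ) ^ r -
        ∑ p ∈ (Finset.range (r + 1) ×ˢ Finset.range (r + 1)).filter fun p => r < p.1 + p.2,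
          jetEval r h V (wkb p.1) x / (lam : ℂ) ^ p.1 *
            (jetEval r h V (wkb p.2) x / (lam : ℂ) ^ p.2) := by
  rw [← riccati_truncation (a := fun k => jetEval r h V (wkb k) x)
    (b := fun k => jetEval r h V (formalDeriv (wkb k)) x) (g := Complex.I * h) (v := V x)
    (Complex.ofReal_ne_zero.2 hlam)]
  · simp only [residual, wkbSeries, wkbSeriesDeriv]
    push_cast
    ring
  · simp [jetEval, wkb_zero]
  · intro k
    rcases k with _ | k
    · simp [jetEval, wkb_zero, wkb_one, jet]
      ring
    · simp only [Nat.add_eq_zero_iff, one_ne_zero, and_false, if_false, add_zero]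
      simp only [jetEval]
      rw [wkb_add_two]
      simp only [map_mul, map_sub, aeval_C, aeval_X, map_sum]
      simp [jet]

end

/-! ### The phase expansion -/

section
open MvPolynomial MeasureTheory ComplexConjugate

theorem norm_sum_div_pow_le {r : ℕ} {A lam : ℝ} {s : ℕ → ℂ} (hlam : 1 ≤ lam) (h0 : s 0 = 0)
    (hA : 0 ≤ A) (hs : ∀ k ≤ r, ‖s k‖ ≤ A) :
    ‖∑ k ∈ Finset.range (r + 1), s k / (lam : ℂ) ^ k‖ ≤ (r + 1) * A / lam := by
  have hl : 0 < lam := by linarith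
  have h1 : ∀ k ∈ Finset.range (r + 1), ‖s k / (lam : ℂ) ^ k‖ ≤ A / lam := by
    intro k hk
    rcases k with _ | k
    · rw [h0, zero_div, norm_zero]; positivity
    · rw [norm_div, norm_pow, Complex.norm_real, Real.norm_eq_abs, abs_of_pos hl]
      have h2 : lam ≤ lam ^ (k + 1) := le_self_pow₀ hlam (by omega)
      have h3 := hs (k + 1) (by have := Finset.mem_range.1 hk; omega)
      gcongr
  refine (norm_sum_le_of_le _ h1).trans_eq ?_
  rw [Finset.sum_const, Finset.card_range, nsmul_eq_mul]
  push_cast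
  ring

theorem norm_sum_filter_mul_div_pow_le {r : ℕ} {A lam : ℝ} {s : ℕ → ℂ} (hlam : 1 ≤ lam)
    (hA : 0 ≤ A) (hs : ∀ k ≤ r, ‖s k‖ ≤ A) :
    ‖∑ p ∈ (Finset.range (r + 1) ×ˢ Finset.range (r + 1)).filter fun p => r < p.1 + p.2,
      s p.1 / (lam : ℂ) ^ p.1 * (s p.2 / (lam : ℂ) ^ p.2)‖ ≤
      (r + 1) ^ 2 * A ^ 2 / lam ^ (r + 1) := by
  have hl : 0 < lam := by linarith
  have h1 : ∀ p ∈ (Finset.range (r + 1) ×ˢ Finset.range (r + 1)).filter fun p => r < p.1 + p.2,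
      ‖s p.1 / (lam : ℂ) ^ p.1 * (s p.2 / (lam : ℂ) ^ p.2)‖ ≤ A ^ 2 / lam ^ (r + 1) := by
    intro p hp
    simp only [Finset.mem_filter, Finset.mem_product, Finset.mem_range] at hp
    have h2 : s p.1 / (lam : ℂ) ^ p.1 * (s p.2 / (lam : ℂ) ^ p.2) =
        s p.1 * s p.2 / (lam : ℂ) ^ (p.1 + p.2) := by
      rw [pow_add, div_mul_div_comm]
    rw [h2, norm_div, norm_pow, Complex.norm_real, Real.norm_eq_abs, abs_of_pos hl, norm_mul, sq]
    have h3 : lam ^ (r + 1) ≤ lam ^ (p.1 + p.2) := pow_le_pow_right₀ hlam (by omega)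
    have h4 := hs p.1 (by omega)
    have h5 := hs p.2 (by omega)
    gcongr
  refine (norm_sum_le_of_le _ h1).trans ?_
  rw [Finset.sum_const, nsmul_eq_mul]
  have h6 : (((Finset.range (r + 1) ×ˢ Finset.range (r + 1)).filter fun p => r < p.1 + p.2).card :
      ℝ) ≤ (r + 1) ^ 2 := by
    have := Finset.card_filter_le (Finset.range (r + 1) ×ˢ Finset.range (r + 1))
      fun p => r < p.1 + p.2
    rw [Finset.card_product, Finset.card_range] at this
    calc _ ≤ (((r + 1) * (r + 1) : ℕ) : ℝ) := by exact_mod_cast this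
      _ = _ := by push_cast; ring
  calc _ ≤ ((r : ℝ) + 1) ^ 2 * (A ^ 2 / lam ^ (r + 1)) := by gcongr
    _ = _ := by ring

/-- Replacing the amplitude `S` by `lam` in the velocity of the phase. -/
theorem norm_velocity_sub_le {n : ℕ} {b A q D lam : ℝ} {s Q w : ℂ} (hlam : 1 ≤ lam)
    (hA : 0 ≤ A) (hs : ‖s‖ ≤ A) (hw : ‖w‖ = 1) (hQ : ‖Q‖ ≤ q / lam ^ (n + 1))
    (hD : |D - lam| ≤ b / lam) (hb : 2 * b ≤ lam) :
    ‖((2 * s / (lam : ℂ) ^ n - Q) + conj (2 * s / (lam : ℂ) ^ n - Q) * w) / (2 * D : ℝ) -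
      (s + conj s * w) / (lam : ℂ) ^ (n + 1)‖ ≤ (4 * b * A + 2 * q) / lam ^ (n + 2) := by
  have hl : 0 < lam := by linarith
  have hb0 : 0 ≤ b := by
    have := (abs_nonneg _).trans hD
    by_contra h
    exact absurd this (not_le.2 (div_neg_of_neg_of_pos (not_le.1 h) hl))
  have hD2 : lam / 2 ≤ D := by
    have h1 : b / lam ≤ b := div_le_self hb0 hlam
    have := (abs_le.1 hD).1
    linarith
  have hD0 : 0 < D := by linarith
  have hDc : (D : ℂ) ≠ 0 := Complex.ofReal_ne_zero.2 hD0.ne'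
  have hlc : (lam : ℂ) ≠ 0 := Complex.ofReal_ne_zero.2 hl.ne'
  have h1 : ((2 * s / (lam : ℂ) ^ n - Q) + conj (2 * s / (lam : ℂ) ^ n - Q) * w) / (2 * D : ℝ) -
      (s + conj s * w) / (lam : ℂ) ^ (n + 1) =
      (s + conj s * w) / (lam : ℂ) ^ n * (((lam - D : ℝ) : ℂ) / (D * lam)) -
        (Q + conj Q * w) / (2 * D) := by
    simp only [map_sub, map_div₀, map_mul, map_pow, Complex.conj_ofReal, map_ofNat]
    push_cast
    field_simp
    ring
  have h2 : ∀ z : ℂ, ‖z + conj z * w‖ ≤ 2 * ‖z‖ := by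
    intro z
    refine (norm_add_le _ _).trans_eq ?_
    rw [norm_mul, hw, RCLike.norm_conj]; ring
  rw [h1]
  refine (norm_sub_le _ _).trans ?_
  rw [norm_mul, norm_div, norm_div, norm_div, norm_mul, norm_mul, norm_pow]
  simp only [Complex.norm_real, Real.norm_eq_abs, abs_of_pos hl, abs_of_pos hD0, Complex.norm_ofNat]
  have h3 : ‖s + conj s * w‖ / lam ^ n * (|lam - D| / (D * lam)) ≤ 4 * b * A / lam ^ (n + 2) := by
    have h4 : |lam - D| / (D * lam) ≤ b / (lam / 2 * lam) := by
      rw [abs_sub_comm]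
      have : b / lam ≤ b := div_le_self hb0 hlam
      have := hD.trans this
      gcongr
    calc _ ≤ (2 * A) / lam ^ n * (b / (lam / 2 * lam)) := by
          gcongr
          exact (h2 s).trans (by linarith)
      _ = _ := by rw [pow_add]; field_simp; ring
  have h5 : ‖Q + conj Q * w‖ / (2 * D) ≤ 2 * q / lam ^ (n + 2) := by
    calc _ ≤ (2 * (q / lam ^ (n + 1))) / (2 * (lam / 2)) := by
          have := (norm_nonneg _).trans hQ
          gcongr
          exact (h2 Q).trans (by linarith)
      _ = _ := by rw [pow_succ _ (n + 1)]; field_simp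
  rw [add_div]
  exact add_le_add h3 h5

variable {r : ℕ} {V : ℝ → ℝ}

/-- The approximate velocity of the phase. -/
noncomputable def approxVelocity (r : ℕ) (h lam : ℝ) (V : ℝ → ℝ) (u : ℝ → ℂ) (x : ℝ) : ℂ :=
  wkbSeries r h lam V x + (jetEval r h V (wkb (r + 1)) x +
    conj (jetEval r h V (wkb (r + 1)) x) * u x) / (lam : ℂ) ^ (r + 1)

theorem jetEval_wkb_zero (r : ℕ) (h : ℝ) (V : ℝ → ℝ) (x : ℝ) : jetEval r h V (wkb 0) x = 0 := by
  simp [jetEval, wkb_zero]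

theorem norm_wkbSeries_sub_le {h lam A x : ℝ} (hlam : 1 ≤ lam) (hA : 0 ≤ A)
    (hs : ∀ k ≤ r, ‖jetEval r h V (wkb k) x‖ ≤ A) :
    ‖wkbSeries r h lam V x - lam‖ ≤ (r + 1) * A / lam := by
  rw [wkbSeries, add_sub_cancel_left]
  exact norm_sum_div_pow_le hlam (jetEval_wkb_zero r h V x) hA hs

theorem abs_re_wkbSeries_sub_le {h lam A x : ℝ} (hlam : 1 ≤ lam) (hA : 0 ≤ A)
    (hs : ∀ k ≤ r, ‖jetEval r h V (wkb k) x‖ ≤ A) :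
    |(wkbSeries r h lam V x).re - lam| ≤ (r + 1) * A / lam := by
  refine le_trans ?_ (norm_wkbSeries_sub_le hlam hA hs)
  simpa using Complex.abs_re_le_norm (wkbSeries r h lam V x - lam)

/-- Division by `2 Re S ≈ 2 lam` turns the leading residual into `s_{r+1} / lam^(r+1)`. The series
thus gains its next term, though `s_{r+1}` need not be differentiable; the price is a conjugate term
that oscillates with `u`. -/
theorem abs_phaseVelocity_sub_le {h lam A x : ℝ} {u : ℝ → ℂ} (hlam : 1 ≤ lam) (hA : 0 ≤ A)
    (hs : ∀ k ≤ r + 1, ‖jetEval r h V (wkb k) x‖ ≤ A) (hA' : 2 * ((r + 1) * A) ≤ lam)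
    (hu : ‖u x‖ = 1) :
    |phaseVelocity V h (lam ^ 2) (wkbSeries r h lam V) (wkbSeriesDeriv r h lam V) u x -
      (approxVelocity r h lam V u x).re| ≤
      (4 * ((r + 1) * A) * A + 2 * ((r + 1) ^ 2 * A ^ 2)) / lam ^ (r + 2) := by
  have hs' : ∀ k ≤ r, ‖jetEval r h V (wkb k) x‖ ≤ A := fun k hk => hs k (by omega)
  have h1 := norm_velocity_sub_le (n := r) hlam hA (hs (r + 1) le_rfl) hu
    (norm_sum_filter_mul_div_pow_le hlam hA hs') (abs_re_wkbSeries_sub_le hlam hA hs') hA'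
  refine le_trans ?_ h1
  unfold phaseVelocity approxVelocity
  rw [residual_wkbSeries r h (by linarith), ← Complex.sub_re, add_sub_add_left_eq_sub]
  exact Complex.abs_re_le_norm _

/-- The crude bound that makes `u` a phase factor with velocity error `O(1 / lam)`, as the
oscillatory estimates require. -/
theorem abs_phaseVelocity_sub_self_le {h lam A x : ℝ} {u : ℝ → ℂ} (hlam : 1 ≤ lam) (hA : 0 ≤ A)
    (hs : ∀ k ≤ r + 1, ‖jetEval r h V (wkb k) x‖ ≤ A) (hA' : 2 * ((r + 1) * A) ≤ lam)
    (hu : ‖u x‖ = 1) :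
    |phaseVelocity V h (lam ^ 2) (wkbSeries r h lam V) (wkbSeriesDeriv r h lam V) u x - lam| ≤
      ((r + 3) * A + (4 * ((r + 1) * A) * A + 2 * ((r + 1) ^ 2 * A ^ 2))) / lam := by
  have hl : 0 < lam := by linarith
  set c := 4 * ((r + 1) * A) * A + 2 * ((r + 1) ^ 2 * A ^ 2) with hc
  have hc0 : 0 ≤ c := by positivity
  have h1 := abs_phaseVelocity_sub_le hlam hA hs hA' hu
  rw [← hc] at h1
  have h2 : |(approxVelocity r h lam V u x).re - lam| ≤ (r + 3) * A / lam := by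
    have h3 := norm_wkbSeries_sub_le (x := x) hlam hA fun k hk => hs k (by omega)
    have h4 : ‖(jetEval r h V (wkb (r + 1)) x +
        conj (jetEval r h V (wkb (r + 1)) x) * u x) / (lam : ℂ) ^ (r + 1)‖ ≤ 2 * A / lam := by
      rw [norm_div, norm_pow, Complex.norm_real, Real.norm_eq_abs, abs_of_pos hl]
      have h5 : lam ≤ lam ^ (r + 1) := le_self_pow₀ hlam (by omega)
      have h6 := hs (r + 1) le_rfl
      have : ‖jetEval r h V (wkb (r + 1)) x +
        conj (jetEval r h V (wkb (r + 1)) x) * u x‖ ≤ 2 * A := by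
        refine (norm_add_le _ _).trans ?_
        rw [norm_mul, hu, RCLike.norm_conj]; linarith
      gcongr
    have h7 : |(approxVelocity r h lam V u x - lam).re| ≤ _ :=
      (Complex.abs_re_le_norm _).trans (le_of_eq_of_le (congrArg norm (show
        approxVelocity r h lam V u x - lam = (wkbSeries r h lam V x - lam) + (jetEval r h V (wkb (r + 1)) x +
        conj (jetEval r h V (wkb (r + 1)) x) * u x) / (lam : ℂ) ^ (r + 1) by
          unfold approxVelocity; ring)) ((norm_add_le _ _).trans (add_le_add h3 h4)))
    rw [Complex.sub_re, Complex.ofReal_re] at h7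
    refine h7.trans_eq ?_
    ring
  have h8 : c / lam ^ (r + 2) ≤ c / lam := by
    have : lam ≤ lam ^ (r + 2) := le_self_pow₀ hlam (by omega)
    gcongr
  rw [add_div]
  have := abs_sub_le (phaseVelocity V h (lam ^ 2) (wkbSeries r h lam V) (wkbSeriesDeriv r h lam V) u x)
    (approxVelocity r h lam V u x).re lam
  linarith

end

/-! ### Integration of the phase velocity over a period. -/

section
open MvPolynomial MeasureTheory ComplexConjugate

variable {r : ℕ} {V : ℝ → ℝ}

theorem integral_eq_zero_of_hasDerivAt {f f' : ℝ → ℂ} (hf : Continuous f)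
    (hper : Function.Periodic f (2 * π)) {E : Set ℝ} (hE : E.Countable)
    (hd : ∀ x ∉ E, HasDerivAt f (f' x) x) (hi : IntervalIntegrable f' volume (-π) π) :
    ∫ x in (-π)..π, f' x = 0 := by
  rw [integral_eq_of_hasDerivAt_off_countable f f' hE hf.continuousOn (fun x hx => hd x hx.2) hi,
    sub_eq_zero, ← hper (-π)]
  congr 1; ring

/-- The differential polynomials that yield the coefficients of the phase expansion. -/
noncomputable def phasePoly (k : ℕ) : DiffPoly := if k = 1 then wkb 1 else wkbRest (k - 1)

/-- For `k ≥ 2` the leading term of `s_k` is a multiple of `v^(k-1)`, which integrates to zero over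
a period, so `wkbRest (k - 1)` can replace `s_k`. This keeps `V^(r)` out of the coefficient of order
`r + 1`. For `k = 1` the leading term is a multiple of `V` and has to stay. -/
theorem phasePoly_mem_lowOrder (hr : 1 ≤ r) {k : ℕ} (hk : k ≤ r + 1) : phasePoly k ∈ lowOrder r := by
  unfold phasePoly
  split_ifs with h
  · exact lowOrder_mono hr (wkb_mem_lowOrder 1)
  · exact lowOrder_mono (by omega) (wkbRest_mem_lowOrder (k - 1))

/-- The coefficients of the phase expansion. -/
noncomputable def phaseCoeff (k : ℕ) (h : ℝ) (V : ℝ → ℝ) : ℝ :=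
  formalIntegral (phasePoly k) h V / (2 * π)

theorem jetEval_wkb_succ {j : ℕ} (hj : j ≤ r) (h : ℝ) (V : ℝ → ℝ) :
    jetEval r h V (wkb (j + 1)) = fun x => jetEval r h V (wkbRest j) x -
      (1 / 2) ^ (j + 1) * (Complex.I * h) ^ j * (iteratedDeriv j V x : ℝ) := by
  have h1 : wkb (j + 1) = wkbRest j - C ((1 / 2) ^ (j + 1)) * (X none ^ j * X (some j)) := by
    rw [wkbRest]; ring
  funext x
  rw [h1]
  simp [jetEval, jet, hj]
  ring

theorem re_integral_jetEval_wkb (hV : HasPiecewiseContinuousDeriv r V) (hr : 1 ≤ r)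
    (hper : Function.Periodic V (2 * π)) {h : ℝ} (hh : 0 < h) {k : ℕ} (hk1 : 1 ≤ k)
    (hk : k ≤ r + 1) :
    (∫ x in (-π)..π, jetEval r h V (wkb k) x).re = 2 * π * phaseCoeff k h V := by
  have hpi := two_pi_pos
  rw [phaseCoeff, mul_div_cancel₀ _ hpi.ne', ← re_integral_jetEval hV h (phasePoly_mem_lowOrder hr hk)]
  congr 1
  unfold phasePoly
  split_ifs with h1
  · rw [h1]
  · obtain ⟨j, rfl⟩ : ∃ j, k = j + 1 := ⟨k - 1, by omega⟩
    have hj1 : 1 ≤ j := by omega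
    have hj : j ≤ r := by omega
    obtain ⟨i, rfl⟩ : ∃ i, j = i + 1 := ⟨j - 1, by omega⟩
    have h2 : IntervalIntegrable (jetEval r h V (X (some (i + 1)))) volume (-π) π :=
      intervalIntegrable_jetEval hV hr hper hh _ _ _
    -- `V^(i+1)` is, off a countable set, the derivative of the continuous periodic function
    -- `V^(i)`; this includes `i + 1 = r`.
    have h3 : ∫ x in (-π)..π, jetEval r h V (X (some (i + 1))) x = 0 := by
      have hi : X (some i) ∈ lowOrder r := X_some_mem_lowOrder (by omega)
      refine integral_eq_zero_of_hasDerivAt (continuous_jetEval hV h hi)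
        (periodic_jetEval hper h _) hV.countable_exceptionalSet (fun x hx => ?_) h2
      have := hasDerivAt_jetEval hV h hi hx
      rwa [formalDeriv_X_some] at this
    rw [jetEval_X_some hj] at h2 h3
    rw [jetEval_wkb_succ hj, intervalIntegral.integral_sub
      (intervalIntegrable_jetEval hV hr hper hh _ _ _) (h2.const_mul _),
      intervalIntegral.integral_const_mul, h3, mul_zero, sub_zero, Nat.add_sub_cancel]

theorem re_integral_approxVelocity (hV : HasPiecewiseContinuousDeriv r V) (hr : 1 ≤ r)
    (hper : Function.Periodic V (2 * π)) {h : ℝ} (hh : 0 < h) (lam : ℝ) {u : ℝ → ℂ}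
    (hu : IntervalIntegrable (fun x => conj (jetEval r h V (wkb (r + 1)) x) * u x) volume (-π) π) :
    IntervalIntegrable (approxVelocity r h lam V u) volume (-π) π ∧
    (∫ x in (-π)..π, approxVelocity r h lam V u x).re =
      2 * π * (lam + ∑ k ∈ Finset.Icc 1 (r + 1), phaseCoeff k h V / lam ^ k) +
        (∫ x in (-π)..π, conj (jetEval r h V (wkb (r + 1)) x) * u x).re / lam ^ (r + 1) := by
  have hi : ∀ k, IntervalIntegrable (jetEval r h V (wkb k)) volume (-π) π := fun k =>
    intervalIntegrable_jetEval hV hr hper hh _ _ _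
  have h1 : approxVelocity r h lam V u = fun x => ((lam : ℂ) +
      ∑ k ∈ Finset.Icc 1 (r + 1), jetEval r h V (wkb k) x / (lam : ℂ) ^ k) +
        conj (jetEval r h V (wkb (r + 1)) x) * u x / (lam : ℂ) ^ (r + 1) := by
    funext x
    have h2 : ∑ k ∈ Finset.range (r + 2), jetEval r h V (wkb k) x / (lam : ℂ) ^ k =
        ∑ k ∈ Finset.Icc 1 (r + 1), jetEval r h V (wkb k) x / (lam : ℂ) ^ k := by
      rw [Finset.range_eq_Ico, Finset.sum_eq_sum_Ico_succ_bot (by omega), jetEval_wkb_zero, zero_div,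
        zero_add, zero_add]
      rfl
    rw [← h2, Finset.sum_range_succ, approxVelocity, wkbSeries, add_div]
    ring
  have hs : IntervalIntegrable (fun x => ∑ k ∈ Finset.Icc 1 (r + 1),
      jetEval r h V (wkb k) x / (lam : ℂ) ^ k) volume (-π) π := by
    have := IntervalIntegrable.sum (μ := volume) (a := -π) (b := π) (Finset.Icc 1 (r + 1))
      (f := fun k x => jetEval r h V (wkb k) x / (lam : ℂ) ^ k) fun k _ => (hi k).div_const _
    refine this.congr_ae ?_
    filter_upwards with x
    simp
  have hc : IntervalIntegrable (fun _ : ℝ => (lam : ℂ)) volume (-π) π :=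
    continuous_const.intervalIntegrable _ _
  have hre : ∀ (z : ℂ) (k : ℕ), (z / (lam : ℂ) ^ k).re = z.re / lam ^ k := by
    intro z k
    rw [← Complex.ofReal_pow, Complex.div_ofReal_re]
  rw [h1]
  refine ⟨(hc.add hs).add (hu.div_const _), ?_⟩
  rw [intervalIntegral.integral_add (hc.add hs) (hu.div_const _),
    intervalIntegral.integral_add hc hs, intervalIntegral.integral_const,
    intervalIntegral.integral_finsetSum (fun k _ => (hi k).div_const _)]
  simp only [intervalIntegral.integral_div, Complex.add_re, Complex.re_sum, hre]
  rw [Finset.sum_congr rfl fun k hk => by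
    rw [re_integral_jetEval_wkb hV hr hper hh (Finset.mem_Icc.1 hk).1 (Finset.mem_Icc.1 hk).2]]
  simp only [mul_div_assoc]
  rw [← Finset.mul_sum]
  simp
  ring

/-- The oscillatory integral in the last term of the phase expansion. -/
theorem exists_oscillation_bound (hV : HasPiecewiseContinuousDeriv r V) (hr : 1 ≤ r)
    (hper : Function.Periodic V (2 * π)) (h₀ c : ℝ) :
    ∃ (C : ℝ) (ε : ℕ → ℝ), 0 ≤ C ∧ Tendsto ε atTop (𝓝 0) ∧ (∀ N, 0 ≤ ε N) ∧
      ∀ (h lam : ℝ) (N : ℕ) (u : ℝ → ℂ), 0 < h → h ≤ h₀ → 1 ≤ lam → h / lam ≤ 2 / N →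
        IsPhaseFactor h lam (c / lam) u →
        IntervalIntegrable (fun x => conj (jetEval r h V (wkb (r + 1)) x) * u x) volume (-π) π ∧
        ‖∫ x in (-π)..π, conj (jetEval r h V (wkb (r + 1)) x) * u x‖ ≤ C / lam + h ^ r * ε N := by
  obtain ⟨B₀, hB₀, hb₀⟩ := exists_bound_jetEval hV hper h₀ (wkbRest r)
  obtain ⟨B₁, hB₁, hb₁⟩ := exists_bound_jetEval hV hper h₀ (formalDeriv (wkbRest r))
  obtain ⟨B, hB, hb⟩ := hV.exists_bound hper
  have hVi : IntervalIntegrable (iteratedDeriv r V) volume (-π) π := by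
    rw [intervalIntegrable_iff]
    exact Measure.integrableOn_of_bounded (by simp)
      (hV.measurable_iteratedDeriv hr le_rfl).aestronglyMeasurable
      (M := B) (Eventually.of_forall fun x => hb r le_rfl x)
  obtain ⟨ε, hε, hε0, hrl⟩ := exists_riemann_lebesgue hVi (hb r le_rfl)
  -- The first two terms come from integrating the lower-order part by parts, the third from the
  -- velocity error in the Riemann–Lebesgue bound for `V^(r)`.
  refine ⟨|h₀| * (B₀ + π * B₁) + 2 * π * B₀ * |c| + |h₀| ^ r * (2 * π * (B + 1) * |c|), ε,
    by positivity, hε, hε0, fun h lam N u hh hh₀ hlam hN hu => ?_⟩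
  have hl : 0 < lam := by linarith
  have huc := hu.continuous
  have hh₀' : h ≤ |h₀| := hh₀.trans (le_abs_self _)
  have hG : Continuous fun x => conj (jetEval r h V (wkbRest r) x) :=
    Complex.continuous_conj.comp (continuous_jetEval hV h (wkbRest_mem_lowOrder r))
  have hG' : IntervalIntegrable (fun x => conj (jetEval r h V (formalDeriv (wkbRest r)) x))
      volume (-π) π := by
    have h2 := intervalIntegrable_jetEval hV hr hper hh (formalDeriv (wkbRest r)) (-π) π
    rw [intervalIntegrable_iff] at h2 ⊢
    exact (Complex.conjCLE : ℂ →L[ℝ] ℂ).integrable_comp h2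
  set w : ℂ := (1 / 2) ^ (r + 1) * conj (Complex.I * h) ^ r with hw
  have h1 : (fun x => conj (jetEval r h V (wkb (r + 1)) x) * u x) = fun x =>
      conj (jetEval r h V (wkbRest r) x) * u x - w * (((iteratedDeriv r V x : ℝ) : ℂ) * u x) := by
    funext x
    rw [jetEval_wkb_succ le_rfl, hw]
    simp only [map_sub, map_mul, map_pow, Complex.conj_ofReal, map_div₀, map_one, map_ofNat]
    ring
  have hi1 : IntervalIntegrable (fun x => conj (jetEval r h V (wkbRest r) x) * u x) volume (-π) π :=
    (hG.mul huc).intervalIntegrable _ _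
  have hVc : IntervalIntegrable (fun x => ((iteratedDeriv r V x : ℝ) : ℂ)) volume (-π) π := by
    rw [intervalIntegrable_iff] at hVi ⊢
    exact hVi.ofReal
  have hi2 : IntervalIntegrable (fun x => w * (((iteratedDeriv r V x : ℝ) : ℂ) * u x))
      volume (-π) π := (hVc.mul_continuousOn huc.continuousOn).const_mul _
  have hw1 : ‖w‖ ≤ h ^ r := by
    rw [hw, norm_mul, norm_pow, norm_pow, RCLike.norm_conj, norm_mul, Complex.norm_I, one_mul,
      Complex.norm_real, Real.norm_eq_abs, abs_of_pos hh]
    have : ‖(1 / 2 : ℂ)‖ ^ (r + 1) ≤ 1 := pow_le_one₀ (norm_nonneg _) (by norm_num)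
    exact mul_le_of_le_one_left (by positivity) this
  rw [h1]
  refine ⟨hi1.sub hi2, ?_⟩
  rw [intervalIntegral.integral_sub hi1 hi2, intervalIntegral.integral_const_mul]
  have h2 := hu.norm_integral_le hh hl hG hG' hV.countable_exceptionalSet
    (fun x hx => (hasDerivAt_jetEval hV h (wkbRest_mem_lowOrder r) hx).star)
    (B₀ := B₀) (B₁ := B₁)
    (fun x _ => by rw [RCLike.norm_conj]; exact hb₀ h hh hh₀ x)
    (fun x _ => by rw [RCLike.norm_conj]; exact hb₁ h hh hh₀ x)
  have h3 := hrl N h lam _ u hh hl hN hu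
  have hc : c / lam / lam ≤ |c| / lam := by
    rw [div_div]
    calc c / (lam * lam) ≤ |c| / (lam * lam) := by gcongr; exact le_abs_self c
      _ ≤ |c| / lam := by
        gcongr
        exact le_mul_of_one_le_left hl.le hlam
  have h4 : ‖∫ x in (-π)..π, conj (jetEval r h V (wkbRest r) x) * u x‖ ≤
      |h₀| / lam * (B₀ + π * B₁) + 2 * π * B₀ * (|c| / lam) := by
    refine h2.trans ?_
    gcongr
  have h5 : ‖w * ∫ x in (-π)..π, ((iteratedDeriv r V x : ℝ) : ℂ) * u x‖ ≤
      h ^ r * ε N + |h₀| ^ r * (2 * π * (B + 1) * (|c| / lam)) := by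
    rw [norm_mul]
    calc _ ≤ h ^ r * (ε N + 2 * π * (B + 1) * (c / lam / lam)) := by gcongr
      _ ≤ h ^ r * (ε N + 2 * π * (B + 1) * (|c| / lam)) := by gcongr
      _ = h ^ r * ε N + h ^ r * (2 * π * (B + 1) * (|c| / lam)) := by ring
      _ ≤ _ := by gcongr
  refine (norm_sub_le _ _).trans ((add_le_add h4 h5).trans_eq ?_)
  ring

theorem hasDerivAt_wkbSeries (hV : HasPiecewiseContinuousDeriv r V) (h lam : ℝ) {x : ℝ}
    (hx : x ∉ exceptionalSet r V) :
    HasDerivAt (wkbSeries r h lam V) (wkbSeriesDeriv r h lam V x) x := by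
  refine HasDerivAt.const_add _ (HasDerivAt.fun_sum fun k hk => ?_)
  exact (hasDerivAt_jetEval hV h (lowOrder_mono (by have := Finset.mem_range.1 hk; omega)
    (wkb_mem_lowOrder k)) hx).div_const _

theorem continuous_wkbSeries (hV : HasPiecewiseContinuousDeriv r V) (h lam : ℝ) :
    Continuous (wkbSeries r h lam V) := by
  refine continuous_const.add (continuous_finsetSum _ fun k hk => ?_)
  exact (continuous_jetEval hV h (lowOrder_mono (by have := Finset.mem_range.1 hk; omega)
    (wkb_mem_lowOrder k))).div_const _

theorem periodic_wkbSeries (hper : Function.Periodic V (2 * π)) (h lam : ℝ) :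
    Function.Periodic (wkbSeries r h lam V) (2 * π) := by
  intro x
  simp only [wkbSeries, periodic_jetEval hper h _ x]

theorem intervalIntegrable_wkbSeriesDeriv (hV : HasPiecewiseContinuousDeriv r V) (hr : 1 ≤ r)
    (hper : Function.Periodic V (2 * π)) {h : ℝ} (hh : 0 < h) (lam : ℝ) :
    IntervalIntegrable (wkbSeriesDeriv r h lam V) volume (-π) π := by
  have := IntervalIntegrable.sum (μ := volume) (a := -π) (b := π) (Finset.range (r + 1))
    (f := fun k x => jetEval r h V (formalDeriv (wkb k)) x / (lam : ℂ) ^ k)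
    fun k _ => (intervalIntegrable_jetEval hV hr hper hh _ _ _).div_const _
  refine this.congr_ae ?_
  filter_upwards with x
  simp [wkbSeriesDeriv]

/-- The integrated phase identity. The constant `C` collects the pointwise velocity error and the
part of the oscillatory integral that is `O(1 / lam)`; `h ^ r * ε N` is the contribution of `V^(r)`.
-/
theorem exists_phase_expansion (hV : HasPiecewiseContinuousDeriv r V) (hr : 1 ≤ r)
    (hper : Function.Periodic V (2 * π)) (h₀ : ℝ) :
    ∃ (C Λ : ℝ) (ε : ℕ → ℝ), 0 ≤ C ∧ 1 ≤ Λ ∧ Tendsto ε atTop (𝓝 0) ∧ (∀ N, 0 ≤ ε N) ∧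
      ∀ (h lam t : ℝ) (N : ℕ), 0 < h → h ≤ h₀ → Λ ≤ lam → 1 ≤ N →
        turn V h (lam ^ 2) t = 2 * π * N → N * h ≤ 2 * lam ∧
        |N * h - lam - ∑ k ∈ Finset.Icc 1 (r + 1), phaseCoeff k h V / lam ^ k| ≤
          C / lam ^ (r + 2) + h ^ r * ε N / lam ^ (r + 1) := by
  choose a ha0 ha using exists_bound_jetEval hV hper h₀
  obtain ⟨A, hA0, hA⟩ : ∃ A, 0 ≤ A ∧ ∀ h, 0 < h → h ≤ h₀ → ∀ x, ∀ k ≤ r + 1,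
      ‖jetEval r h V (wkb k) x‖ ≤ A := by
    refine ⟨∑ k ∈ Finset.range (r + 2), a (wkb k), Finset.sum_nonneg fun k _ => ha0 _,
      fun h hh hh₀ x k hk => (ha _ h hh hh₀ x).trans ?_⟩
    exact Finset.single_le_sum (f := fun k => a (wkb k)) (fun i _ => ha0 _)
      (Finset.mem_range.2 (by omega))
  set c₂ := 4 * ((r + 1) * A) * A + 2 * ((r + 1) ^ 2 * A ^ 2) with hc₂
  set c₁ := (r + 3) * A + c₂ with hc₁
  have hc₂0 : 0 ≤ c₂ := by positivity
  have hc₁0 : 0 ≤ c₁ := by positivity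
  obtain ⟨C, ε, hC0, hε, hε0, hosc⟩ := exists_oscillation_bound hV hr hper h₀ c₁
  -- Beyond this threshold `Re S` is positive and `ω ≤ 2 lam`. The latter gives `N h ≤ 2 lam`, i.e.
  -- the frequency condition `h / lam ≤ 2 / N`.
  refine ⟨c₂ + C, 1 + 2 * ((r + 1) * A) + c₁, ε, by positivity, ?_, hε, hε0, ?_⟩
  · have : 0 ≤ 2 * ((r + 1) * A) := by positivity
    linarith
  intro h lam t N hh hh₀ hlam hN hturn
  have hrA : 0 ≤ 2 * ((r + 1) * A) := by positivity
  have hlam1 : 1 ≤ lam := by linarith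
  have hl : 0 < lam := by linarith
  have hs := hA h hh hh₀
  have hA' : 2 * ((r + 1) * A) ≤ lam := by linarith
  have hpos : ∀ x, 0 < (wkbSeries r h lam V x).re := by
    intro x
    have h1 := abs_re_wkbSeries_sub_le (x := x) hlam1 hA0 fun k hk => hs x k (by omega)
    have h2 : (r + 1) * A / lam ≤ (r + 1) * A := div_le_self (by positivity) hlam1
    have := (abs_le.1 h1).1
    linarith
  obtain ⟨u, huc, hu1, -, hud, hui, hint⟩ := exists_phase hV.continuous hh hturn
    (continuous_wkbSeries hV h lam)
    (by rw [← periodic_wkbSeries hper h lam (-π)]; congr 1; ring) hpos hV.countable_exceptionalSet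
    (fun x hx => hasDerivAt_wkbSeries hV h lam hx) (intervalIntegrable_wkbSeriesDeriv hV hr hper hh lam)
  set ω := phaseVelocity V h (lam ^ 2) (wkbSeries r h lam V) (wkbSeriesDeriv r h lam V) u with hω
  have hω1 : ∀ x, |ω x - lam| ≤ c₁ / lam := fun x =>
    abs_phaseVelocity_sub_self_le hlam1 hA0 (hs x) hA' (hu1 x)
  have hω2 : ∀ x, |ω x - (approxVelocity r h lam V u x).re| ≤ c₂ / lam ^ (r + 2) := fun x =>
    abs_phaseVelocity_sub_le hlam1 hA0 (hs x) hA' (hu1 x)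
  have huf : IsPhaseFactor h lam (c₁ / lam) u :=
    ⟨huc, hu1, ω, exceptionalSet r V, hV.countable_exceptionalSet, hui, hω1, hud⟩
  have hπ := two_pi_pos
  have hNpos : (0 : ℝ) < N := by exact_mod_cast hN
  have hNh' : N * h ≤ 2 * lam := by
    have h1 : ∀ x, ω x ≤ 2 * lam := by
      intro x
      have h2 : c₁ / lam ≤ c₁ := div_le_self hc₁0 hlam1
      have := (abs_le.1 (hω1 x)).2
      linarith
    have h2 := intervalIntegral.integral_mono_on (by linarith [pi_pos]) hui
      (continuous_const.intervalIntegrable _ _) fun x _ => h1 x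
    rw [hint, intervalIntegral.integral_const, smul_eq_mul] at h2
    have h3 : (2 * π) * (N * h) ≤ (2 * π) * (2 * lam) := by linarith
    exact le_of_mul_le_mul_left h3 hπ
  have hNh : h / lam ≤ 2 / N := by
    rw [div_le_div_iff₀ hl hNpos]
    linarith
  refine ⟨hNh', ?_⟩
  obtain ⟨hoi, hob⟩ := hosc h lam N u hh hh₀ hlam1 hNh huf
  obtain ⟨hai, hav⟩ := re_integral_approxVelocity hV hr hper hh lam hoi
  have hari : IntervalIntegrable (fun x => (approxVelocity r h lam V u x).re) volume (-π) π := by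
    rw [intervalIntegrable_iff] at hai ⊢
    exact hai.re
  have hre : ∫ x in (-π)..π, (approxVelocity r h lam V u x).re =
      (∫ x in (-π)..π, approxVelocity r h lam V u x).re :=
    Complex.reCLM.intervalIntegral_comp_comm hai
  have h1 : |2 * π * N * h - (∫ x in (-π)..π, approxVelocity r h lam V u x).re| ≤
      c₂ / lam ^ (r + 2) * (2 * π) := by
    rw [← hint, ← hre, ← intervalIntegral.integral_sub hui hari]
    have h2 := intervalIntegral.norm_integral_le_of_norm_le_const (a := -π) (b := π)
      (f := fun x => ω x - (approxVelocity r h lam V u x).re) (fun x _ => hω2 x)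
    rwa [show π - -π = 2 * π by ring, abs_of_pos hπ] at h2
  rw [hav] at h1
  set T := ∑ k ∈ Finset.Icc 1 (r + 1), phaseCoeff k h V / lam ^ k
  set z := ∫ x in (-π)..π, conj (jetEval r h V (wkb (r + 1)) x) * u x with hz
  have h2 : |z.re / lam ^ (r + 1)| ≤ (C / lam + h ^ r * ε N) / lam ^ (r + 1) := by
    rw [abs_div, abs_of_pos (pow_pos hl _)]
    have := (Complex.abs_re_le_norm z).trans hob
    gcongr
  have h3 : 2 * π * |N * h - lam - T| ≤
      2 * π * (c₂ / lam ^ (r + 2)) + (C / lam + h ^ r * ε N) / lam ^ (r + 1) := by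
    have h4 : 2 * π * (N * h - lam - T) =
        (2 * π * N * h - (2 * π * (lam + T) + z.re / lam ^ (r + 1))) + z.re / lam ^ (r + 1) := by
      ring
    rw [← abs_of_pos hπ, ← abs_mul, abs_of_pos hπ, h4]
    refine (abs_add_le _ _).trans ?_
    linarith
  have h5 : (C / lam + h ^ r * ε N) / lam ^ (r + 1) ≤
      2 * π * ((C / lam + h ^ r * ε N) / lam ^ (r + 1)) := by
    have := hε0 N
    refine le_mul_of_one_le_left (by positivity) ?_
    linarith [pi_gt_three]
  have h6 : |N * h - lam - T| ≤
      c₂ / lam ^ (r + 2) + (C / lam + h ^ r * ε N) / lam ^ (r + 1) := by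
    refine le_of_mul_le_mul_left ?_ hπ
    linarith
  refine h6.trans_eq ?_
  rw [pow_succ _ (r + 1)]
  field_simp
  ring

end

/-! ### Inversion of the phase expansion -/

section
open Polynomial

/-- With `t = 1 / X` and `lam = X φ`, the equation `lam + ∑_{k ≤ n} a_k lam⁻ᵏ = X` becomes
`scaledEquation n a = 0` in `φ`. -/
noncomputable def scaledEquation (n : ℕ) (a : ℕ → ℝ) : Polynomial ℝ[X] :=
  X ^ (n + 1) - X ^ n + ∑ k ∈ Finset.Icc 1 n, C (C (a k) * X ^ (k + 1)) * X ^ (n - k)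

/-- The partial sums of the formal power series in `t` that solves `scaledEquation n a`. -/
noncomputable def inverseSeries (n : ℕ) (a : ℕ → ℝ) : ℕ → ℝ[X]
  | 0 => 1
  | j + 1 => inverseSeries n a j -
      C (((scaledEquation n a).eval (inverseSeries n a j)).coeff (j + 2)) * X ^ (j + 2)

/-- The coefficients of the inverse of `lam + ∑_{k ≤ n} a_k lam⁻ᵏ`. -/
noncomputable def inverseCoeff (n : ℕ) (a : ℕ → ℝ) (k : ℕ) : ℝ :=
  -((scaledEquation n a).eval (inverseSeries n a (k - 1))).coeff (k + 1)

theorem inverseSeries_succ (n : ℕ) (a : ℕ → ℝ) (j : ℕ) : inverseSeries n a (j + 1) =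
    inverseSeries n a j + C (inverseCoeff n a (j + 1)) * X ^ (j + 2) := by
  rw [inverseSeries, inverseCoeff, Nat.add_sub_cancel, C_neg]
  ring

theorem inverseSeries_eq (n : ℕ) (a : ℕ → ℝ) (j : ℕ) : inverseSeries n a j =
    1 + ∑ k ∈ Finset.Icc 1 j, C (inverseCoeff n a k) * X ^ (k + 1) := by
  induction j with
  | zero => simp [inverseSeries]
  | succ j ih => rw [inverseSeries_succ, ih, Finset.sum_Icc_succ_top (by omega), add_assoc]

theorem eval_zero_inverseSeries (n : ℕ) (a : ℕ → ℝ) (j : ℕ) : (inverseSeries n a j).eval 0 = 1 := by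
  rw [inverseSeries_eq]
  simp [eval_finsetSum]

theorem eval_scaledEquation (n : ℕ) (a : ℕ → ℝ) (φ : ℝ[X]) : (scaledEquation n a).eval φ =
    φ ^ (n + 1) - φ ^ n + ∑ k ∈ Finset.Icc 1 n, C (a k) * X ^ (k + 1) * φ ^ (n - k) := by
  simp [scaledEquation, eval_finsetSum]

/-- A Newton–Hensel step: each correction removes the lowest remaining coefficient of the equation.
-/
theorem pow_dvd_scaledEquation (n : ℕ) (a : ℕ → ℝ) (j : ℕ) :
    X ^ (j + 2) ∣ (scaledEquation n a).eval (inverseSeries n a j) := by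
  induction j with
  | zero =>
    rw [eval_scaledEquation, inverseSeries]
    simp only [one_pow, sub_self, zero_add, mul_one]
    refine Finset.dvd_sum fun k hk => Dvd.dvd.mul_left (pow_dvd_pow _ ?_) _
    have := (Finset.mem_Icc.1 hk).1
    omega
  | succ j ih =>
    obtain ⟨g, hg⟩ := ih
    have h1 : inverseCoeff n a (j + 1) = -g.eval 0 := by
      have h2 := coeff_X_pow_mul g (j + 2) 0
      rw [zero_add] at h2
      rw [inverseCoeff, Nat.add_sub_cancel, hg, h2, coeff_zero_eq_eval_zero]
    obtain ⟨w, hw⟩ := (scaledEquation n a).binomExpansion (inverseSeries n a j)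
      (C (inverseCoeff n a (j + 1)) * X ^ (j + 2))
    -- At `φ = 1`, `t = 0` the derivative is `(n + 1) - n = 1`, so the correction is just minus the
    -- coefficient.
    have h2 : ((derivative (scaledEquation n a)).eval (inverseSeries n a j)).eval 0 = 1 := by
      simp only [scaledEquation, derivative_add, derivative_sub, derivative_sum, derivative_C_mul,
        derivative_X_pow]
      simp [eval_finsetSum, eval_zero_inverseSeries]
    rw [inverseSeries_succ, hw, hg, show j + 1 + 2 = (j + 2) + 1 by omega, pow_succ X (j + 2)]
    have h3 : X ∣ g + (derivative (scaledEquation n a)).eval (inverseSeries n a j) *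
        C (inverseCoeff n a (j + 1)) + w * C (inverseCoeff n a (j + 1)) ^ 2 * X ^ (j + 2) := by
      rw [X_dvd_iff, coeff_zero_eq_eval_zero]
      simp [h1, h2]
    refine (mul_dvd_mul_left (X ^ (j + 2)) h3).trans (dvd_of_eq ?_)
    ring

theorem coeff_eq_of_X_pow_dvd_sub {p q : ℝ[X]} {m k : ℕ} (h : X ^ m ∣ p - q) (hk : k < m) :
    p.coeff k = q.coeff k := by
  have := X_pow_dvd_iff.1 h k hk
  rwa [coeff_sub, sub_eq_zero] at this

theorem exists_one_add_X_sq_mul_pow (z : ℝ[X]) (m : ℕ) :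
    ∃ w, (1 + X ^ 2 * z) ^ m = 1 + (m : ℝ[X]) * (X ^ 2 * z) + X ^ 4 * w := by
  obtain ⟨w, hw⟩ := powAddExpansion 1 (X ^ 2 * z) m
  refine ⟨w * z ^ 2, ?_⟩
  rw [hw]
  simp only [one_pow]
  ring

/-- The equation at `φ = 1 + b t²` up to order `t⁴`: `φⁿ (φ - 1)` gives `b t² + n b² t⁴`, and the
term with `a 1` gives `a₁ t² + (n - 1) a₁ b t⁴`. This suffices to read off the first three
coefficients of the inverse. -/
theorem X_pow_five_dvd_scaledEquation_sub {n : ℕ} (hn : 2 ≤ n) {a : ℕ → ℝ} (h2 : a 2 = 0)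
    (b : ℝ) :
    X ^ 5 ∣ (scaledEquation n a).eval (1 + X ^ 2 * C b) -
      (X ^ 2 * C (a 1 + b) + X ^ 4 * C ((if 3 ≤ n then a 3 else 0) + n * b ^ 2 + (n - 1 : ℕ) * (a 1 * b))) := by
  obtain ⟨w, hw⟩ := exists_one_add_X_sq_mul_pow (C b) n
  obtain ⟨w1, hw1⟩ := exists_one_add_X_sq_mul_pow (C b) (n - 1)
  have h3 : X ^ 5 ∣ ∑ k ∈ Finset.Icc 3 n, C (a k) * X ^ (k + 1) * (1 + X ^ 2 * C b) ^ (n - k) -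
      X ^ 4 * C (if 3 ≤ n then a 3 else 0) := by
    rcases Nat.lt_or_ge n 3 with hn3 | hn3
    · rw [Finset.Icc_eq_empty (by omega), if_neg (by omega)]
      simp
    · rw [← Finset.add_sum_Ioc_eq_sum_Icc hn3, if_pos hn3]
      obtain ⟨w3, hw3⟩ := exists_one_add_X_sq_mul_pow (C b) (n - 3)
      have h4 : X ^ 5 ∣ ∑ k ∈ Finset.Ioc 3 n, C (a k) * X ^ (k + 1) * (1 + X ^ 2 * C b) ^ (n - k) := by
        refine Finset.dvd_sum fun k hk => Dvd.dvd.mul_right (Dvd.dvd.mul_left (pow_dvd_pow _ ?_) _) _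
        have := (Finset.mem_Ioc.1 hk).1
        omega
      rw [hw3, add_sub_right_comm]
      refine dvd_add ⟨X * C (a 3) * (((n - 3 : ℕ) : ℝ[X]) * C b + X ^ 2 * w3), ?_⟩ h4
      ring
  have h5 : ∑ k ∈ Finset.Icc 1 n, C (a k) * X ^ (k + 1) * (1 + X ^ 2 * C b) ^ (n - k) =
      C (a 1) * X ^ 2 * (1 + X ^ 2 * C b) ^ (n - 1) +
        ∑ k ∈ Finset.Icc 3 n, C (a k) * X ^ (k + 1) * (1 + X ^ 2 * C b) ^ (n - k) := by
    rw [← Finset.add_sum_Ioc_eq_sum_Icc (by omega : 1 ≤ n)]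
    have : Finset.Ioc 1 n = Finset.Icc 2 n := rfl
    rw [this, ← Finset.add_sum_Ioc_eq_sum_Icc hn, h2]
    simp only [C_0, zero_mul, zero_add]
    rfl
  rw [eval_scaledEquation, h5, pow_succ _ n, hw, hw1]
  obtain ⟨d, hd⟩ := h3
  refine ⟨X * (w * C b) + X * C (a 1) * w1 + d, ?_⟩
  simp only [C_add, C_mul, C_pow, map_natCast]
  linear_combination hd

theorem inverseCoeff_one {n : ℕ} (hn : 2 ≤ n) {a : ℕ → ℝ} (h2 : a 2 = 0) : inverseCoeff n a 1 = -a 1 := by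
  have h1 := X_pow_five_dvd_scaledEquation_sub hn h2 0
  rw [inverseCoeff, Nat.sub_self, inverseSeries]
  rw [C_0, mul_zero, add_zero] at h1
  rw [coeff_eq_of_X_pow_dvd_sub h1 (by norm_num)]
  simp

theorem inverseCoeff_two {n : ℕ} (hn : 2 ≤ n) {a : ℕ → ℝ} (h2 : a 2 = 0) : inverseCoeff n a 2 = 0 := by
  have h1 := X_pow_five_dvd_scaledEquation_sub hn h2 (inverseCoeff n a 1)
  have h3 : inverseSeries n a 1 = 1 + X ^ 2 * C (inverseCoeff n a 1) := by
    rw [inverseSeries_eq, Finset.Icc_self, Finset.sum_singleton]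
    ring
  rw [inverseCoeff, h3, coeff_eq_of_X_pow_dvd_sub h1 (by norm_num)]
  simp [coeff_X_pow_mul']

theorem inverseCoeff_three {n : ℕ} (hn3 : 3 ≤ n) {a : ℕ → ℝ} (h2 : a 2 = 0) : inverseCoeff n a 3 = -a 3 - a 1 ^ 2 := by
  have hn : 2 ≤ n := by omega
  have h1 := X_pow_five_dvd_scaledEquation_sub hn h2 (inverseCoeff n a 1)
  have h3 : inverseSeries n a 2 = 1 + X ^ 2 * C (inverseCoeff n a 1) := by
    rw [inverseSeries_succ, inverseCoeff_two hn h2, inverseSeries_eq, Finset.Icc_self,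
      Finset.sum_singleton, C_0]
    ring
  rw [inverseCoeff, h3, coeff_eq_of_X_pow_dvd_sub h1 (by norm_num), inverseCoeff_one hn h2]
  simp only [coeff_add, coeff_X_pow_mul', coeff_C]
  rw [Nat.cast_sub (by omega), if_pos hn3]
  norm_num
  ring

/-- Families of polynomials of bounded degree with coefficients given by differential
polynomials. -/
structure HasDiffPolyCoeffs (r : ℕ) (P : ℝ → (ℝ → ℝ) → ℝ[X]) : Prop where
  exists_natDegree_le : ∃ D, ∀ h V, (P h V).natDegree ≤ D
  coeff : ∀ n, IsDiffPolyFunctional r fun h V => (P h V).coeff n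

namespace HasDiffPolyCoeffs

variable {r : ℕ} {P Q : ℝ → (ℝ → ℝ) → ℝ[X]}

theorem const (r : ℕ) (p : ℝ[X]) : HasDiffPolyCoeffs r fun _ _ => p :=
  ⟨⟨p.natDegree, fun _ _ => le_rfl⟩, fun n => IsDiffPolyFunctional.const r (p.coeff n)⟩

theorem C {A : ℝ → (ℝ → ℝ) → ℝ} (hA : IsDiffPolyFunctional r A) :
    HasDiffPolyCoeffs r fun h V => Polynomial.C (A h V) := by
  refine ⟨⟨0, fun h V => (natDegree_C _).le⟩, fun n => ?_⟩
  simp only [coeff_C]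
  split_ifs
  · exact hA
  · exact IsDiffPolyFunctional.const r 0

theorem add (hP : HasDiffPolyCoeffs r P) (hQ : HasDiffPolyCoeffs r Q) :
    HasDiffPolyCoeffs r fun h V => P h V + Q h V := by
  obtain ⟨D, hD⟩ := hP.exists_natDegree_le
  obtain ⟨D', hD'⟩ := hQ.exists_natDegree_le
  refine ⟨⟨max D D', fun h V => natDegree_add_le_of_degree_le
    ((hD h V).trans (le_max_left _ _)) ((hD' h V).trans (le_max_right _ _))⟩, fun n => ?_⟩
  simp only [coeff_add]
  exact (hP.coeff n).add (hQ.coeff n)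

theorem mul (hP : HasDiffPolyCoeffs r P) (hQ : HasDiffPolyCoeffs r Q) :
    HasDiffPolyCoeffs r fun h V => P h V * Q h V := by
  obtain ⟨D, hD⟩ := hP.exists_natDegree_le
  obtain ⟨D', hD'⟩ := hQ.exists_natDegree_le
  refine ⟨⟨D + D', fun h V => natDegree_mul_le_of_le (hD h V) (hD' h V)⟩, fun n => ?_⟩
  simp only [coeff_mul]
  exact IsDiffPolyFunctional.sum _ fun i _ => (hP.coeff i.1).mul (hQ.coeff i.2)

theorem sub (hP : HasDiffPolyCoeffs r P) (hQ : HasDiffPolyCoeffs r Q) :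
    HasDiffPolyCoeffs r fun h V => P h V - Q h V := by
  have h1 := hP.add ((const r (-1)).mul hQ)
  simpa only [neg_one_mul, ← sub_eq_add_neg] using h1

theorem pow (hP : HasDiffPolyCoeffs r P) (m : ℕ) : HasDiffPolyCoeffs r fun h V => P h V ^ m := by
  induction m with
  | zero => simpa using const r 1
  | succ m ih => simpa only [pow_succ] using ih.mul hP

theorem sum {ι : Type*} (s : Finset ι) {P : ι → ℝ → (ℝ → ℝ) → ℝ[X]}
    (hP : ∀ i ∈ s, HasDiffPolyCoeffs r (P i)) :
    HasDiffPolyCoeffs r fun h V => ∑ i ∈ s, P i h V := by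
  classical
  induction s using Finset.induction_on with
  | empty => simpa using const r 0
  | insert a s ha ih =>
    simp only [Finset.sum_insert ha]
    exact (hP a (by simp)).add (ih fun i hi => hP i (by simp [hi]))

end HasDiffPolyCoeffs

/-! ### Inversion with error bounds uniform in `h`. -/

variable {r n : ℕ} {a : ℕ → ℝ → (ℝ → ℝ) → ℝ}

theorem hasDiffPolyCoeffs_scaledEquation (ha : ∀ k ≤ n, IsDiffPolyFunctional r (a k))
    {P : ℝ → (ℝ → ℝ) → ℝ[X]} (hP : HasDiffPolyCoeffs r P) :
    HasDiffPolyCoeffs r fun h V => (scaledEquation n fun k => a k h V).eval (P h V) := by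
  simp only [eval_scaledEquation]
  refine ((hP.pow _).sub (hP.pow _)).add (HasDiffPolyCoeffs.sum _ fun k hk => ?_)
  exact ((HasDiffPolyCoeffs.C (ha k (Finset.mem_Icc.1 hk).2)).mul (HasDiffPolyCoeffs.const r _)).mul
    (hP.pow _)

theorem hasDiffPolyCoeffs_inverseSeries (ha : ∀ k ≤ n, IsDiffPolyFunctional r (a k)) (j : ℕ) :
    HasDiffPolyCoeffs r fun h V => inverseSeries n (fun k => a k h V) j := by
  induction j with
  | zero => exact HasDiffPolyCoeffs.const r 1
  | succ j ih =>
    exact ih.sub ((HasDiffPolyCoeffs.C ((hasDiffPolyCoeffs_scaledEquation ha ih).coeff (j + 2))).mul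
      (HasDiffPolyCoeffs.const r _))

theorem isDiffPolyFunctional_inverseCoeff (ha : ∀ k ≤ n, IsDiffPolyFunctional r (a k)) (k : ℕ) :
    IsDiffPolyFunctional r fun h V => inverseCoeff n (fun k => a k h V) k := by
  have h1 := (IsDiffPolyFunctional.const r (-1)).mul ((hasDiffPolyCoeffs_scaledEquation ha
    (hasDiffPolyCoeffs_inverseSeries ha (k - 1))).coeff (k + 1))
  simpa only [inverseCoeff, neg_one_mul] using h1

/-- For fixed `V` the value is a polynomial in `h`, hence bounded on `[0, h₀]`; no regularity of `V`
is needed. -/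
theorem IsDiffPolyFunctional.exists_bound {A : ℝ → (ℝ → ℝ) → ℝ} (hA : IsDiffPolyFunctional r A)
    (V : ℝ → ℝ) (h₀ : ℝ) : ∃ C, 0 ≤ C ∧ ∀ h, 0 < h → h ≤ h₀ → |A h V| ≤ C := by
  obtain ⟨s, F, Q, hQ⟩ := hA
  have hc : Continuous fun h => A h V := by
    simp only [hQ]
    have h1 : Continuous fun (h : ℝ) (o : Option (Fin s)) =>
        o.elim h fun j => diffIntegral (F j) V := by
      refine continuous_pi fun o => ?_
      rcases o with _ | j
      · exact continuous_id
      · exact continuous_const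
    exact (MvPolynomial.continuous_eval Q).comp h1
  obtain ⟨C, hC⟩ := (isCompact_Icc (a := 0) (b := h₀)).exists_bound_of_continuousOn hc.continuousOn
  exact ⟨|C|, abs_nonneg C, fun h hh hh₀ => (hC h ⟨hh.le, hh₀⟩).trans (le_abs_self C)⟩

/-- The uniform degree bound leaves finitely many coefficients to estimate, and divisibility removes
those below `m`. -/
theorem HasDiffPolyCoeffs.exists_eval_bound {P : ℝ → (ℝ → ℝ) → ℝ[X]} (hP : HasDiffPolyCoeffs r P)
    {m : ℕ} {V : ℝ → ℝ} (hd : ∀ h, X ^ m ∣ P h V) (h₀ : ℝ) :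
    ∃ q, 0 ≤ q ∧ ∀ h, 0 < h → h ≤ h₀ → ∀ t, 0 ≤ t → t ≤ 1 → |(P h V).eval t| ≤ q * t ^ m := by
  obtain ⟨D, hD⟩ := hP.exists_natDegree_le
  choose c hc0 hc using fun i => (hP.coeff i).exists_bound V h₀
  refine ⟨∑ i ∈ Finset.range (D + 1), c i, Finset.sum_nonneg fun i _ => hc0 i,
    fun h hh hh₀ t ht ht1 => ?_⟩
  rw [eval_eq_sum_range' (Nat.lt_succ_of_le (hD h V)), Finset.sum_mul]
  refine (Finset.abs_sum_le_sum_abs _ _).trans (Finset.sum_le_sum fun i _ => ?_)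
  rw [abs_mul, abs_of_nonneg (pow_nonneg ht i)]
  rcases lt_or_ge i m with him | him
  · rw [X_pow_dvd_iff.1 (hd h) i him, abs_zero, zero_mul]
    have := hc0 i
    positivity
  · have h1 := pow_le_pow_of_le_one ht ht1 him
    have h2 := hc i h hh hh₀
    have h3 := hc0 i
    gcongr

/-- Far out the sum is Lipschitz with constant at most `1 / 2`, so approximate solutions of the
equation are close to each other. -/
theorem abs_sub_le_two_mul_of_large {b : ℕ → ℝ} {M L x y : ℝ} (hM : 0 ≤ M)
    (hb : ∀ k ∈ Finset.Icc 1 n, |b k| ≤ M) (hL : 1 ≤ L) (hL' : 2 * (n * (n * M)) ≤ L) (hx : L ≤ x)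
    (hy : L ≤ y) :
    |x - y| ≤ 2 * |(x + ∑ k ∈ Finset.Icc 1 n, b k / x ^ k) -
      (y + ∑ k ∈ Finset.Icc 1 n, b k / y ^ k)| := by
  have hx0 : 0 < x := by linarith
  have hy0 : 0 < y := by linarith
  have hL0 : 0 < L := by linarith
  have h1 : |∑ k ∈ Finset.Icc 1 n, b k / x ^ k - ∑ k ∈ Finset.Icc 1 n, b k / y ^ k| ≤
      |x - y| / 2 := by
    rw [← Finset.sum_sub_distrib]
    have h2 : |1 / x - 1 / y| ≤ |x - y| / L := by
      rw [div_sub_div _ _ hx0.ne' hy0.ne', abs_div, abs_of_pos (mul_pos hx0 hy0), one_mul, mul_one,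
        abs_sub_comm y x]
      have h3 : L ≤ x * y := by nlinarith
      gcongr
    have h4 : ∀ k ∈ Finset.Icc 1 n, |b k / x ^ k - b k / y ^ k| ≤ M * (|x - y| / L * n) := by
      intro k hk
      have h5 : b k / x ^ k - b k / y ^ k = b k * ((1 / x) ^ k - (1 / y) ^ k) := by
        rw [one_div_pow, one_div_pow]; ring
      have h6 := abs_pow_sub_pow_le (1 / x) (1 / y) k
      have h7 : max |1 / x| |1 / y| ^ (k - 1) ≤ 1 := by
        refine pow_le_one₀ ((abs_nonneg _).trans (le_max_left _ _)) (max_le ?_ ?_)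
        · rw [abs_of_pos (by positivity), div_le_one hx0]; linarith
        · rw [abs_of_pos (by positivity), div_le_one hy0]; linarith
      have h8 : (k : ℝ) ≤ n := by exact_mod_cast (Finset.mem_Icc.1 hk).2
      rw [h5, abs_mul]
      refine mul_le_mul (hb k hk) (h6.trans ?_) (abs_nonneg _) hM
      refine (mul_le_of_le_one_right (by positivity) h7).trans ?_
      gcongr
    refine (Finset.abs_sum_le_sum_abs _ _).trans ((Finset.sum_le_sum h4).trans ?_)
    rw [Finset.sum_const, Nat.card_Icc, Nat.add_sub_cancel, nsmul_eq_mul]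
    have h9 : n * (M * (|x - y| / L * n)) = |x - y| / 2 * (2 * (n * (n * M)) / L) := by ring
    rw [h9]
    exact mul_le_of_le_one_right (by positivity) ((div_le_one hL0).2 hL')
  have h2 : x - y = ((x + ∑ k ∈ Finset.Icc 1 n, b k / x ^ k) -
      (y + ∑ k ∈ Finset.Icc 1 n, b k / y ^ k)) -
      (∑ k ∈ Finset.Icc 1 n, b k / x ^ k - ∑ k ∈ Finset.Icc 1 n, b k / y ^ k) := by ring
  have h3 := abs_sub ((x + ∑ k ∈ Finset.Icc 1 n, b k / x ^ k) -
      (y + ∑ k ∈ Finset.Icc 1 n, b k / y ^ k))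
      (∑ k ∈ Finset.Icc 1 n, b k / x ^ k - ∑ k ∈ Finset.Icc 1 n, b k / y ^ k)
  rw [← h2] at h3
  linarith

theorem mul_eval_inverseSeries {b : ℕ → ℝ} {x : ℝ} (hx : x ≠ 0) :
    x * (inverseSeries n b n).eval (1 / x) =
      x + ∑ k ∈ Finset.Icc 1 n, inverseCoeff n b k / x ^ k := by
  rw [inverseSeries_eq, eval_add, eval_one, eval_finsetSum, mul_add, mul_one, Finset.mul_sum]
  congr 1
  refine Finset.sum_congr rfl fun k _ => ?_
  rw [eval_mul, eval_C, eval_pow, eval_X, one_div_pow, pow_succ]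
  field_simp

theorem eval_eval_scaledEquation {b : ℕ → ℝ} {x : ℝ} (hx : x ≠ 0) (φ : ℝ[X])
    (hφ : φ.eval (1 / x) ≠ 0) :
    x * φ.eval (1 / x) + (∑ k ∈ Finset.Icc 1 n, b k / (x * φ.eval (1 / x)) ^ k) - x =
      x / φ.eval (1 / x) ^ n * ((scaledEquation n b).eval φ).eval (1 / x) := by
  set z := φ.eval (1 / x) with hz
  have h1 : ((scaledEquation n b).eval φ).eval (1 / x) = z ^ (n + 1) - z ^ n +
      ∑ k ∈ Finset.Icc 1 n, b k * (1 / x) ^ (k + 1) * z ^ (n - k) := by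
    rw [eval_scaledEquation]
    simp [eval_finsetSum, hz]
  have h2 : ∀ k ∈ Finset.Icc 1 n, x / z ^ n * (b k * (1 / x) ^ (k + 1) * z ^ (n - k)) =
      b k / (x * z) ^ k := by
    intro k hk
    have h3 : z ^ n = z ^ (n - k) * z ^ k := by
      rw [← pow_add, Nat.sub_add_cancel (Finset.mem_Icc.1 hk).2]
    rw [h3, mul_pow, one_div_pow, pow_succ]
    field_simp
  rw [h1, mul_add, Finset.mul_sum, Finset.sum_congr rfl h2, pow_succ]
  field_simp
  ring

/-- If `lam + ∑_{k ≤ n} a_k lam⁻ᵏ` is close to `x`, then `lam` is close to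
`x + ∑_{k ≤ n} A_k x⁻ᵏ`. -/
theorem exists_inversion (ha : ∀ k ≤ n, IsDiffPolyFunctional r (a k)) (V : ℝ → ℝ) (h₀ : ℝ) :
    ∃ C K : ℝ, 0 ≤ C ∧ 1 ≤ K ∧ ∀ h, 0 < h → h ≤ h₀ → ∀ lam x δ, K ≤ lam → K ≤ x →
      |x - lam - ∑ k ∈ Finset.Icc 1 n, a k h V / lam ^ k| ≤ δ →
      |lam - (x + ∑ k ∈ Finset.Icc 1 n, inverseCoeff n (fun k => a k h V) k / x ^ k)| ≤
        2 * δ + C / x ^ (n + 1) := by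
  have hbd : ∀ B : ℕ → ℝ → (ℝ → ℝ) → ℝ, (∀ k ≤ n, IsDiffPolyFunctional r (B k)) →
      ∃ M, 0 ≤ M ∧ ∀ h, 0 < h → h ≤ h₀ → ∀ k ∈ Finset.Icc 1 n, |B k h V| ≤ M := by
    intro B hB
    have h1 : ∀ k, ∃ C, 0 ≤ C ∧ (k ≤ n → ∀ h, 0 < h → h ≤ h₀ → |B k h V| ≤ C) := by
      intro k
      by_cases hk : k ≤ n
      · obtain ⟨C, hC0, hC⟩ := (hB k hk).exists_bound V h₀
        exact ⟨C, hC0, fun _ => hC⟩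
      · exact ⟨0, le_rfl, fun h => absurd h hk⟩
    choose c hc0 hc using h1
    refine ⟨∑ k ∈ Finset.Icc 1 n, c k, Finset.sum_nonneg fun k _ => hc0 k,
      fun h hh hh₀ k hk => (hc k (Finset.mem_Icc.1 hk).2 h hh hh₀).trans ?_⟩
    exact Finset.single_le_sum (f := c) (fun i _ => hc0 i) hk
  obtain ⟨M, hM0, hM⟩ := hbd a ha
  obtain ⟨M', hM0', hM'⟩ := hbd (fun k h V => inverseCoeff n (fun k => a k h V) k)
    fun k _ => isDiffPolyFunctional_inverseCoeff ha k
  obtain ⟨q, hq0, hq⟩ := (hasDiffPolyCoeffs_scaledEquation ha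
    (hasDiffPolyCoeffs_inverseSeries ha n)).exists_eval_bound (V := V) (m := n + 2)
    (fun h => pow_dvd_scaledEquation n _ n) h₀
  have hnn : 0 ≤ 2 * (n * (n * M)) := by positivity
  have hnM' : 0 ≤ n * M' := by positivity
  -- For `x` beyond this threshold the series value `z` is at least `1 / 2`. Hence `z⁻ⁿ ≤ 2ⁿ`, and
  -- `x z ≥ x / 2` still lies where the Lipschitz estimate applies.
  refine ⟨2 * (2 ^ n * q), 2 * (1 + 2 * (n * (n * M)) + n * M'), by positivity, by linarith, ?_⟩
  intro h hh hh₀ lam x δ hlam hx hδ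
  set b := fun k => a k h V with hb
  have hx1 : 1 ≤ x := by linarith
  have hx0 : 0 < x := by linarith
  have hS : |∑ k ∈ Finset.Icc 1 n, inverseCoeff n b k / x ^ k| ≤ n * M' := by
    have h1 : ∀ k ∈ Finset.Icc 1 n, |inverseCoeff n b k / x ^ k| ≤ M' := by
      intro k hk
      rw [abs_div, abs_of_pos (pow_pos hx0 k)]
      exact (div_le_self (abs_nonneg _) (one_le_pow₀ hx1)).trans (hM' h hh hh₀ k hk)
    refine (Finset.abs_sum_le_sum_abs _ _).trans ((Finset.sum_le_sum h1).trans_eq ?_)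
    rw [Finset.sum_const, Nat.card_Icc, Nat.add_sub_cancel, nsmul_eq_mul]
  rw [← mul_eval_inverseSeries hx0.ne']
  have hS' := mul_eval_inverseSeries (n := n) (b := b) hx0.ne'
  set z := (inverseSeries n b n).eval (1 / x) with hz
  have hxz : x / 2 ≤ x * z := by
    have := (abs_le.1 hS).1
    linarith
  have hz2 : 1 / 2 ≤ z := by
    refine le_of_mul_le_mul_left ?_ hx0
    linarith
  have hz0 : 0 < z := by linarith
  have h1 := abs_sub_le_two_mul_of_large (n := n) (b := b) (L := 1 + 2 * (n * (n * M))) (x := lam)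
    (y := x * z) hM0 (hM h hh hh₀) (by linarith) (by linarith) (by linarith) (by linarith)
  have h2 : |x * z + (∑ k ∈ Finset.Icc 1 n, b k / (x * z) ^ k) - x| ≤ 2 ^ n * q / x ^ (n + 1) := by
    rw [eval_eval_scaledEquation hx0.ne' _ hz0.ne', abs_mul, ← hz,
      abs_of_pos (div_pos hx0 (pow_pos hz0 n))]
    have h3 := hq h hh hh₀ (1 / x) (by positivity) ((div_le_one hx0).2 hx1)
    have h4 : x / z ^ n ≤ x * 2 ^ n := by
      rw [div_le_iff₀ (pow_pos hz0 n), mul_assoc, ← mul_pow]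
      exact le_mul_of_one_le_right hx0.le (one_le_pow₀ (by linarith))
    calc _ ≤ x * 2 ^ n * (q * (1 / x) ^ (n + 2)) := by gcongr
      _ = _ := by
        rw [one_div_pow, pow_succ x (n + 1)]
        field_simp
  have h5 := abs_sub_le (lam + ∑ k ∈ Finset.Icc 1 n, b k / lam ^ k) x
    (x * z + ∑ k ∈ Finset.Icc 1 n, b k / (x * z) ^ k)
  have h6 : |lam + (∑ k ∈ Finset.Icc 1 n, b k / lam ^ k) - x| ≤ δ := by
    rw [abs_sub_comm]
    refine le_of_eq_of_le (congrArg _ ?_) hδ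
    ring
  rw [abs_sub_comm x] at h5
  have h7 : 2 * (2 ^ n * q) / x ^ (n + 1) = 2 * (2 ^ n * q / x ^ (n + 1)) := by ring
  rw [h7]
  linarith

end

/-! ### The expansion of the eigenvalues -/

section

variable {r : ℕ} {V : ℝ → ℝ}

/-- The coefficients of the expansion of the eigenvalues. -/
noncomputable def eigenvalueCoeff (r k : ℕ) (h : ℝ) (V : ℝ → ℝ) : ℝ :=
  inverseCoeff (r + 1) (fun k => phaseCoeff k h V) k

theorem isDiffPolyFunctional_phaseCoeff (hr : 1 ≤ r) {k : ℕ} (hk : k ≤ r + 1) :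
    IsDiffPolyFunctional r (phaseCoeff k) := by
  have h1 := (isDiffPolyFunctional_formalIntegral (phasePoly_mem_lowOrder hr hk)).mul
    (IsDiffPolyFunctional.const r (2 * π)⁻¹)
  exact h1

theorem isDiffPolyFunctional_eigenvalueCoeff (hr : 1 ≤ r) (k : ℕ) :
    IsDiffPolyFunctional r (eigenvalueCoeff r k) :=
  isDiffPolyFunctional_inverseCoeff (fun _ hk => isDiffPolyFunctional_phaseCoeff hr hk) k

theorem phaseCoeff_one (h : ℝ) (V : ℝ → ℝ) :
    phaseCoeff 1 h V = -(1 / (4 * π) * ∫ x in (-π)..π, V x) := by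
  rw [phaseCoeff, phasePoly, if_pos rfl, formalIntegral_wkb_one]
  field_simp
  ring

theorem phaseCoeff_two (h : ℝ) (V : ℝ → ℝ) : phaseCoeff 2 h V = 0 := by
  rw [phaseCoeff, phasePoly, if_neg (by norm_num), wkbRest_one, formalIntegral_zero, zero_div]

theorem phaseCoeff_three (h : ℝ) (V : ℝ → ℝ) :
    phaseCoeff 3 h V = -(1 / (16 * π) * ∫ x in (-π)..π, V x ^ 2) := by
  rw [phaseCoeff, phasePoly, if_neg (by norm_num), formalIntegral_wkbRest_two]
  field_simp
  ring

theorem eigenvalueCoeff_one (hr : 1 ≤ r) (h : ℝ) (V : ℝ → ℝ) :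
    eigenvalueCoeff r 1 h V = 1 / (4 * π) * ∫ x in (-π)..π, V x := by
  rw [eigenvalueCoeff, inverseCoeff_one (by omega) (phaseCoeff_two h V), phaseCoeff_one, neg_neg]

theorem eigenvalueCoeff_two (hr : 1 ≤ r) (h : ℝ) (V : ℝ → ℝ) : eigenvalueCoeff r 2 h V = 0 :=
  inverseCoeff_two (by omega) (phaseCoeff_two h V)

theorem eigenvalueCoeff_three (hr : 2 ≤ r) (h : ℝ) (V : ℝ → ℝ) : eigenvalueCoeff r 3 h V =
    1 / (16 * π) * (∫ x in (-π)..π, V x ^ 2) - eigenvalueCoeff r 1 h V ^ 2 := by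
  rw [eigenvalueCoeff_one (by omega), eigenvalueCoeff,
    inverseCoeff_three (by omega) (phaseCoeff_two h V), phaseCoeff_one, phaseCoeff_three]
  ring

/-- If `μ < Λ²`, the upper rotation bound with `κ² = Λ² + M` allows fewer than `N` turns. -/
theorem sq_le_of_turn_eq (hV : Continuous V) {M Λ h₀ h μ t : ℝ} {N : ℕ} (hM : ∀ x, |V x| ≤ M)
    (hΛ : 0 < Λ) (hh : 0 < h) (hh₀ : h ≤ h₀) (hN : √(Λ ^ 2 + M) + h₀ / 2 < N * h)
    (ht : turn V h μ t = 2 * π * N) : Λ ^ 2 ≤ μ := by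
  by_contra hμ
  have hM0 : 0 ≤ M := (abs_nonneg _).trans (hM 0)
  have h1 := turn_le_of_le_sq (μ := μ) hV hh (Real.sqrt_pos.2 (by positivity : 0 < Λ ^ 2 + M))
    (fun x => by
      rw [Real.sq_sqrt (by positivity)]
      linarith [(abs_le.1 (hM x)).1]) t
  rw [ht] at h1
  have h2 : 2 * π * N * h ≤ 2 * π * √(Λ ^ 2 + M) + π * h := by
    calc 2 * π * N * h ≤ (2 * π * √(Λ ^ 2 + M) / h + π) * h := by gcongr
      _ = _ := by field_simp
  have h3 : 2 * π * (√(Λ ^ 2 + M) + h₀ / 2) < 2 * π * (N * h) :=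
    mul_lt_mul_of_pos_left hN two_pi_pos
  have h4 : π * h ≤ π * h₀ := by gcongr
  linarith

theorem exists_sqrt_expansion (hV : HasPiecewiseContinuousDeriv r V) (hr : 1 ≤ r)
    (hper : Function.Periodic V (2 * π)) (h₀ : ℝ) :
    ∃ (C K : ℝ) (ε : ℕ → ℝ), 0 ≤ C ∧ 0 < K ∧ Tendsto ε atTop (𝓝 0) ∧ (∀ N, 0 ≤ ε N) ∧
      ∀ (h μ t : ℝ) (N : ℕ), 0 < h → h ≤ h₀ → 1 ≤ N → K ≤ N * h → turn V h μ t = 2 * π * N →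
        1 ≤ μ ∧ |√μ - (N * h + ∑ k ∈ Finset.Icc 1 (r + 1), eigenvalueCoeff r k h V / (N * h) ^ k)| ≤
          C / (N * h) ^ (r + 2) + h ^ r * ε N / (N * h) ^ (r + 1) := by
  obtain ⟨C₁, Λ, ε, hC₁, hΛ, hε, hε0, hphase⟩ := exists_phase_expansion hV hr hper h₀
  obtain ⟨C₂, K, hC₂, hK, hinv⟩ := exists_inversion (n := r + 1) (a := phaseCoeff)
    (fun _ hk => isDiffPolyFunctional_phaseCoeff hr hk) V h₀
  obtain ⟨M, hM0, hM⟩ := hV.exists_bound hper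
  have hM' : ∀ x, |V x| ≤ M := fun x => by simpa using hM 0 (by omega) x
  set Λ' := max Λ K with hΛ'
  have hΛ1 : 1 ≤ Λ' := hΛ.trans (le_max_left _ _)
  -- The powers of 2 come from `N h ≤ 2 lam`, which replaces negative powers of `lam` by those of `N
  -- h`.
  refine ⟨2 * (2 ^ (r + 2) * C₁) + C₂, √(Λ' ^ 2 + M) + |h₀| / 2 + K,
    fun N => 2 * (2 ^ (r + 1) * ε N), by positivity, by positivity, ?_,
    fun N => by have := hε0 N; positivity, ?_⟩
  · simpa using (hε.const_mul ((2 : ℝ) ^ (r + 1))).const_mul 2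
  intro h μ t N hh hh₀ hN hKN ht
  have h1 : Λ' ^ 2 ≤ μ := sq_le_of_turn_eq hV.continuous hM' (by linarith) hh
    (hh₀.trans (le_abs_self h₀)) (by linarith) ht
  have h2 : Λ' ≤ √μ := Real.le_sqrt_of_sq_le h1
  have hμ1 : 1 ≤ μ := (one_le_pow₀ hΛ1).trans h1
  refine ⟨hμ1, ?_⟩
  set lam := √μ with hlam
  set x := (N : ℝ) * h with hx
  have hlam0 : 0 < lam := by linarith
  have hsq : lam ^ 2 = μ := Real.sq_sqrt (by linarith)
  rw [← hsq] at ht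
  obtain ⟨h3, h4⟩ := hphase h lam t N hh hh₀ ((le_max_left _ _).trans h2) hN ht
  have hKx : K ≤ x := by
    have : 0 ≤ √(Λ' ^ 2 + M) + |h₀| / 2 := by positivity
    linarith
  have hx0 : 0 < x := by linarith
  have h5 := hinv h hh hh₀ lam x _ ((le_max_right _ _).trans h2) hKx h4
  refine h5.trans ?_
  have hε1 := hε0 N
  have h6 : ∀ (c : ℝ) (k : ℕ), 0 ≤ c → c / lam ^ k ≤ 2 ^ k * c / x ^ k := by
    intro c k hc
    rw [div_le_div_iff₀ (pow_pos hlam0 k) (pow_pos hx0 k), mul_comm (2 ^ k) c, mul_assoc,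
      ← mul_pow]
    gcongr
  have h7 := h6 C₁ (r + 2) hC₁
  have h8 := h6 (h ^ r * ε N) (r + 1) (by positivity)
  calc _ ≤ 2 * (2 ^ (r + 2) * C₁ / x ^ (r + 2) + 2 ^ (r + 1) * (h ^ r * ε N) / x ^ (r + 1)) +
        C₂ / x ^ (r + 1 + 1) := by gcongr
    _ = _ := by ring

theorem expansion_eq (r : ℕ) (A : ℕ → ℝ) (h : ℝ) (m : ℕ) : expansion r A h m =
    ((m + 1 : ℕ) : ℝ) * h + ∑ k ∈ Finset.Icc 1 (r + 1), A k / (((m + 1 : ℕ) : ℝ) * h) ^ k := by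
  simp only [expansion, mul_pow]
  push_cast
  rfl

theorem exists_eigenvalue_expansion (hV : HasPiecewiseContinuousDeriv r V) (hr : 1 ≤ r)
    (hper : Function.Periodic V (2 * π)) (h₀ : ℝ) :
    ∃ (C K : ℝ) (ε : ℕ → ℝ), 0 ≤ C ∧ 0 < K ∧ Tendsto ε atTop (𝓝 0) ∧
      ∀ h : ℝ, 0 < h → h ≤ h₀ → ∀ m : ℕ, K ≤ m * h → ∀ j : ℕ, j = 1 ∨ j = 2 →
        0 < eigenvalue V h (2 * m + j) ∧
        |√(eigenvalue V h (2 * m + j)) - expansion r (fun k => eigenvalueCoeff r k h V) h m| ≤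
          C / ((m : ℝ) ^ (r + 2) * h ^ (r + 2)) +
            ε m / ((m : ℝ) ^ (r + 1) * h ^ max 1 (r - 2)) := by
  obtain ⟨C, K, ε, hC, hK, hε, hε0, hexp⟩ := exists_sqrt_expansion hV hr hper h₀
  obtain ⟨M, -, hM⟩ := hV.exists_bound hper
  have hM' : ∀ x, |V x| ≤ M := fun x => by simpa using hM 0 (by omega) x
  -- The error obtained is `ε / (m^(r+1) h)`. Writing `1 / h` as `h^(q-1) / h^q` with `q = max 1 (r
  -- - 2)` and bounding `h^(q-1)` by `|h₀|^(q-1)` gives the stated weaker form.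
  refine ⟨C, K, fun m => |h₀| ^ (max 1 (r - 2) - 1) * ε (m + 1), hC, hK, ?_, ?_⟩
  · simpa using ((tendsto_add_atTop_iff_nat 1).2 hε).const_mul (|h₀| ^ (max 1 (r - 2) - 1))
  intro h hh hh₀ m hKm j hj
  have hm : 0 < m := by
    rcases Nat.eq_zero_or_pos m with h1 | h1
    · rw [h1, Nat.cast_zero, zero_mul] at hKm; linarith
    · exact h1
  have hm0 : (0 : ℝ) < m := by exact_mod_cast hm
  set x := ((m + 1 : ℕ) : ℝ) * h with hx
  have hmx : m * h ≤ x := by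
    rw [hx]; push_cast; gcongr; linarith
  rw [expansion_eq, ← hx]
  set T := x + ∑ k ∈ Finset.Icc 1 (r + 1), eigenvalueCoeff r k h V / x ^ k with hT
  set e := C / x ^ (r + 2) + h ^ r * ε (m + 1) / x ^ (r + 1) with he
  -- The maxima keep the bases nonnegative so that squaring is monotone; the 1 also yields
  -- positivity of the eigenvalue.
  have h1 := eigenvalue_mem_Icc (L := (max 1 (T - e)) ^ 2) (U := (max 0 (T + e)) ^ 2)
    hV.continuous hper hM' hh (m := m) (fun μ t ht => by
      obtain ⟨h2, h3⟩ := hexp h μ t (m + 1) hh hh₀ (by omega) (hKm.trans hmx) ht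
      rw [← hx, ← hT, ← he] at h3
      have h4 := abs_le.1 h3
      rw [← Real.sq_sqrt (by linarith : 0 ≤ μ)]
      refine ⟨pow_le_pow_left₀ (by positivity) (max_le (Real.one_le_sqrt.2 h2) (by linarith)) 2,
        pow_le_pow_left₀ (Real.sqrt_nonneg μ) (le_max_of_le_right (by linarith)) 2⟩) hj
  have h2 : max 1 (T - e) ≤ √(eigenvalue V h (2 * m + j)) := Real.le_sqrt_of_sq_le h1.1
  have h3 : √(eigenvalue V h (2 * m + j)) ≤ max 0 (T + e) :=
    Real.sqrt_le_iff.2 ⟨le_max_left _ _, h1.2⟩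
  have h4 : (1 : ℝ) ≤ √(eigenvalue V h (2 * m + j)) := (le_max_left _ _).trans h2
  have h5 : √(eigenvalue V h (2 * m + j)) ≤ T + e := by
    rcases le_max_iff.1 h3 with h6 | h6
    · linarith
    · exact h6
  have h6 : T - e ≤ √(eigenvalue V h (2 * m + j)) := (le_max_right _ _).trans h2
  refine ⟨Real.sqrt_pos.1 (by linarith), (abs_le.2 ⟨by linarith, by linarith⟩ :
    |√(eigenvalue V h (2 * m + j)) - T| ≤ e).trans ?_⟩
  have hε1 := hε0 (m + 1)
  refine add_le_add ?_ ?_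
  · rw [← mul_pow]; gcongr
  · set q := max 1 (r - 2) with hq
    have hq1 : h ^ q = h ^ (q - 1) * h := by
      rw [← pow_succ, Nat.sub_add_cancel (le_max_left _ _)]
    have h7 : h ^ (q - 1) ≤ |h₀| ^ (q - 1) :=
      pow_le_pow_left₀ hh.le (hh₀.trans (le_abs_self _)) _
    calc h ^ r * ε (m + 1) / x ^ (r + 1) ≤ h ^ r * ε (m + 1) / (m * h) ^ (r + 1) := by gcongr
      _ = h ^ (q - 1) * ε (m + 1) / ((m : ℝ) ^ (r + 1) * h ^ q) := by
        rw [hq1, mul_pow, pow_succ h r]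
        field_simp
      _ ≤ |h₀| ^ (q - 1) * ε (m + 1) / ((m : ℝ) ^ (r + 1) * h ^ q) := by gcongr

/-- A number bounded by `a + b` is a sum of numbers bounded by `a` and by `b`. -/
theorem abs_clamp_le {T a b : ℝ} (ha : 0 ≤ a) (hb : 0 ≤ b) (hT : |T| ≤ a + b) :
    |max (-a) (min a T)| ≤ a ∧ |T - max (-a) (min a T)| ≤ b := by
  have h1 := abs_le.1 hT
  rcases le_total a T with h2 | h2
  · rw [min_eq_left h2, max_eq_right (by linarith), abs_of_nonneg ha, abs_of_nonneg (by linarith)]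
    exact ⟨le_rfl, by linarith⟩
  · rw [min_eq_right h2]
    rcases le_total (-a) T with h3 | h3
    · rw [max_eq_right h3, sub_self, abs_zero]
      exact ⟨abs_le.2 ⟨h3, h2⟩, hb⟩
    · rw [max_eq_left h3, abs_neg, abs_of_nonneg ha]
      exact ⟨le_rfl, abs_le.2 ⟨by linarith, by linarith⟩⟩

end
end PeriodicSL

theorem theoremA4 (r : ℕ) (hr : 1 ≤ r) :
    ∃ A : ℕ → ℝ → (ℝ → ℝ) → ℝ,
      -- the coefficients `A k h V` do not depend on `m`; they involve only `h` and
      -- `V, V', …, V^(r-1)`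
      (∀ k, 1 ≤ k → k ≤ r + 1 → PeriodicSL.IsDiffPolyFunctional r (A k)) ∧
      (∀ h V, A 1 h V = 1 / (4 * π) * ∫ x in (-π)..π, V x) ∧
      (∀ h V, A 2 h V = 0) ∧
      (2 ≤ r → ∀ h V, A 3 h V = 1 / (16 * π) * (∫ x in (-π)..π, V x ^ 2) - A 1 h V ^ 2) ∧
      ∀ V : ℝ → ℝ, Function.Periodic V (2 * π) → PeriodicSL.HasPiecewiseContinuousDeriv r V →
        -- for each `h > 0`, as `m → ∞`
        (∀ h : ℝ, 0 < h → ∀ j : ℕ, j = 1 ∨ j = 2 →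
          ∃ E₁ E₂ : ℕ → ℝ,
            E₁ =O[atTop] (fun m : ℕ => 1 / ((m : ℝ) ^ (r + 2) * h ^ (r + 2))) ∧
            E₂ =o[atTop] (fun m : ℕ => 1 / ((m : ℝ) ^ (r + 1) * h ^ ((r : ℤ) - 2))) ∧
            ∀ᶠ m : ℕ in atTop,
              0 < PeriodicSL.eigenvalue V h (2 * m + j) ∧
              √(PeriodicSL.eigenvalue V h (2 * m + j)) =
                PeriodicSL.expansion r (fun k => A k h V) h m + E₁ m + E₂ m) ∧
        -- uniformly in `0 < h ≤ h₀` and `m h ≥ K`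
        (∀ h₀ : ℝ, 0 < h₀ →
          ∃ (C K : ℝ) (ε : ℕ → ℝ), 0 < K ∧ Tendsto ε atTop (𝓝 0) ∧
            ∀ h : ℝ, 0 < h → h ≤ h₀ → ∀ m : ℕ, K ≤ m * h → ∀ j : ℕ, j = 1 ∨ j = 2 →
              0 < PeriodicSL.eigenvalue V h (2 * m + j) ∧
              |√(PeriodicSL.eigenvalue V h (2 * m + j)) -
                  PeriodicSL.expansion r (fun k => A k h V) h m| ≤
                C / ((m : ℝ) ^ (r + 2) * h ^ (r + 2)) +
                  ε m / ((m : ℝ) ^ (r + 1) * h ^ max 1 (r - 2))) := by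
  refine ⟨PeriodicSL.eigenvalueCoeff r,
    fun k _ _ => PeriodicSL.isDiffPolyFunctional_eigenvalueCoeff hr k,
    PeriodicSL.eigenvalueCoeff_one hr, PeriodicSL.eigenvalueCoeff_two hr,
    PeriodicSL.eigenvalueCoeff_three, fun V hper hV => ⟨fun h hh j hj => ?_, fun h₀ _ => ?_⟩⟩
  -- For a fixed `h` the uniform estimate is used with `h₀ = h`.
  · obtain ⟨C, K, ε, hC, hK, hε, hexp⟩ := PeriodicSL.exists_eigenvalue_expansion hV hr hper h
    set T : ℕ → ℝ := fun m => √(PeriodicSL.eigenvalue V h (2 * m + j)) -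
      PeriodicSL.expansion r (fun k => PeriodicSL.eigenvalueCoeff r k h V) h m with hT
    set a : ℕ → ℝ := fun m => C / ((m : ℝ) ^ (r + 2) * h ^ (r + 2)) with ha
    set b : ℕ → ℝ := fun m => |ε m| / ((m : ℝ) ^ (r + 1) * h ^ max 1 (r - 2)) with hb
    have hev : ∀ᶠ m : ℕ in atTop, K ≤ m * h :=
      (tendsto_natCast_atTop_atTop.atTop_mul_const hh).eventually_ge_atTop K
    have hsplit : ∀ᶠ m : ℕ in atTop,
        |max (-a m) (min (a m) (T m))| ≤ a m ∧ |T m - max (-a m) (min (a m) (T m))| ≤ b m := by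
      filter_upwards [hev] with m hm
      refine PeriodicSL.abs_clamp_le (by positivity) (by positivity)
        ((hexp h hh le_rfl m hm j hj).2.trans ?_)
      have := le_abs_self (ε m)
      simp only [ha, hb]
      gcongr
    -- The total error is split by truncating it to `[-a m, a m]`: the truncation is the `O` term,
    -- and the excess, bounded by `b m`, is the `o` term.
    refine ⟨fun m => max (-a m) (min (a m) (T m)), fun m => T m - max (-a m) (min (a m) (T m)),
      ?_, ?_, ?_⟩
    · refine IsBigO.of_bound C ?_
      filter_upwards [hsplit] with m hm
      rw [Real.norm_eq_abs, Real.norm_eq_abs,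
        abs_of_nonneg (by positivity : 0 ≤ 1 / ((m : ℝ) ^ (r + 2) * h ^ (r + 2))), mul_one_div]
      exact hm.1
    · have h1 : (fun m => T m - max (-a m) (min (a m) (T m))) =O[atTop] b := by
        refine IsBigO.of_bound 1 ?_
        filter_upwards [hsplit] with m hm
        rw [one_mul, Real.norm_eq_abs, Real.norm_eq_abs]
        exact hm.2.trans (le_abs_self _)
      refine h1.trans_isLittleO ?_
      -- For fixed `h` the two powers of `h` differ by a constant factor. The integer exponent
      -- matters for `r = 1`, where natural subtraction would truncate.
      have h2 : b = fun m => (|ε m| * (h ^ ((r : ℤ) - 2) / h ^ max 1 (r - 2))) *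
          (1 / ((m : ℝ) ^ (r + 1) * h ^ ((r : ℤ) - 2))) := by
        funext m
        simp only [hb]
        have : h ^ ((r : ℤ) - 2) ≠ 0 := (zpow_pos hh _).ne'
        rcases eq_or_ne ((m : ℝ) ^ (r + 1)) 0 with h3 | h3
        · simp [h3]
        · field_simp
      rw [h2]
      have h3 : (fun m => |ε m| * (h ^ ((r : ℤ) - 2) / h ^ max 1 (r - 2))) =o[atTop]
          fun _ => (1 : ℝ) := by
        rw [isLittleO_one_iff]
        simpa using hε.abs.mul_const (h ^ ((r : ℤ) - 2) / h ^ max 1 (r - 2))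
      simpa using h3.mul_isBigO (isBigO_refl
        (fun m : ℕ => 1 / ((m : ℝ) ^ (r + 1) * h ^ ((r : ℤ) - 2))) atTop)
    · filter_upwards [hev] with m hm
      refine ⟨(hexp h hh le_rfl m hm j hj).1, ?_⟩
      simp only [hT]
      ring
  · obtain ⟨C, K, ε, -, hK, hε, hexp⟩ := PeriodicSL.exists_eigenvalue_expansion hV hr hper h₀
    exact ⟨C, K, ε, hK, hε, hexp⟩
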